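/- **Setting.** Let $g\ge 0$ and $v\ge 1$ be integers with $2g-2+v>0$, and let $b,c\in\mathbb R$ with $b\ge 0$, $c>0$. For $\mu_1,\dots,\mu_v\ge 0$ let $C_{g,v}(\mu_1,\dots,\mu_v)$ be the generalized Catalan number: the number, up to orientation-preserving equivalence, of graphs drawn on the closed connected oriented surface of genus $g$ that give a cell decomposition of it, have $v$ labelled vertices, the $i$-th of degree $\mu_i$, and carry at each vertex of positive degree an arrow on one of the half-edges incident to it. Define $$\widetilde M_{g,v}(n_1,\dots,n_v;b,c)=\sum_{\mu_1=0}^{n_1}\cdots\sum_{\mu_v=0}^{n_v}\ \prod_{i=1}^v\binom{n_i}{\mu_i}\; C_{g,v}(\mu_1,\dots,\mu_v)\,b^{\sum_i n_i-\sum_i\mu_i}\,c^{\sum_i\mu_i},$$ $$F_{g,v}^{\widetilde M(b,c)}(x_1,\dots,x_v)=\sum_{n_1,\dots,n_v\ge 1}\frac{\widetilde M_{g,v}(n_1,\dots,n_v;b,c)}{n_1\cdots n_v}\,x_1^{-n_1}\cdots x_v^{-n_v},$$ and introduce variables $t_i$ by $\frac{x_i-b}{c}=2+\frac{4}{t_i^2-1}$,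 where the branch with $\operatorname{Re} t_i<0$ is taken (so that $x_i=\infty$ corresponds to $t_i=-1$). **Statement.** There is a Laurent polynomial $P\in\mathbb C[t_1^{\pm1},\dots,t_v^{\pm1}]$ such that: 1. the series $F_{g,v}^{\widetilde M(b,c)}(x_1,\dots,x_v)$ converges absolutely and equals $P(t_1,\dots,t_v)$ whenever, for all $i$, $\operatorname{Re}t_i<0$, $t_i\ne-1$ and $|x_i|>b+2c$; that is, $F_{g,v}^{\widetilde M(b,c)}(t_1,\dots,t_v)=P(t_1,\dots,t_v)$ is a Laurent polynomial in the $t_i$; 2. $P$ has total degree exactly $3(2g-2+v)$: this is the maximum of $a_1+\cdots+a_v$ over the monomials $t_1^{a_1}\cdots t_v^{a_v}$ occurring in $P$; 3. $P(1/t_1,\dots,1/t_v)=P(t_1,\dots,t_v)$ for all $t_1,\dots,t_v\in\mathbb C\setminus\{0\}$. -/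

import Mathlib

noncomputable section

namespace BCMotzkin

/-- The half-edges of a graph on an oriented surface with `v` labelled vertices, the `i`-th one of
degree `μ i`. The half-edge `⟨i, k⟩` is the one met after `k` steps when one walks counterclockwise
around vertex `i`, starting from the arrowed half-edge `⟨i, 0⟩`. -/
abbrev HalfEdge {v : ℕ} (μ : Fin v → ℕ) : Type := Σ i : Fin v, Fin (μ i)

/-- Sends a half-edge to the next one counterclockwise around its vertex. -/
def rotation {v : ℕ} (μ : Fin v → ℕ) : Equiv.Perm (HalfEdge μ) :=
  Equiv.sigmaCongrRight fun i => finRotate (μ i)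

/-- The graph on the vertices (loops and multiplicities forgotten) obtained by gluing each half-edge
`h` to the half-edge `α h`. -/
def vertexGraph {v : ℕ} (μ : Fin v → ℕ) (α : Equiv.Perm (HalfEdge μ)) : SimpleGraph (Fin v) :=
  SimpleGraph.fromRel fun i j => ∃ h : HalfEdge μ, h.1 = i ∧ (α h).1 = j

/-- The number of faces (boundary components of the ribbon graph): one for each orbit of
"cross the edge, then turn counterclockwise" on the half-edges, and one around each vertex
of degree `0`, whose ribbon neighbourhood is a disc. -/
def faceCount {v : ℕ} (μ : Fin v → ℕ) (α : Equiv.Perm (HalfEdge μ)) : ℕ :=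
  Nat.card (Quotient (Equiv.Perm.SameCycle.setoid (rotation μ * α))) + Nat.card {i : Fin v // μ i = 0}

/-- `α` glues the half-edges into the edges of a Catalan graph of degree `μ` on the closed connected
oriented surface of genus `g`: a connected graph giving a cell decomposition of that surface. Since
the vertices are labelled and one half-edge at every vertex (of positive degree) is arrowed, every
half-edge has a canonical name, and two different `α` give non-isomorphic Catalan graphs. -/
structure IsCatalanGraph {v : ℕ} (g : ℕ) (μ : Fin v → ℕ) (α : Equiv.Perm (HalfEdge μ)) : Prop where
  involutive : ∀ h, α (α h) = h
  fixedPointFree : ∀ h, α h ≠ h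
  connected : (vertexGraph μ α).Connected
  /-- Euler's formula `V - E + F = 2 - 2 g`. -/
  euler : (v : ℤ) - ((∑ i, μ i) / 2 : ℕ) + faceCount μ α = 2 - 2 * g

/-- The generalized Catalan number `C_{g,v}(μ_1, …, μ_v)`. -/
def genCatalan (g : ℕ) {v : ℕ} (μ : Fin v → ℕ) : ℕ :=
  Nat.card {α : Equiv.Perm (HalfEdge μ) // IsCatalanGraph g μ α}

/-- The generalized `bc`-Motzkin number `M̃_{g,v}(n_1, …, n_v; b, c)`. -/
def genMotzkin (g : ℕ) {v : ℕ} (b c : ℝ) (n : Fin v → ℕ) : ℝ :=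
  ∑ μ ∈ Fintype.piFinset fun i => Finset.range (n i + 1),
    (∏ i, ((n i).choose (μ i) : ℝ)) * genCatalan g μ *
      b ^ ((∑ i, n i) - ∑ i, μ i) * c ^ (∑ i, μ i)

/-- The general term of the series defining the discrete Laplace transform. -/
def laplaceTerm (g : ℕ) {v : ℕ} (b c : ℝ) (x : Fin v → ℂ) (n : Fin v → ℕ+) : ℂ :=
  (genMotzkin g b c (fun i => (n i : ℕ)) : ℂ) / (∏ i, ((n i : ℕ) : ℂ)) *
    ∏ i, x i ^ (-((n i : ℕ) : ℤ))

/-- The discrete Laplace transform `F_{g,v}^{M̃(b,c)}(x_1, …, x_v)`; it has an additional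
logarithmic term for `(g, v) = (0, 1)`. -/
def discreteLaplace (g : ℕ) {v : ℕ} (b c : ℝ) (x : Fin v → ℂ) : ℂ :=
  (∑' n : Fin v → ℕ+, laplaceTerm g b c x n) -
    if g = 0 ∧ v = 1 then (genMotzkin 0 b c (fun _ : Fin v => 0) : ℂ) * ∑ i, Complex.log (x i)
    else 0

/-- The change of variable `(x - b) / c = 2 + 4 / (t ^ 2 - 1)`, solved for `x`. -/
def xOfT (b c : ℝ) (t : ℂ) : ℂ := b + c * (2 + 4 / (t ^ 2 - 1))

/-- Laurent polynomials in `v` variables over `ℂ`: the exponents are the vectors in `ℤ ^ v`. -/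
abbrev MvLaurent (v : ℕ) : Type := AddMonoidAlgebra ℂ (Fin v → ℤ)

/-- Evaluation of a Laurent polynomial at a point. -/
def MvLaurent.eval {v : ℕ} (P : MvLaurent v) (t : Fin v → ℂ) : ℂ :=
  P.coeff.sum fun a r => r * ∏ i, t i ^ a i

/-- `P` is nonzero of total degree `d`: the maximum of `a_1 + ⋯ + a_v` over the monomials
`t_1 ^ a_1 ⋯ t_v ^ a_v` that occur in `P` is `d`. -/
def MvLaurent.HasDegree {v : ℕ} (P : MvLaurent v) (d : ℤ) : Prop :=
  IsGreatest {k : ℤ | ∃ a ∈ P.coeff.support, k = ∑ i, a i} d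

end BCMotzkin

end

set_option linter.unusedSectionVars false

noncomputable section
open Equiv Equiv.Perm

namespace BCMotzkin

/-! ### Cycles of permutations, first return maps, products with a transposition -/

section Cycles
variable {D : Type} [Finite D]

/-! Graphs on surfaces are handled as rotation systems: a permutation σ turns around the vertices, a
fixed-point-free involution α glues the half-edges, and the cycles of σ * α are the faces, together
with one face around each isolated vertex. Contracting the edge that joins the arrowed half-edge a
of the root to b = α a replaces σ by the first return map of σ * swap a b on the remaining
half-edges and keeps the number of faces. If b sits at another vertex, that vertex merges with the
root; if b sits at the root, the root splits in two, and the result is connected or has two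
components. This is the recursion `gluings_conn_succ`; Euler's formula turns it into `cat_succ` for
the generalized Catalan numbers.

For the generating series in the degree of the root, the splittings that cut off a one-vertex sphere
move to the left-hand side and produce the factor r = √(1 - 4X²) (`rSer`). The good coordinate is u
= √((1 + 2X)/(1 - 2X)) (`uPow 1`), which is -t at X = c/(x - b), and the good series are e_k = X
d/dX (u^(2k+1)/(2k+1)) (`eSer`). Three facts drive the induction on 2g - 2 + v. A product X² e_k e_l
is r times a third difference of the e's (`X_sq_mul_eSer_mul_eSer`). The merging terms, taken
together with the splittings that cut off a two-vertex sphere, map e_k to r times a third difference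
of the sums of (2q+1) e_q ⊗ e_(a-1-q) (`cut_add`). The two initial cases are explicit: `wThree_eq`
for (g, v) = (0, 3) and `gf_one_of_isEmpty` for (1, 1). Hence C_{g,v}(μ) is a finite combination of
products of coefficients of the e_(k_i) (`exists_expansion`).

For the degree, a product is given the weight ∑ max(2k_i + 1, 0). Each step of the recursion adds
three to the weight, and the leading terms of the differences above have positive coefficients, so
nothing cancels in top weight. `cone` and `openCone` record this, and `gf_mem_openCone` is the
induction.

The Laplace transform then factors over the variables. The m-th coefficient of e_k is m/(2k+1) times
that of u^(2k+1), and (m/n) binom(n, m) = binom(n-1, m-1), so each factor sums to (u^(2k+1) -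
1)/(2k+1) at c/(x - b), that is to -(t^(2k+1) + 1)/(2k+1) (`hasSum_laplaceTerm`). In particular P
does not depend on b and c.

The symmetry is therefore read off at b = 0, c = 1. There t ↦ 1/t amounts to x ↦ -x, and the
transform is unchanged when all x_i change sign, since a gluing has an even number of half-edges.
This proves the identity at negative real t_i, and a Laurent polynomial identity extends from there.
-/

theorem rel_of_sameCycle {r : D → D → Prop} (hr : Equivalence r) {f : Perm D}
    (h : ∀ x, r x (f x)) {x y : D} (hxy : f.SameCycle x y) : r x y := by
  obtain ⟨n, rfl⟩ := hxy.exists_nat_pow_eq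
  clear hxy
  induction n with
  | zero => exact hr.refl x
  | succ n ih => rw [pow_succ', Perm.mul_apply]; exact hr.trans ih (h _)

theorem sameCycle_self_apply (f : Perm D) (x : D) : f.SameCycle x (f x) :=
  sameCycle_apply_right.2 (SameCycle.refl f x)

theorem some_removeNone (f : Perm (Option D)) (x : D) :
    (∃ y, f (some x) = some y ∧ removeNone f x = y) ∨
      (f (some x) = none ∧ f none = some (removeNone f x)) := by
  rcases h : f (some x) with _ | y
  · right; exact ⟨rfl, (removeNone_none f h).symm⟩
  · left
    refine ⟨y, rfl, ?_⟩
    have := removeNone_some f ⟨y, h⟩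
    rw [h] at this
    exact Option.some_injective _ this

/-- `removeNone f` is the first return map of f to the points other than `none`: it follows f and
skips `none`. So its cycles are those of f with `none` deleted. -/
theorem sameCycle_removeNone (f : Perm (Option D)) (x y : D) :
    SameCycle (removeNone f) x y ↔ f.SameCycle (some x) (some y) := by
  constructor
  · intro h
    refine rel_of_sameCycle (r := fun a b => f.SameCycle (some a) (some b))
      ⟨fun a => SameCycle.refl _ _, fun h => h.symm, fun h h' => h.trans h'⟩ ?_ h
    intro a
    rcases some_removeNone f a with ⟨z, h1, h2⟩ | ⟨h1, h2⟩
    · rw [h2, ← h1]; exact sameCycle_self_apply f _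
    · rw [← h2, ← h1, sameCycle_apply_right]; exact sameCycle_self_apply f _
  · intro h
    obtain ⟨n, hn⟩ := h.exists_nat_pow_eq
    clear h
    -- The induction is strong because one step of the return map through `none` uses two steps of
    -- f.
    induction n using Nat.strong_induction_on generalizing x with
    | _ n ih =>
      rcases n with _ | n
      · obtain rfl : x = y := by simpa using hn
        exact SameCycle.refl _ _
      rw [pow_succ, Perm.mul_apply] at hn
      rcases some_removeNone f x with ⟨z, h1, h2⟩ | ⟨h1, h2⟩
      · rw [h1] at hn
        have := ih n (by omega) z hn
        rw [← h2] at this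
        exact sameCycle_apply_left.1 this
      · rw [h1] at hn
        rcases n with _ | n
        · simp at hn
        rw [pow_succ, Perm.mul_apply, h2] at hn
        exact sameCycle_apply_left.1 (ih n (by omega) _ hn)

/-- The number of cycles of a permutation, fixed points included. -/
def numCycles (f : Perm D) : ℕ := Nat.card (Quotient (SameCycle.setoid f))

theorem numCycles_congr {D' : Type} {f : Perm D} {f' : Perm D'} (e : D ≃ D')
    (h : ∀ x y, f.SameCycle x y ↔ f'.SameCycle (e x) (e y)) : numCycles f = numCycles f' :=
  Nat.card_congr (Quotient.congr e h)

theorem numCycles_sumCongr {D' : Type} [Finite D'] (f : Perm D) (f' : Perm D') :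
    numCycles (Equiv.sumCongr f f') = numCycles f + numCycles f' := by
  have key : ∀ x y, SameCycle (Equiv.sumCongr f f') x y →
      Sum.LiftRel f.SameCycle f'.SameCycle x y := by
    intro x y h
    refine rel_of_sameCycle (f := Equiv.sumCongr f f') ⟨?_, ?_, ?_⟩ ?_ h
    · rintro (a | a) <;> simp [SameCycle.refl _ a]
    · rintro _ _ (⟨h⟩ | ⟨h⟩) <;> simp [SameCycle.symm h]
    · rintro _ _ _ (⟨h⟩ | ⟨h⟩) (⟨h'⟩ | ⟨h'⟩) <;> simp [h.trans h']
    · rintro (a | a) <;> simp [SameCycle.refl _ a]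
  have hl : ∀ x y, f.SameCycle x y → SameCycle (Equiv.sumCongr f f') (.inl x) (.inl y) := by
    intro x y h
    refine rel_of_sameCycle (f := f) (r := fun x y =>
      SameCycle (Equiv.sumCongr f f') (.inl x) (.inl y))
      ⟨fun _ => SameCycle.refl _ _, fun h => h.symm, fun h h' => h.trans h'⟩ (fun x => ?_) h
    exact sameCycle_self_apply (Equiv.sumCongr f f' : Perm (D ⊕ D')) (.inl x)
  have hr : ∀ x y, f'.SameCycle x y → SameCycle (Equiv.sumCongr f f') (.inr x) (.inr y) := by
    intro x y h
    refine rel_of_sameCycle (f := f') (r := fun x y =>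
      SameCycle (Equiv.sumCongr f f') (.inr x) (.inr y))
      ⟨fun _ => SameCycle.refl _ _, fun h => h.symm, fun h h' => h.trans h'⟩ (fun x => ?_) h
    exact sameCycle_self_apply (Equiv.sumCongr f f' : Perm (D ⊕ D')) (.inr x)
  unfold numCycles
  rw [← Nat.card_sum]
  symm
  refine Nat.card_eq_of_bijective (Sum.elim
    (Quotient.lift (fun x => Quotient.mk (SameCycle.setoid (Equiv.sumCongr f f' : Perm (D ⊕ D'))) (.inl x)) ?_)
    (Quotient.lift (fun x => Quotient.mk (SameCycle.setoid (Equiv.sumCongr f f' : Perm (D ⊕ D'))) (.inr x)) ?_)) ⟨?_, ?_⟩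
  · intro a b h; exact Quotient.sound (hl a b h)
  · intro a b h; exact Quotient.sound (hr a b h)
  · rintro (⟨⟨a⟩⟩ | ⟨⟨a⟩⟩) (⟨⟨b⟩⟩ | ⟨⟨b⟩⟩) h
    · have := key (.inl a) (.inl b) (Quotient.exact (s := SameCycle.setoid (Equiv.sumCongr f f')) h)
      exact congrArg Sum.inl (Quotient.sound (show f.SameCycle a b by simpa using this))
    · have := key (.inl a) (.inr b) (Quotient.exact (s := SameCycle.setoid (Equiv.sumCongr f f')) h); simp at this
    · have := key (.inr a) (.inl b) (Quotient.exact (s := SameCycle.setoid (Equiv.sumCongr f f')) h); simp at this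
    · have := key (.inr a) (.inr b) (Quotient.exact (s := SameCycle.setoid (Equiv.sumCongr f f')) h)
      exact congrArg Sum.inr (Quotient.sound (show f'.SameCycle a b by simpa using this))
  · rintro ⟨(a | a)⟩
    · exact ⟨.inl ⟦a⟧, rfl⟩
    · exact ⟨.inr ⟦a⟧, rfl⟩

-- Deleting a point destroys its cycle exactly when the point was fixed.
open Classical in
theorem numCycles_removeNone (f : Perm (Option D)) :
    numCycles f = numCycles (removeNone f) + if f none = none then 1 else 0 := by
  unfold numCycles
  split_ifs with h
  · rw [← Finite.card_option]
    symm
    refine Nat.card_eq_of_bijective (fun o => Option.elim o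
      (Quotient.mk (SameCycle.setoid f) none)
      (Quotient.lift (fun x => Quotient.mk (SameCycle.setoid f) (some x)) ?_)) ⟨?_, ?_⟩
    · intro a b hab
      exact Quotient.sound ((sameCycle_removeNone f a b).1 hab)
    · have hn : ∀ x : D, ¬ f.SameCycle none (some x) := fun x hx => by
        have := hx.eq_of_left h
        simp at this
      rintro (_ | ⟨⟨a⟩⟩) (_ | ⟨⟨b⟩⟩) hab
      · rfl
      · exact absurd (Quotient.exact hab) (hn _)
      · exact absurd (Quotient.exact hab).symm (hn _)
      · exact congrArg some (Quotient.sound ((sameCycle_removeNone f a b).2 (Quotient.exact hab)))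
    · rintro ⟨(_ | a)⟩
      · exact ⟨none, rfl⟩
      · exact ⟨some ⟦a⟧, rfl⟩
  · symm
    refine Nat.card_eq_of_bijective
      (Quotient.lift (fun x => Quotient.mk (SameCycle.setoid f) (some x)) ?_) ⟨?_, ?_⟩
    · intro a b hab
      exact Quotient.sound ((sameCycle_removeNone f a b).1 hab)
    · rintro ⟨a⟩ ⟨b⟩ hab
      exact Quotient.sound ((sameCycle_removeNone f a b).2 (Quotient.exact hab))
    · rintro ⟨(_ | a)⟩
      · obtain ⟨x, hx⟩ := Option.ne_none_iff_exists'.1 h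
        refine ⟨⟦x⟧, Quotient.sound ?_⟩
        change f.SameCycle _ _
        rw [← hx]
        exact (sameCycle_self_apply f none).symm
      · exact ⟨⟦a⟧, rfl⟩

/-- Return maps are not multiplicative in general. Here g fixes the deleted point, so a detour of f
* g through that point is a detour of f alone. -/
theorem removeNone_mul (f g : Perm (Option D)) (hg : g none = none) :
    removeNone (f * g) = removeNone f * removeNone g := by
  ext x
  rw [Perm.mul_apply]
  have hgx : g (some x) = some (removeNone g x) := by
    rcases some_removeNone g x with ⟨z, h1, h2⟩ | ⟨h1, h2⟩
    · rw [h1, h2]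
    · rw [hg] at h2; simp at h2
  rcases some_removeNone (f * g) x with ⟨z, h1, h2⟩ | ⟨h1, h2⟩ <;>
  rcases some_removeNone f (removeNone g x) with ⟨z', h3, h4⟩ | ⟨h3, h4⟩ <;>
  simp_all [Perm.mul_apply]

/-- If the orbit of `x` meets `a` but not `b`, multiplying by `swap a b` keeps `x` and `a` together. -/
theorem sameCycle_mul_swap_of_not [DecidableEq D] {f : Perm D} {a b x : D} (hx : f.SameCycle x a)
    (hb : ¬ f.SameCycle x b) : (f * swap a b).SameCycle x a := by
  obtain ⟨n, hn⟩ := hx.exists_nat_pow_eq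
  clear hx
  induction n generalizing x with
  | zero => rw [show x = a by simpa using hn]
  | succ n ih =>
    rw [pow_succ, Perm.mul_apply] at hn
    by_cases hxa : x = a
    · rw [hxa]
    have hxb : x ≠ b := fun h => hb (h ▸ SameCycle.refl _ _)
    have := ih (x := f x) (fun h => hb (sameCycle_apply_left.1 h)) hn
    rw [← sameCycle_apply_left, Perm.mul_apply, swap_apply_of_ne_of_ne hxa hxb]
    exact this

/-- Along the orbit of x, the permutations f and f * swap a b agree until a or b is reached. -/
theorem sameCycle_mul_swap_or [DecidableEq D] {f : Perm D} {a b x : D} (hx : f.SameCycle x a) :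
    (f * swap a b).SameCycle x a ∨ (f * swap a b).SameCycle x b := by
  obtain ⟨n, hn⟩ := hx.exists_nat_pow_eq
  clear hx
  induction n generalizing x with
  | zero => rw [show x = a by simpa using hn]; left; rfl
  | succ n ih =>
    rw [pow_succ, Perm.mul_apply] at hn
    by_cases hxa : x = a
    · rw [hxa]; left; rfl
    by_cases hxb : x = b
    · rw [hxb]; right; rfl
    have := ih (x := f x) hn
    rw [← sameCycle_apply_left, ← sameCycle_apply_left (y := b), Perm.mul_apply,
      swap_apply_of_ne_of_ne hxa hxb]
    exact this

theorem sameCycle_mul_swap [DecidableEq D] {f : Perm D} {a b : D} (h : ¬ f.SameCycle a b) :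
    (f * swap a b).SameCycle a b := by
  have h1 : (f * swap b a).SameCycle (f b) b :=
    sameCycle_mul_swap_of_not (sameCycle_apply_left.2 (SameCycle.refl _ _))
      fun h' => h (sameCycle_apply_left.1 h').symm
  rw [swap_comm] at h1
  rw [← sameCycle_apply_left, Perm.mul_apply, swap_apply_left]
  exact h1

/-- Points away from the two cycles met by a transposition stay in the same cycle. -/
theorem sameCycle_mul_swap_of_sameCycle [DecidableEq D] {f : Perm D} {a b x y : D}
    (ha : ¬ f.SameCycle x a) (hb : ¬ f.SameCycle x b) (hxy : f.SameCycle x y) :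
    (f * swap a b).SameCycle x y := by
  obtain ⟨n, hn⟩ := hxy.exists_nat_pow_eq
  clear hxy
  induction n generalizing x with
  | zero => rw [show x = y by simpa using hn]
  | succ n ih =>
    rw [pow_succ, Perm.mul_apply] at hn
    have hxa : x ≠ a := fun h => ha (h ▸ SameCycle.refl _ _)
    have hxb : x ≠ b := fun h => hb (h ▸ SameCycle.refl _ _)
    have := ih (x := f x) (fun h => ha (sameCycle_apply_left.1 h))
      (fun h => hb (sameCycle_apply_left.1 h)) hn
    rw [← sameCycle_apply_left, Perm.mul_apply, swap_apply_of_ne_of_ne hxa hxb]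
    exact this

end Cycles

/-! ### Rotation systems, faces and gluings -/

section RotationSystems
variable {D D' V V' : Type}

/-- `σ` turns around the vertices of a graph whose half-edge `x` sits at the vertex `p x`. -/
def IsRot (p : D → V) (σ : Perm D) : Prop := ∀ x y, σ.SameCycle x y ↔ p x = p y

theorem IsRot.apply {p : D → V} {σ : Perm D} (h : IsRot p σ) (x : D) : p (σ x) = p x :=
  ((h _ _).1 (sameCycle_apply_right.2 (SameCycle.refl σ x))).symm

theorem IsRot.removeNone [Finite D] {p : Option D → V} {σ : Perm (Option D)} (h : IsRot p σ) :
    IsRot (fun x => p (some x)) (removeNone σ) := fun x y => by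
  rw [sameCycle_removeNone, h]

/-- The number of faces when `φ` walks around the faces. -/
def numFaces (p : D → V) (φ : Perm D) : ℕ := numCycles φ + (Set.range p)ᶜ.ncard

/-- A cycle is lost only when `none` is the sole half-edge at its vertex. That vertex then becomes
isolated and contributes a face of its own, so the total is unchanged. -/
theorem numFaces_removeNone [Finite D] [Finite V] {p : Option D → V} {σ β : Perm (Option D)}
    (h : IsRot p σ) (hβ : β none = none) :
    numFaces p (σ * β) = numFaces (fun x => p (some x)) (removeNone σ * removeNone β) := by
  unfold numFaces
  rw [numCycles_removeNone, removeNone_mul _ _ hβ, Perm.mul_apply, hβ]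
  split_ifs with hn
  · have h1 : p none ∉ Set.range fun x => p (some x) := by
      rintro ⟨x, hx⟩
      have := ((h _ _).2 hx).eq_of_right hn
      simp at this
    have h2 : (Set.range fun x => p (some x))ᶜ = insert (p none) (Set.range p)ᶜ := by
      ext v
      simp only [Set.mem_compl_iff, Set.mem_range, Set.mem_insert_iff, Option.exists, not_or]
      constructor
      · intro hv
        by_cases hvn : v = p none
        · exact Or.inl hvn
        · exact Or.inr ⟨fun h => hvn h.symm, hv⟩
      · rintro (rfl | ⟨-, hv⟩)
        · exact h1
        · exact hv
    rw [h2, Set.ncard_insert_of_notMem (by simp)]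
    omega
  · have h2 : (Set.range fun x => p (some x)) = Set.range p := by
      ext v
      simp only [Set.mem_range, Option.exists]
      refine ⟨Or.inr, ?_⟩
      rintro (rfl | h')
      · obtain ⟨x, hx⟩ := Option.ne_none_iff_exists'.1 hn
        exact ⟨x, by rw [← hx, h.apply]⟩
      · exact h'
    rw [h2, add_zero]

/-- Two vertices are linked if an edge joins them. -/
def Linked (p : D → V) (α : Perm D) (a b : V) : Prop := ∃ x, p x = a ∧ p (α x) = b

/-- The relation `R` connects any two vertices. -/
def Conn (R : V → V → Prop) : Prop := ∀ a b, Relation.EqvGen R a b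

/-- A gluing of the half-edges with `F` faces whose adjacency relation satisfies `Q`. -/
structure IsGluing (p : D → V) (σ : Perm D) (Q : (V → V → Prop) → Prop) (F : ℕ) (α : Perm D) :
    Prop where
  inv : ∀ x, α (α x) = x
  ne : ∀ x, α x ≠ x
  adj : Q (Linked p α)
  faces : numFaces p (σ * α) = F

/-- The number of gluings. -/
def cnt (p : D → V) (σ : Perm D) (Q : (V → V → Prop) → Prop) (F : ℕ) : ℕ :=
  Nat.card {α : Perm D // IsGluing p σ Q F α}

theorem isGluing_permCongr_iff [Finite D] (e : D ≃ D') (e' : V ≃ V') {p : D → V} {p' : D' → V'} {σ : Perm D} {σ' : Perm D'}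
    (hp : ∀ x, p' (e x) = e' (p x)) (hσ : ∀ x, σ' (e x) = e (σ x))
    {Q : (V → V → Prop) → Prop} {Q' : (V' → V' → Prop) → Prop}
    (hQ : ∀ R, Q' R ↔ Q fun a b => R (e' a) (e' b)) {F : ℕ} {α : Perm D} :
    IsGluing p σ Q F α ↔ IsGluing p' σ' Q' F (e.permCongr α) := by
  have h1 : (fun a b => Linked p' (e.permCongr α) (e' a) (e' b)) = Linked p α := by
    ext a b
    constructor
    · rintro ⟨x, h1, h2⟩
      obtain ⟨x, rfl⟩ := e.surjective x
      refine ⟨x, ?_, ?_⟩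
      · rw [hp] at h1; exact e'.injective h1
      · simp only [permCongr_apply, symm_apply_apply] at h2
        rw [hp] at h2; exact e'.injective h2
    · rintro ⟨x, rfl, rfl⟩
      exact ⟨e x, by simp [hp], by simp [hp]⟩
  have h2 : numFaces p' (σ' * e.permCongr α) = numFaces p (σ * α) := by
    have hσ2 : σ' = e.permCongr σ := by
      ext x
      obtain ⟨x, rfl⟩ := e.surjective x
      simp [hσ]
    have h3 : σ' * e.permCongr α = e.permCongr (σ * α) := by
      rw [hσ2]; ext x; simp [permCongr_apply]
    unfold numFaces
    congr 1
    · rw [h3]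
      symm
      refine numCycles_congr e fun x y => ?_
      simp only [SameCycle]
      refine exists_congr fun i => ?_
      have : (e.permCongr (σ * α)) ^ i = e.permCongr ((σ * α) ^ i) := (map_zpow e.permCongrHom _ _).symm
      rw [this]
      simp [permCongr_apply]
    · have : (Set.range p')ᶜ = e' '' (Set.range p)ᶜ := by
        rw [Set.image_compl_eq e'.bijective]
        congr 1
        ext v
        simp only [Set.mem_range, Set.mem_image, exists_exists_eq_and]
        rw [← e.exists_congr_right]
        simp [hp]
      rw [this, Set.ncard_image_of_injective _ e'.injective]
  constructor
  · rintro ⟨a1, a2, a3, a4⟩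
    refine ⟨fun x => ?_, fun x => ?_, ?_, ?_⟩
    · simp [permCongr_apply, a1]
    · obtain ⟨x, rfl⟩ := e.surjective x
      simp [permCongr_apply, a2]
    · rw [hQ, h1]; exact a3
    · rw [h2]; exact a4
  · rintro ⟨a1, a2, a3, a4⟩
    refine ⟨fun x => ?_, fun x => ?_, ?_, ?_⟩
    · simpa [permCongr_apply] using a1 (e x)
    · simpa [permCongr_apply] using a2 (e x)
    · rw [hQ, h1] at a3; exact a3
    · rw [h2] at a4; exact a4

theorem cnt_congr [Finite D] (e : D ≃ D') (e' : V ≃ V') {p : D → V} {p' : D' → V'} {σ : Perm D} {σ' : Perm D'}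
    (hp : ∀ x, p' (e x) = e' (p x)) (hσ : ∀ x, σ' (e x) = e (σ x))
    (Q : (V → V → Prop) → Prop) (Q' : (V' → V' → Prop) → Prop)
    (hQ : ∀ R, Q' R ↔ Q fun a b => R (e' a) (e' b)) (F : ℕ) :
    cnt p σ Q F = cnt p' σ' Q' F :=
  Nat.card_congr (e.permCongr.subtypeEquiv fun _ => isGluing_permCongr_iff e e' hp hσ hQ)

/-- A rotation acts on the half-edges at one vertex like a rotation of `Fin n`. -/
theorem IsRot.exists_equiv_fin [Finite D] {p : D → V} {σ : Perm D} (h : IsRot p σ) (v : V) {n : ℕ}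
    (hn : Nat.card {x // p x = v} = n) :
    ∃ e : Fin n ≃ {x // p x = v}, ∀ k, (e (finRotate n k) : D) = σ (e k) := by
  classical
  have := Fintype.ofFinite D
  rcases n with _ | n
  · have : IsEmpty {x // p x = v} := by
      rwa [← Finite.card_eq_zero_iff]
    exact ⟨Equiv.equivOfIsEmpty _ _, fun k => k.elim0⟩
  have hne : Nonempty {x // p x = v} := by
    rw [← Finite.card_pos_iff, hn]; omega
  obtain ⟨⟨x0, hx0⟩⟩ := hne
  set s : Finset D := Finset.univ.filter fun x => p x = v with hs
  have hcyc : σ.IsCycleOn s := by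
    constructor
    · refine ⟨fun x hx => ?_, σ.injective.injOn, fun x hx => ⟨σ.symm x, ?_, by simp⟩⟩
      · simp only [hs, Finset.coe_filter, Finset.mem_univ, true_and, Set.mem_ofPred_eq] at hx ⊢
        rw [h.apply, hx]
      · simp only [hs, Finset.coe_filter, Finset.mem_univ, true_and, Set.mem_ofPred_eq] at hx ⊢
        rw [← h.apply]; simpa using hx
    · intro x hx y hy
      simp only [hs, Finset.coe_filter, Finset.mem_univ, true_and, Set.mem_ofPred_eq] at hx hy
      rw [h, hx, hy]
  have hcard : s.card = n + 1 := by
    rw [← hn, Nat.card_eq_fintype_card, Fintype.card_subtype]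
  have hx0s : x0 ∈ s := by simp [hs, hx0]
  have hpow : ∀ k : ℕ, p ((σ ^ k) x0) = v := by
    intro k
    rw [← hx0]
    exact ((h _ _).1 ⟨k, rfl⟩).symm
  have hinj : Function.Injective (fun k : Fin (n + 1) => (⟨(σ ^ (k : ℕ)) x0, hpow k⟩ : {x // p x = v})) := by
    intro k l hkl
    have h1 := (hcyc.pow_apply_eq_pow_apply hx0s).1 (congrArg Subtype.val hkl)
    rw [hcard] at h1
    exact Fin.ext (Nat.ModEq.eq_of_lt_of_lt h1 k.2 l.2)
  have hbij := (Fintype.bijective_iff_injective_and_card _).2 ⟨hinj, by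
    rw [← Nat.card_eq_fintype_card, ← Nat.card_eq_fintype_card, hn]; simp⟩
  refine ⟨Equiv.ofBijective _ hbij, fun k => ?_⟩
  simp only [Equiv.ofBijective_apply]
  rw [← Perm.mul_apply, ← pow_succ', hcyc.pow_apply_eq_pow_apply hx0s, hcard]
  rw [finRotate_apply, Fin.val_add]
  rcases n with _ | n
  · simp [Nat.modEq_one]
  · exact Nat.mod_modEq _ _

/-- The standard rotation on the half-edges `⟨v, k⟩`, `k < d v`. -/
def stdRot (d : V → ℕ) : Perm (Σ v, Fin (d v)) := Equiv.sigmaCongrRight fun v => finRotate (d v)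

theorem finRotate_sameCycle {n : ℕ} (k l : Fin n) : (finRotate n).SameCycle k l := by
  rcases n with _ | _ | n
  · exact k.elim0
  · rw [show k = l from Fin.ext (by omega)]
  · exact isCycle_finRotate.sameCycle (by simp) (by simp)

theorem isRot_stdRot [Finite V] (d : V → ℕ) : IsRot (Sigma.fst : (Σ v, Fin (d v)) → V) (stdRot d) := by
  intro x y
  constructor
  · intro h
    exact rel_of_sameCycle (r := fun x y : Σ v, Fin (d v) => x.1 = y.1)
      ⟨fun _ => rfl, fun h => h.symm, fun h h' => h.trans h'⟩ (fun x => rfl) h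
  · obtain ⟨v, k⟩ := x
    obtain ⟨w, l⟩ := y
    rintro rfl
    refine rel_of_sameCycle (f := finRotate (d v)) (r := fun k l =>
      (stdRot d).SameCycle ⟨v, k⟩ ⟨v, l⟩)
      ⟨fun _ => SameCycle.refl _ _, fun h => h.symm, fun h h' => h.trans h'⟩ (fun x => ?_)
      (finRotate_sameCycle k l)
    exact sameCycle_self_apply (stdRot d) ⟨v, x⟩

/-- The number of gluings with vertex degrees `d`. -/
def gluings (d : V → ℕ) (Q : (V → V → Prop) → Prop) (F : ℕ) : ℕ :=
  cnt (Sigma.fst : (Σ v, Fin (d v)) → V) (stdRot d) Q F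

/-- Around each vertex a rotation is a single cycle, so up to relabelling it is determined by the
degrees, and so is the number of gluings. -/
theorem cnt_eq_gluings [Finite D] [Finite V] {p : D → V} {σ : Perm D} (h : IsRot p σ) {d : V → ℕ}
    (hd : ∀ v, Nat.card {x // p x = v} = d v) (Q : (V → V → Prop) → Prop) (F : ℕ) :
    cnt p σ Q F = gluings d Q F := by
  choose e he using fun v => h.exists_equiv_fin v (hd v)
  refine (cnt_congr ((Equiv.sigmaCongrRight e).trans (Equiv.sigmaFiberEquiv p)) (Equiv.refl V)
    ?_ ?_ Q Q (fun _ => Iff.rfl) F).symm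
  · rintro ⟨v, k⟩
    exact (e v k).2
  · rintro ⟨v, k⟩
    exact (he v k).symm

theorem gluings_congr [Finite V] (e : V ≃ V') {d : V → ℕ} {d' : V' → ℕ} (hd : ∀ v, d' (e v) = d v)
    (Q : (V → V → Prop) → Prop) (Q' : (V' → V' → Prop) → Prop)
    (hQ : ∀ R, Q' R ↔ Q fun a b => R (e a) (e b)) (F : ℕ) :
    gluings d Q F = gluings d' Q' F := by
  refine cnt_congr (Equiv.sigmaCongr e fun v => finCongr (hd v).symm) e ?_ ?_ Q Q' hQ F
  · rintro ⟨v, k⟩; rfl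
  · rintro ⟨v, k⟩
    have : ∀ (n m : ℕ) (h : n = m) (k : Fin n), finRotate m (finCongr h k) = finCongr h (finRotate n k) := by
      rintro n _ rfl k; rfl
    exact Sigma.ext rfl (heq_of_eq (this _ _ _ k))

end RotationSystems
end BCMotzkin
end

noncomputable section
open Equiv Equiv.Perm
namespace BCMotzkin

/-! ### Contraction of an edge -/

section Contraction
variable {D V V' : Type}

theorem optionCongr_removeNone [Finite D] {f : Perm (Option D)} (h : f none = none) :
    optionCongr (removeNone f) = f := by
  ext1 x
  rcases x with _ | x
  · simp [h]
  · rcases some_removeNone f x with ⟨z, h1, h2⟩ | ⟨h1, h2⟩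
    · simp [h1, h2]
    · rw [h] at h2; simp at h2

/-- The edge to contract consists of `none` and `some none`. For α = swap * β the face permutation
is σ * α = (σ * swap) * β, that is, the face permutation of β for the rotation σ * swap. As β fixes
the two ends, both can be deleted without changing the number of faces. -/
theorem isGluing_swap_mul_iff [Finite D] [Finite V] [Finite V'] [DecidableEq D] {p : Option (Option D) → V}
    {σ : Perm (Option (Option D))} {p' : Option (Option D) → V'}
    (hrot : IsRot p' (σ * swap none (some none)))
    (hcard : (Set.range p)ᶜ.ncard = (Set.range p')ᶜ.ncard)
    {Q : (V → V → Prop) → Prop} {Q' : (V' → V' → Prop) → Prop} {β : Perm D}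
    (hQ : Q (Linked p (swap none (some none) * optionCongr (optionCongr β))) ↔
      Q' (Linked (fun x => p' (some (some x))) β)) (F : ℕ) :
    IsGluing p σ Q F (swap none (some none) * optionCongr (optionCongr β)) ↔
      IsGluing (fun x => p' (some (some x))) (removeNone (removeNone (σ * swap none (some none)))) Q' F β := by
  have hs : ∀ x, (swap none (some none) * optionCongr (optionCongr β) : Perm (Option (Option D)))
      (some (some x)) = some (some (β x)) := by
    intro x; simp [Perm.mul_apply, swap_apply_of_ne_of_ne]
  have h0 : (swap none (some none) * optionCongr (optionCongr β) : Perm (Option (Option D))) none = some none := by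
    simp [Perm.mul_apply]
  have h1 : (swap none (some none) * optionCongr (optionCongr β) : Perm (Option (Option D))) (some none) = none := by
    simp [Perm.mul_apply]
  have hf : numFaces p (σ * (swap none (some none) * optionCongr (optionCongr β))) =
      numFaces (fun x => p' (some (some x))) (removeNone (removeNone (σ * swap none (some none))) * β) := by
    have : numFaces p (σ * (swap none (some none) * optionCongr (optionCongr β))) =
        numFaces p' ((σ * swap none (some none)) * optionCongr (optionCongr β)) := by
      unfold numFaces; rw [hcard, mul_assoc]
    rw [this, numFaces_removeNone hrot (by simp), removeNone_optionCongr,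
      numFaces_removeNone hrot.removeNone (by simp), removeNone_optionCongr]
  constructor
  · rintro ⟨a1, a2, a3, a4⟩
    refine ⟨fun x => ?_, fun x hx => ?_, hQ.1 a3, hf ▸ a4⟩
    · have := a1 (some (some x))
      rw [hs, hs] at this
      simpa using this
    · apply a2 (some (some x))
      rw [hs, hx]
  · rintro ⟨a1, a2, a3, a4⟩
    refine ⟨?_, ?_, hQ.2 a3, hf ▸ a4⟩
    · rintro (_ | _ | x)
      · rw [h0, h1]
      · rw [h1, h0]
      · rw [hs, hs, a1]
    · rintro (_ | _ | x)
      · rw [h0]; simp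
      · rw [h1]; simp
      · rw [hs]; simp [a2]

theorem card_isGluing_option [Finite D] [Finite V] [Finite V'] [DecidableEq D] {p : Option (Option D) → V}
    {σ : Perm (Option (Option D))} {p' : Option (Option D) → V'}
    (hrot : IsRot p' (σ * swap none (some none)))
    (hcard : (Set.range p)ᶜ.ncard = (Set.range p')ᶜ.ncard)
    {Q : (V → V → Prop) → Prop} {Q' : (V' → V' → Prop) → Prop}
    (hQ : ∀ β : Perm D, Q (Linked p (swap none (some none) * optionCongr (optionCongr β))) ↔
      Q' (Linked (fun x => p' (some (some x))) β)) (F : ℕ) :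
    Nat.card {α // IsGluing p σ Q F α ∧ α none = some none} =
      cnt (fun x => p' (some (some x))) (removeNone (removeNone (σ * swap none (some none)))) Q' F := by
  symm
  refine Nat.card_eq_of_bijective (fun β => ⟨swap none (some none) * optionCongr (optionCongr β.1),
    (isGluing_swap_mul_iff hrot hcard (hQ β.1) F).2 β.2, by simp [Perm.mul_apply]⟩) ⟨?_, ?_⟩
  · intro β γ h
    have := mul_left_cancel (congrArg Subtype.val h)
    exact Subtype.ext (optionCongr_injective (optionCongr_injective this))
  · rintro ⟨α, hα, hα0⟩
    have h1 : α (some none) = none := by rw [← hα0, hα.inv]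
    set γ := swap none (some none) * α with hγ
    have hγ0 : γ none = none := by simp [hγ, Perm.mul_apply, hα0]
    have hγ1 : γ (some none) = some none := by simp [hγ, Perm.mul_apply, h1]
    have hδ := optionCongr_removeNone hγ0
    have hδ0 : removeNone γ none = none := by
      have h2 : optionCongr (removeNone γ) (some none) = some none := by rw [hδ]; exact hγ1
      simpa only [optionCongr_apply, Option.map_some, Option.some_inj] using h2
    have hα' : α = swap none (some none) * optionCongr (optionCongr (removeNone (removeNone γ))) := by
      rw [optionCongr_removeNone hδ0, hδ, hγ, ← mul_assoc, swap_mul_self, one_mul]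
    refine ⟨⟨removeNone (removeNone γ), (isGluing_swap_mul_iff hrot hcard (hQ _) F).1 ?_⟩, ?_⟩
    · rw [← hα']; exact hα
    · exact Subtype.ext hα'.symm

/-- Contracting the edge from `a` to `b`: the gluings of `a` to `b` correspond to the gluings of the
other half-edges, turned around the new vertices by the first return map of `σ * swap a b`. -/
theorem card_isGluing_eq_gluings [Finite D] [Finite V] [Finite V'] [DecidableEq D] {p : D → V} {σ : Perm D}
    {p' : D → V'} {a b : D} (hab : a ≠ b) (hrot : IsRot p' (σ * swap a b))
    (hcard : (Set.range p)ᶜ.ncard = (Set.range p')ᶜ.ncard)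
    {d : V' → ℕ} (hd : ∀ v, Nat.card {x // p' x = v ∧ x ≠ a ∧ x ≠ b} = d v)
    {Q : (V → V → Prop) → Prop} {Q' : (V' → V' → Prop) → Prop}
    (hQ : ∀ α : Perm D, α a = b → α b = a → (Q (Linked p α) ↔
      Q' fun v w => ∃ x, x ≠ a ∧ x ≠ b ∧ p' x = v ∧ p' (α x) = w)) (F : ℕ) :
    Nat.card {α // IsGluing p σ Q F α ∧ α a = b} = gluings d Q' F := by
  set D' := {x // x ≠ a ∧ x ≠ b}
  let g : Option (Option D') → D := fun o => o.elim a fun o => o.elim b Subtype.val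
  have hg : Function.Bijective g := by
    constructor
    · rintro (_ | _ | ⟨x, hx⟩) (_ | _ | ⟨y, hy⟩) h
      · rfl
      · exact absurd h hab
      · exact absurd h.symm hy.1
      · exact absurd h.symm hab
      · rfl
      -- The map g names a by `none` and b by `some none`, which reduces the claim to
      -- `card_isGluing_option`.
      · exact absurd h.symm hy.2
      · exact absurd h hx.1
      · exact absurd h hx.2
      · obtain rfl : x = y := h
        rfl
    · intro x
      by_cases hxa : x = a
      · exact ⟨none, hxa.symm⟩
      by_cases hxb : x = b
      · exact ⟨some none, hxb.symm⟩
      · exact ⟨some (some ⟨x, hxa, hxb⟩), rfl⟩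
  set e : Option (Option D') ≃ D := Equiv.ofBijective g hg with he
  have e0 : e none = a := rfl
  have e1 : e (some none) = b := rfl
  have e2 : ∀ x : D', e (some (some x)) = x := fun _ => rfl
  set σ' : Perm (Option (Option D')) := e.symm.permCongr σ with hσ'
  have hσe : ∀ x, σ (e x) = e (σ' x) := fun x => by simp [hσ']
  have hprod : e.permCongr (σ' * swap none (some none)) = σ * swap a b := by
    ext x
    obtain ⟨x, rfl⟩ := e.surjective x
    have hsw : e (swap none (some none) x) = swap a b (e x) := e.injective.map_swap none (some none) x
    rw [permCongr_apply, symm_apply_apply, Perm.mul_apply, Perm.mul_apply, ← hσe, hsw]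
  have hrot' : IsRot (p' ∘ e) (σ' * swap none (some none)) := by
    intro x y
    simp only [Function.comp_apply]
    rw [← hrot, ← hprod]
    simp only [SameCycle]
    refine exists_congr fun i => ?_
    rw [show (e.permCongr (σ' * swap none (some none))) ^ i =
      e.permCongr ((σ' * swap none (some none)) ^ i) from (map_zpow e.permCongrHom _ _).symm]
    simp [permCongr_apply]
  have h1 : Nat.card {α // IsGluing p σ Q F α ∧ α a = b} =
      Nat.card {α // IsGluing (p ∘ e) σ' Q F α ∧ α none = some none} := by
    symm
    refine Nat.card_congr (e.permCongr.subtypeEquiv fun α => ?_)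
    rw [isGluing_permCongr_iff (p := p ∘ e) (p' := p) (σ' := σ) (Q' := Q) e (Equiv.refl V) (fun _ => rfl) hσe (fun _ => Iff.rfl)]
    refine and_congr Iff.rfl ?_
    rw [permCongr_apply, ← e0, ← e1, symm_apply_apply, e.injective.eq_iff]
  rw [h1, card_isGluing_option (p' := p' ∘ e) (Q' := Q') hrot' ?_ ?_ F]
  · refine cnt_eq_gluings hrot'.removeNone.removeNone (fun v => ?_) _ _
    rw [← hd v]
    refine Nat.card_congr ⟨fun x => ⟨x.1.1, x.2, x.1.2⟩, fun x => ⟨⟨x.1, x.2.2⟩, x.2.1⟩,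
      fun _ => rfl, fun _ => rfl⟩
  · rw [e.surjective.range_comp, e.surjective.range_comp, hcard]
  · intro β
    set γ := swap none (some none) * optionCongr (optionCongr β) with hγ
    have hs : ∀ x, γ (some (some x)) = some (some (β x)) := by
      intro x; simp [hγ, Perm.mul_apply, swap_apply_of_ne_of_ne]
    have hγ0 : γ none = some none := by simp [hγ, Perm.mul_apply]
    have hγ1 : γ (some none) = none := by simp [hγ, Perm.mul_apply]
    have hc : ∀ x, e.permCongr γ (e x) = e (γ x) := fun x => by simp [permCongr_apply]
    have := hQ (e.permCongr γ) (by rw [← e0, hc, hγ0]; rfl) (by rw [← e1, hc, hγ1]; rfl)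
    have hl : Linked p (e.permCongr γ) = Linked (p ∘ e) γ := by
      ext v w
      simp only [Linked, Function.comp_apply]
      rw [← e.exists_congr_right]
      simp only [hc]
    rw [hl] at this
    rw [this]
    refine iff_of_eq (congrArg Q' ?_)
    ext v w
    constructor
    · rintro ⟨x, hxa, hxb, h2, h3⟩
      refine ⟨⟨x, hxa, hxb⟩, h2, ?_⟩
      rwa [show e.permCongr γ x = e (some (some (β ⟨x, hxa, hxb⟩))) by rw [← hs, ← hc]; rfl] at h3
    · rintro ⟨x, h2, h3⟩
      refine ⟨x, x.2.1, x.2.2, h2, ?_⟩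
      rwa [show e.permCongr γ x = e (some (some (β x))) by rw [← hs, ← hc]; rfl]

end Contraction
end BCMotzkin
end

noncomputable section
open Equiv Equiv.Perm
namespace BCMotzkin

/-! ### Connectivity under identification of vertices -/

section Connectivity
variable {V V' : Type}

theorem eqvGen_lift {R : V → V → Prop} {S : V' → V' → Prop} {f : V → V'}
    (h : ∀ a b, R a b → Relation.EqvGen S (f a) (f b)) {a b : V} (hab : Relation.EqvGen R a b) :
    Relation.EqvGen S (f a) (f b) := by
  induction hab with
  | rel _ _ h' => exact h _ _ h'
  | refl _ => exact .refl _
  | symm _ _ _ ih => exact .symm _ _ ih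
  | trans _ _ _ _ _ ih1 ih2 => exact .trans _ _ _ ih1 ih2

theorem rel_of_eqvGen {R r : V → V → Prop} (hr : Equivalence r) (h : ∀ a b, R a b → r a b) {a b : V}
    (hab : Relation.EqvGen R a b) : r a b := by
  induction hab with
  | rel _ _ h' => exact h _ _ h'
  | refl _ => exact hr.refl _
  | symm _ _ _ ih => exact hr.symm ih
  | trans _ _ _ _ _ ih1 ih2 => exact hr.trans ih1 ih2

/-- Used for the two effects of a contraction: q identifies the ends of an edge when vertices merge,
and it identifies the two halves of the root when the root splits. -/
theorem conn_iff_of_surjective {R : V → V → Prop} {S : V' → V' → Prop} {q : V → V'}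
    (hq : Function.Surjective q) (hker : ∀ v w, q v = q w → Relation.EqvGen R v w)
    (hR : ∀ v w, R v w → Relation.EqvGen S (q v) (q w))
    (hS : ∀ v' w', S v' w' → ∃ v w, q v = v' ∧ q w = w' ∧ Relation.EqvGen R v w) :
    Conn R ↔ Conn S := by
  constructor
  · intro h a b
    obtain ⟨a, rfl⟩ := hq a
    obtain ⟨b, rfl⟩ := hq b
    exact eqvGen_lift hR (h a b)
  · intro h a b
    have := rel_of_eqvGen (r := fun v' w' => ∀ v w, q v = v' → q w = w' → Relation.EqvGen R v w)
      ⟨fun v' v w h1 h2 => hker _ _ (h1.trans h2.symm), fun h v w h1 h2 => (h w v h2 h1).symm,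
        fun {x y z} h h' v w h1 h2 => by
          obtain ⟨u, rfl⟩ := hq y
          exact (h v u h1 rfl).trans _ _ _ (h' u w rfl h2)⟩ ?_ (h (q a) (q b))
    · exact this a b rfl rfl
    · intro v' w' h' v w h1 h2
      obtain ⟨v1, w1, h3, h4, h5⟩ := hS _ _ h'
      exact ((hker v v1 (h1.trans h3.symm)).trans _ _ _ h5).trans _ _ _ (hker w1 w (h4.trans h2.symm))

end Connectivity

/-! ### Rotations after multiplication by a transposition -/

section SwapRot
variable {D V V' : Type} [Finite D] [DecidableEq D]

/-- A transposition of points of two different cycles joins these cycles into one and leaves the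
others alone. -/
theorem isRot_merge {p : D → V} {σ : Perm D} (h : IsRot p σ) {a b : D} (hab : p a ≠ p b) {q : V → V'}
    (hq : ∀ v w, q v = q w ↔ v = w ∨ ((v = p a ∨ v = p b) ∧ (w = p a ∨ w = p b))) :
    IsRot (fun x => q (p x)) (σ * swap a b) := by
  have hqab : q (p a) = q (p b) := (hq _ _).2 (by simp)
  have hn : ¬ σ.SameCycle a b := fun h' => hab ((h _ _).1 h')
  have hab' := sameCycle_mul_swap hn
  have hmem : ∀ x, p x = p a ∨ p x = p b → (σ * swap a b).SameCycle x a := by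
    rintro x (hx | hx)
    · rcases sameCycle_mul_swap_or (b := b) ((h _ _).2 hx) with h' | h'
      · exact h'
      · exact h'.trans hab'.symm
    · have := sameCycle_mul_swap_or (b := a) ((h _ _).2 hx)
      rw [swap_comm] at this
      rcases this with h' | h'
      · exact h'.trans hab'.symm
      · exact h'
  intro x y
  constructor
  · intro hxy
    refine rel_of_sameCycle (r := fun x y => q (p x) = q (p y)) ⟨fun _ => rfl, fun h => h.symm,
      fun h h' => h.trans h'⟩ (fun z => ?_) hxy
    rw [Perm.mul_apply, h.apply]
    by_cases hza : z = a
    · rw [hza, swap_apply_left, hqab]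
    by_cases hzb : z = b
    · rw [hzb, swap_apply_right, hqab]
    rw [swap_apply_of_ne_of_ne hza hzb]
  · intro hxy
    by_cases hx : p x = p a ∨ p x = p b
    · have hy : p y = p a ∨ p y = p b := by
        rcases (hq _ _).1 hxy with h' | h'
        · rwa [← h']
        · exact h'.2
      exact (hmem x hx).trans (hmem y hy).symm
    · have hxy' : p x = p y := by
        rcases (hq _ _).1 hxy with h' | h'
        · exact h'
        · exact absurd h'.1 hx
      push Not at hx
      exact sameCycle_mul_swap_of_sameCycle (fun h' => hx.1 ((h _ _).1 h'))
        (fun h' => hx.2 ((h _ _).1 h')) ((h _ _).2 hxy')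

/-- Inside the cycle of a and b every point stays joined to a or to b, so there are at most two new
cycles. The invariant p' separates a from b, so there are exactly two and p' tells them apart. -/
theorem isRot_split {p : D → V} {σ : Perm D} (h : IsRot p σ) {a b : D} (hab : p a = p b) {p' : D → V'}
    (hinv : ∀ x, p' ((σ * swap a b) x) = p' x) (hne : p' a ≠ p' b)
    (hp : ∀ x y, p' x = p' y → p x = p y) : IsRot p' (σ * swap a b) := by
  have hto : ∀ x y, (σ * swap a b).SameCycle x y → p' x = p' y := fun x y hxy =>
    rel_of_sameCycle (r := fun x y => p' x = p' y) ⟨fun _ => rfl, fun h => h.symm,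
      fun h h' => h.trans h'⟩ (fun z => (hinv z).symm) hxy
  intro x y
  refine ⟨hto x y, fun hxy => ?_⟩
  have hpxy := hp x y hxy
  by_cases hx : p x = p a
  · rcases sameCycle_mul_swap_or (b := b) ((h x a).2 hx) with h1 | h1 <;>
    rcases sameCycle_mul_swap_or (b := b) ((h y a).2 (hpxy ▸ hx)) with h2 | h2
    · exact h1.trans h2.symm
    · exact absurd ((hto _ _ h1).symm.trans (hxy.trans (hto _ _ h2))) hne
    · exact absurd ((hto _ _ h2).symm.trans (hxy.symm.trans (hto _ _ h1))) hne
    · exact h1.trans h2.symm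
  · exact sameCycle_mul_swap_of_sameCycle (fun h' => hx ((h _ _).1 h'))
      (fun h' => hx (((h _ _).1 h').trans hab.symm)) ((h _ _).2 hpxy)

end SwapRot

/-! ### Cardinalities of fibres -/

section Cards
variable {D : Type} [Finite D]

theorem card_fiber_sigma {V : Type} (d : V → ℕ) (v : V) :
    Nat.card {x : Σ v, Fin (d v) // x.1 = v} = d v := by
  rw [Nat.card_congr (Equiv.sigmaSubtype v), Nat.card_eq_fintype_card, Fintype.card_fin]

theorem card_or {P Q : D → Prop} (h : ∀ x, P x → ¬ Q x) :
    Nat.card {x // P x ∨ Q x} = Nat.card {x // P x} + Nat.card {x // Q x} := by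
  classical
  have := Fintype.ofFinite D
  simp only [Nat.card_eq_fintype_card]
  refine Fintype.card_subtype_or_disjoint _ _ ?_
  rw [Pi.disjoint_iff]
  intro x
  simp only [Prop.disjoint_iff]
  exact fun h' => h x h'.1 h'.2

theorem card_ne_ne {P : D → Prop} {a b : D} (ha : P a) (hb : P b) (hab : a ≠ b) :
    Nat.card {x // P x ∧ x ≠ a ∧ x ≠ b} + 2 = Nat.card {x // P x} := by
  classical
  have := Fintype.ofFinite D
  simp only [Nat.card_eq_fintype_card, Fintype.card_subtype]
  have h : (Finset.univ.filter P) = insert a (insert b (Finset.univ.filter fun x => P x ∧ x ≠ a ∧ x ≠ b)) := by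
    ext x
    simp only [Finset.mem_filter, Finset.mem_univ, true_and, Finset.mem_insert]
    by_cases h1 : x = a
    · simp [h1, ha]
    by_cases h2 : x = b
    · simp [h2, hb]
    simp [h1, h2]
  rw [h, Finset.card_insert_of_notMem (by simp [hab]), Finset.card_insert_of_notMem (by simp)]

end Cards

/-! ### The edge at the arrow of the root: merging and splitting -/

section Recursion
variable {ι : Type} [Fintype ι] [DecidableEq ι]

/-- The degrees `m` at the root and `μ` elsewhere. -/
def cons (m : ℕ) (μ : ι → ℕ) : Option ι → ℕ := fun o => o.elim m μ

@[simp] theorem cons_none (m : ℕ) (μ : ι → ℕ) : cons m μ none = m := rfl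
@[simp] theorem cons_some (m : ℕ) (μ : ι → ℕ) (i : ι) : cons m μ (some i) = μ i := rfl

/-- Identifies the vertex `j` with the root. -/
def mergeMap (j : ι) : Option ι → Option {i // i ≠ j} :=
  fun o => o.elim none fun i => if h : i = j then none else some ⟨i, h⟩

theorem mergeMap_eq_iff (j : ι) (v w : Option ι) : mergeMap j v = mergeMap j w ↔
    v = w ∨ ((v = none ∨ v = some j) ∧ (w = none ∨ w = some j)) := by
  rcases v with _ | v <;> rcases w with _ | w <;> simp [mergeMap] <;> grind

theorem mergeMap_surjective (j : ι) : Function.Surjective (mergeMap j) := by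
  rintro (_ | ⟨i, hi⟩)
  · exact ⟨none, rfl⟩
  · exact ⟨some i, by simp [mergeMap, hi]⟩

theorem mergeMap_eq_none (j : ι) (v : Option ι) : mergeMap j v = none ↔ v = none ∨ v = some j := by
  rcases v with _ | v <;> simp [mergeMap]

theorem mergeMap_eq_some (j : ι) (v : Option ι) (i) : mergeMap j v = some i ↔ v = some i.1 := by
  rcases v with _ | v
  · simp [mergeMap]
  · simp only [mergeMap, Option.elim_some, Option.some_inj]
    split_ifs with h
    · simp only [false_iff]
      rintro rfl
      exact i.2 h
    · rw [Option.some_inj, Subtype.ext_iff]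

/-- The root and the vertex j have m + 1 + μ j half-edges together, and two of them disappear with
the edge. -/
theorem card_isGluing_merge (m : ℕ) (μ : ι → ℕ) (j : ι) (k : Fin (μ j)) (F : ℕ) :
    Nat.card {α // IsGluing (Sigma.fst : (Σ v, Fin (cons (m + 1) μ v)) → Option ι)
      (stdRot (cons (m + 1) μ)) Conn F α ∧ α ⟨none, (0 : Fin (m + 1))⟩ = ⟨some j, k⟩} =
    gluings (cons (m + μ j - 1) fun i : {i // i ≠ j} => μ i) Conn F := by
  classical
  have hrot := isRot_stdRot (cons (m + 1) μ)
  set a : Σ v, Fin (cons (m + 1) μ v) := ⟨none, (0 : Fin (m + 1))⟩ with ha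
  set b : Σ v, Fin (cons (m + 1) μ v) := ⟨some j, k⟩ with hb
  have hab : a ≠ b := fun h => by simpa [a, b] using congrArg Sigma.fst h
  have hq := mergeMap_eq_iff j
  refine card_isGluing_eq_gluings (p' := fun x => mergeMap j x.1) hab
    (isRot_merge hrot (a := a) (b := b) (by simp [a, b]) hq) ?_ ?_ ?_ F
  · have : (Set.range fun x : Σ v, Fin (cons (m + 1) μ v) => mergeMap j x.1)ᶜ =
        mergeMap j '' (Set.range (Sigma.fst : (Σ v, Fin (cons (m + 1) μ v)) → Option ι))ᶜ := by
      ext v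
      obtain ⟨v, rfl⟩ := mergeMap_surjective j v
      simp only [Set.mem_compl_iff, Set.mem_range, Set.mem_image, not_exists]
      constructor
      · intro h
        exact ⟨v, fun x hx => h x (by rw [hx]), rfl⟩
      · rintro ⟨w, hw, hwv⟩ x hx
        rcases (hq _ _).1 (hx.trans hwv.symm) with h | ⟨-, h | h⟩
        · exact hw x h
        · exact hw a h.symm
        · exact hw b h.symm
    rw [this, Set.InjOn.ncard_image]
    intro v hv w hw h
    rcases (hq _ _).1 h with h | ⟨h | h, -⟩
    · exact h
    · exact absurd ⟨a, h.symm⟩ hv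
    · exact absurd ⟨b, h.symm⟩ hv
  · rintro (_ | i)
    · have h1 := card_ne_ne (P := fun x : Σ v, Fin (cons (m + 1) μ v) => mergeMap j x.1 = none)
        (a := a) (b := b) (by simp [a, mergeMap]) (by simp [b, mergeMap]) hab
      have h2 : Nat.card {x : Σ v, Fin (cons (m + 1) μ v) // mergeMap j x.1 = none} = (m + 1) + μ j := by
        have h3 := card_fiber_sigma (cons (m + 1) μ) none
        have h4 := card_fiber_sigma (cons (m + 1) μ) (some j)
        rw [cons_none] at h3
        rw [cons_some] at h4
        simp only [mergeMap_eq_none]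
        rw [card_or fun x h h' => by rw [h] at h'; simp at h', h3, h4]
      have := k.pos
      rw [cons_none]
      omega
    · rw [cons_some, ← cons_some (m + 1) μ, ← card_fiber_sigma (cons (m + 1) μ) (some i.1)]
      refine Nat.card_congr (Equiv.subtypeEquivRight fun x => ?_)
      rw [mergeMap_eq_some]
      constructor
      · exact fun h => h.1
      · refine fun h => ⟨h, ?_, ?_⟩
        · rintro rfl; simp [a] at h
        · rintro rfl; simp only [b, Option.some_inj] at h; exact i.2 h.symm
  · intro α hαa hαb
    refine conn_iff_of_surjective (mergeMap_surjective j) ?_ ?_ ?_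
    · have h0 : Relation.EqvGen (Linked (Sigma.fst : (Σ v, Fin (cons (m + 1) μ v)) → Option ι) α) none (some j) :=
        .rel _ _ ⟨a, rfl, by rw [hαa]⟩
      intro v w h
      rcases (hq _ _).1 h with rfl | ⟨rfl | rfl, rfl | rfl⟩
      · exact .refl _
      · exact .refl _
      · exact h0
      · exact h0.symm
      · exact .refl _
    · rintro v w ⟨x, rfl, rfl⟩
      by_cases hxa : x = a
      · rw [hxa, hαa, show mergeMap j a.1 = mergeMap j b.1 by simp [a, b, mergeMap]]; exact .refl _
      by_cases hxb : x = b
      · rw [hxb, hαb, show mergeMap j a.1 = mergeMap j b.1 by simp [a, b, mergeMap]]; exact .refl _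
      exact .rel _ _ ⟨x, hxa, hxb, rfl, rfl⟩
    · rintro v w ⟨x, -, -, rfl, rfl⟩
      exact ⟨_, _, rfl, rfl, .rel _ _ ⟨x, rfl, rfl⟩⟩

/-- The relation `R` connects any two vertices once the two roots are identified. -/
def ConnRoots (R : Option (Option ι) → Option (Option ι) → Prop) : Prop :=
  Conn fun a b => R a b ∨ a = none ∧ b = some none

/-- The vertex where the half-edge `⟨v, i⟩` sits once the root is split. -/
def splitMap (m : ℕ) (μ : ι → ℕ) (k : Fin (m + 1)) : (Σ v, Fin (cons (m + 1) μ v)) → Option (Option ι)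
  | ⟨none, i⟩ => if 1 ≤ (i : ℕ) ∧ (i : ℕ) ≤ k then some none else none
  | ⟨some j, _⟩ => some (some j)

theorem splitMap_fst (m : ℕ) (μ : ι → ℕ) (k : Fin m) :
    splitMap m μ k.succ ⟨none, (0 : Fin (m + 1))⟩ = none := by
  simp [splitMap]

theorem splitMap_snd (m : ℕ) (μ : ι → ℕ) (k : Fin m) :
    splitMap m μ k.succ ⟨none, k.succ⟩ = some none := by
  simp [splitMap]

theorem elim_splitMap (m : ℕ) (μ : ι → ℕ) (k : Fin (m + 1)) (x) :
    (splitMap m μ k x).elim none id = x.1 := by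
  obtain ⟨_ | j, i⟩ := x
  · simp only [splitMap]; split_ifs <;> rfl
  · rfl

/-- With a = 0 and b = k + 1 at the root, σ * swap a b runs through 0, k + 2, …, m on one side and
through 1, …, k + 1 on the other; `splitMap` is constant on both cycles. -/
theorem splitMap_apply (m : ℕ) (μ : ι → ℕ) (k : Fin m) (x) :
    splitMap m μ k.succ ((stdRot (cons (m + 1) μ) *
      swap (⟨none, (0 : Fin (m + 1))⟩ : Σ v, Fin (cons (m + 1) μ v)) ⟨none, k.succ⟩) x) =
      splitMap m μ k.succ x := by
  set a : Σ v, Fin (cons (m + 1) μ v) := ⟨none, (0 : Fin (m + 1))⟩ with ha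
  set b : Σ v, Fin (cons (m + 1) μ v) := ⟨none, k.succ⟩ with hb
  have hpa : splitMap m μ k.succ a = none := splitMap_fst m μ k
  have hpb : splitMap m μ k.succ b = some none := splitMap_snd m μ k
  have hσ : ∀ i : Fin (m + 1), stdRot (cons (m + 1) μ) ⟨none, i⟩ = ⟨none, finRotate (m + 1) i⟩ := fun i => rfl
  revert x
  rintro ⟨_ | j, i⟩
  · change Fin (m + 1) at i
    by_cases hia : i = 0
    · rw [hia, Perm.mul_apply, swap_apply_left, hpa, hσ]
      simp only [splitMap, coe_finRotate]
      split_ifs <;> simp_all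
    by_cases hib : i = k.succ
    · rw [hib, Perm.mul_apply, swap_apply_right, hpb, hσ]
      simp only [splitMap, coe_finRotate]
      split_ifs <;> simp_all
      omega
    have h1 : (⟨none, i⟩ : Σ v, Fin (cons (m + 1) μ v)) ≠ a := fun h => hia (eq_of_heq (Sigma.mk.inj h).2)
    have h2 : (⟨none, i⟩ : Σ v, Fin (cons (m + 1) μ v)) ≠ b := fun h => hib (eq_of_heq (Sigma.mk.inj h).2)
    rw [Perm.mul_apply, swap_apply_of_ne_of_ne h1 h2, hσ]
    have hia' : (i : ℕ) ≠ 0 := fun h => hia (Fin.ext h)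
    have hib' : (i : ℕ) ≠ k + 1 := fun h => hib (Fin.ext h)
    simp only [splitMap, coe_finRotate, Fin.val_succ]
    by_cases hl : i = Fin.last m
    · have : (i : ℕ) = m := by rw [hl]; rfl
      have := k.2
      rw [if_pos hl, if_neg (by omega), if_neg (by omega)]
    · rw [if_neg hl]
      by_cases h3 : (i : ℕ) ≤ k + 1
      · rw [if_pos (by omega), if_pos (by omega)]
      · rw [if_neg (by omega), if_neg (by omega)]
  · have h1 : (⟨some j, i⟩ : Σ v, Fin (cons (m + 1) μ v)) ≠ a := fun h => by simpa [a] using congrArg Sigma.fst h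
    have h2 : (⟨some j, i⟩ : Σ v, Fin (cons (m + 1) μ v)) ≠ b := fun h => by simpa [b] using congrArg Sigma.fst h
    rw [Perm.mul_apply, swap_apply_of_ne_of_ne h1 h2]
    rfl

/-- Before the edge is removed, the two halves of the root carry a and b respectively, so only the
vertices that were isolated already are missed. -/
theorem ncard_range_splitMap (m : ℕ) (μ : ι → ℕ) (k : Fin m) :
    (Set.range (Sigma.fst : (Σ v, Fin (cons (m + 1) μ v)) → Option ι))ᶜ.ncard =
      (Set.range (splitMap m μ k.succ))ᶜ.ncard := by
  set a : Σ v, Fin (cons (m + 1) μ v) := ⟨none, (0 : Fin (m + 1))⟩ with ha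
  set b : Σ v, Fin (cons (m + 1) μ v) := ⟨none, k.succ⟩ with hb
  have hpa : splitMap m μ k.succ a = none := splitMap_fst m μ k
  have hpb : splitMap m μ k.succ b = some none := splitMap_snd m μ k
  have hq := elim_splitMap m μ k.succ
  have : (Set.range (splitMap m μ k.succ))ᶜ =
      (fun o : Option ι => o.elim none fun i => some (some i)) ''
        (Set.range (Sigma.fst : (Σ v, Fin (cons (m + 1) μ v)) → Option ι))ᶜ := by
    ext v
    rcases v with _ | _ | v
    · simp only [Set.mem_compl_iff, Set.mem_image]
      refine iff_of_false (fun h => h ⟨a, hpa⟩) ?_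
      rintro ⟨_ | w, hw, h⟩
      · exact hw ⟨a, rfl⟩
      · simp at h
    · simp only [Set.mem_compl_iff, Set.mem_image]
      refine iff_of_false (fun h => h ⟨b, hpb⟩) ?_
      rintro ⟨_ | w, hw, h⟩ <;> simp at h
    · simp only [Set.mem_compl_iff, Set.mem_image, Set.mem_range, not_exists]
      constructor
      · intro h
        refine ⟨some v, ?_, rfl⟩
        rintro ⟨_, i⟩ rfl
        exact h ⟨some v, i⟩ rfl
      · rintro ⟨_ | w, hw, h⟩ x hx
        · simp at h
        · obtain rfl : w = v := by simpa using h
          refine hw x ?_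
          rw [← hq, hx]; rfl
  rw [this, Set.ncard_image_of_injective]
  rintro (_ | v) (_ | w) h <;> simp_all

/-- Once 0 and k + 1 are removed, k + 2, …, m remain on the first side and 1, …, k on the second. -/
theorem card_splitMap (m : ℕ) (μ : ι → ℕ) (k : Fin m) (v : Option (Option ι)) :
    Nat.card {x // splitMap m μ k.succ x = v ∧ x ≠ ⟨none, (0 : Fin (m + 1))⟩ ∧ x ≠ ⟨none, k.succ⟩} =
      cons (m - 1 - k) (cons k μ) v := by
  set a : Σ v, Fin (cons (m + 1) μ v) := ⟨none, (0 : Fin (m + 1))⟩ with ha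
  set b : Σ v, Fin (cons (m + 1) μ v) := ⟨none, k.succ⟩ with hb
  have hq := elim_splitMap m μ k.succ
  revert v
  have hk := k.2
  rintro (_ | _ | j)
  · have : {x // splitMap m μ k.succ x = none ∧ x ≠ a ∧ x ≠ b} ≃ Finset.Ioi k.succ :=
      { toFun := fun x => match x with
          | ⟨⟨none, i⟩, h⟩ => ⟨i, by
              obtain ⟨h1, h2, -⟩ := h
              change Fin (m + 1) at i
              have hi0 : (i : ℕ) ≠ 0 := fun h => h2 (by rw [show i = 0 from Fin.ext h])
              simp only [splitMap] at h1
              simp only [Fin.val_succ, ite_eq_right_iff, reduceCtorEq, imp_false] at h1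
              simp only [Finset.mem_Ioi, Fin.lt_def, Fin.val_succ]
              omega⟩
          | ⟨⟨some j, i⟩, h⟩ => False.elim (by simpa [splitMap] using h.1)
        invFun := fun i => ⟨⟨none, i.1⟩, by
          have := i.2
          simp only [Finset.mem_Ioi, Fin.lt_def, Fin.val_succ] at this
          refine ⟨?_, fun h => ?_, fun h => ?_⟩
          · simp only [splitMap, Fin.val_succ]
            rw [if_neg (by omega)]
          · have h0 : (i.1 : ℕ) = 0 := congrArg Fin.val (eq_of_heq (Sigma.mk.inj h).2)
            omega
          · have := congrArg Fin.val (eq_of_heq (Sigma.mk.inj h).2)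
            simp at this; omega⟩
        left_inv := by
          rintro ⟨⟨_ | j, i⟩, h⟩
          · rfl
          · exact False.elim (by simpa [splitMap] using h.1)
        right_inv := fun i => rfl }
    rw [Nat.card_congr this, Nat.card_eq_fintype_card, Fintype.card_coe, Fin.card_Ioi]
    simp; omega
  · have : {x // splitMap m μ k.succ x = some none ∧ x ≠ a ∧ x ≠ b} ≃ Finset.Ioo 0 k.succ :=
      { toFun := fun x => match x with
          | ⟨⟨none, i⟩, h⟩ => ⟨i, by
              obtain ⟨h1, h2, h3⟩ := h
              change Fin (m + 1) at i
              have hi0 : (i : ℕ) ≠ k + 1 := fun h => h3 (by rw [show i = k.succ from Fin.ext h])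
              simp only [splitMap] at h1
              simp only [Fin.val_succ, ite_eq_left_iff, reduceCtorEq, imp_false, not_not] at h1
              simp only [Finset.mem_Ioo, Fin.lt_def, Fin.val_succ, Fin.val_zero]
              omega⟩
          | ⟨⟨some j, i⟩, h⟩ => False.elim (by simpa [splitMap] using h.1)
        invFun := fun i => ⟨⟨none, i.1⟩, by
          have := i.2
          simp only [Finset.mem_Ioo, Fin.lt_def, Fin.val_succ, Fin.val_zero] at this
          refine ⟨?_, fun h => ?_, fun h => ?_⟩
          · simp only [splitMap, Fin.val_succ]
            rw [if_pos (by omega)]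
          · have h0 : (i.1 : ℕ) = 0 := congrArg Fin.val (eq_of_heq (Sigma.mk.inj h).2)
            omega
          · have := congrArg Fin.val (eq_of_heq (Sigma.mk.inj h).2)
            simp at this; omega⟩
        left_inv := by
          rintro ⟨⟨_ | j, i⟩, h⟩
          · rfl
          · exact False.elim (by simpa [splitMap] using h.1)
        right_inv := fun i => rfl }
    rw [Nat.card_congr this, Nat.card_eq_fintype_card, Fintype.card_coe, Fin.card_Ioo]
    simp
  · rw [cons_some, cons_some, ← cons_some (m + 1) μ, ← card_fiber_sigma (cons (m + 1) μ) (some j)]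
    refine Nat.card_congr (Equiv.subtypeEquivRight fun x => ?_)
    constructor
    · rintro ⟨h, -, -⟩
      rw [← hq x, h]; rfl
    · rintro h
      obtain ⟨v, i⟩ := x
      obtain rfl : v = some j := h
      refine ⟨rfl, fun h => ?_, fun h => ?_⟩
      · simpa [a] using congrArg Sigma.fst h
      · simpa [b] using congrArg Sigma.fst h

/-- The contracted graph need not be connected: connectivity of the original graph only says that it
becomes so once the two halves of the root are identified, hence `ConnRoots`. -/
theorem card_isGluing_split (m : ℕ) (μ : ι → ℕ) (k : Fin m) (F : ℕ) :
    Nat.card {α // IsGluing (Sigma.fst : (Σ v, Fin (cons (m + 1) μ v)) → Option ι)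
      (stdRot (cons (m + 1) μ)) Conn F α ∧ α ⟨none, (0 : Fin (m + 1))⟩ = ⟨none, k.succ⟩} =
    gluings (cons (m - 1 - k) (cons k μ)) ConnRoots F := by
  classical
  have hrot := isRot_stdRot (cons (m + 1) μ)
  set a : Σ v, Fin (cons (m + 1) μ v) := ⟨none, (0 : Fin (m + 1))⟩ with ha
  set b : Σ v, Fin (cons (m + 1) μ v) := ⟨none, k.succ⟩ with hb
  have hab : a ≠ b := fun h => by
    have := eq_of_heq (Sigma.mk.inj h).2
    exact Fin.succ_ne_zero _ this.symm
  have hpa : splitMap m μ k.succ a = none := splitMap_fst m μ k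
  have hpb : splitMap m μ k.succ b = some none := splitMap_snd m μ k
  have hq := elim_splitMap m μ k.succ
  refine card_isGluing_eq_gluings (p' := splitMap m μ k.succ) hab
    (isRot_split (a := a) (b := b) hrot rfl (splitMap_apply m μ k) (by rw [hpa, hpb]; simp)
      fun x y h => by rw [← hq x, ← hq y, h])
    (ncard_range_splitMap m μ k) (card_splitMap m μ k) ?_ F
  intro α hαa hαb
  symm
  refine conn_iff_of_surjective (q := fun o => o.elim none id) ?_ ?_ ?_ ?_
  · rintro v
    exact ⟨some v, rfl⟩
  · have h0 : Relation.EqvGen (fun v w => (∃ x, x ≠ a ∧ x ≠ b ∧ splitMap m μ k.succ x = v ∧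
        splitMap m μ k.succ (α x) = w) ∨ v = none ∧ w = some none) none (some none) :=
      .rel _ _ (Or.inr ⟨rfl, rfl⟩)
    rintro (_ | v) (_ | w) h
    · exact .refl _
    · obtain rfl : none = w := h
      exact h0
    · obtain rfl : v = none := h
      exact h0.symm
    · obtain rfl : v = w := h
      exact .refl _
  · rintro v w (⟨x, -, -, rfl, rfl⟩ | ⟨rfl, rfl⟩)
    · rw [hq, hq]
      exact .rel _ _ ⟨x, rfl, rfl⟩
    · exact .refl _
  · rintro v w ⟨x, rfl, rfl⟩
    by_cases hxa : x = a
    · exact ⟨none, none, by rw [hxa]; rfl, by rw [hxa, hαa]; rfl, .refl _⟩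
    by_cases hxb : x = b
    · exact ⟨none, none, by rw [hxb]; rfl, by rw [hxb, hαb]; rfl, .refl _⟩
    exact ⟨_, _, hq x, hq (α x), .rel _ _ (Or.inl ⟨x, hxa, hxb, rfl, rfl⟩)⟩

end Recursion
end BCMotzkin
end

noncomputable section
open Equiv Equiv.Perm
namespace BCMotzkin

/-! ### Decomposing counts according to the adjacency relation -/

section Adjacency
variable {D V : Type} [Finite D]

theorem cnt_iff (p : D → V) (σ : Perm D) {Q Q' : (V → V → Prop) → Prop} (h : ∀ R, Q R ↔ Q' R) (F : ℕ) :
    cnt p σ Q F = cnt p σ Q' F := by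
  rw [show Q = Q' from funext fun R => propext (h R)]

theorem cnt_or (p : D → V) (σ : Perm D) {Q Q' : (V → V → Prop) → Prop} (h : ∀ R, Q R → ¬ Q' R) (F : ℕ) :
    cnt p σ (fun R => Q R ∨ Q' R) F = cnt p σ Q F + cnt p σ Q' F := by
  unfold cnt
  rw [← card_or fun α h1 h2 => h _ h1.adj h2.adj]
  refine Nat.card_congr (Equiv.subtypeEquivRight fun α => ?_)
  constructor
  · rintro ⟨h1, h2, h3 | h3, h4⟩
    · exact Or.inl ⟨h1, h2, h3, h4⟩
    · exact Or.inr ⟨h1, h2, h3, h4⟩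
  · rintro (⟨h1, h2, h3, h4⟩ | ⟨h1, h2, h3, h4⟩)
    · exact ⟨h1, h2, Or.inl h3, h4⟩
    · exact ⟨h1, h2, Or.inr h3, h4⟩

theorem cnt_exists {κ : Type} [Fintype κ] (p : D → V) (σ : Perm D) {Q : κ → (V → V → Prop) → Prop}
    (h : ∀ R k l, Q k R → Q l R → k = l) (F : ℕ) :
    cnt p σ (fun R => ∃ k, Q k R) F = ∑ k, cnt p σ (Q k) F := by
  unfold cnt
  rw [← Nat.card_sigma]
  symm
  refine Nat.card_eq_of_bijective
    (fun x => ⟨x.2.1, x.2.2.inv, x.2.2.ne, ⟨x.1, x.2.2.adj⟩, x.2.2.faces⟩) ⟨?_, ?_⟩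
  · rintro ⟨k, α, hα⟩ ⟨l, β, hβ⟩ hαβ
    obtain rfl : α = β := congrArg Subtype.val hαβ
    obtain rfl := h _ _ _ hα.adj hβ.adj
    rfl
  · rintro ⟨α, h1, h2, ⟨k, h3⟩, h4⟩
    exact ⟨⟨k, α, h1, h2, h3, h4⟩, rfl⟩

end Adjacency

/-! ### Gluings with two components -/

section Components
variable {V₁ V₂ : Type}

/-- The relation `R` links no vertex of `V₁` to one of `V₂`, and connects each of the two parts. -/
def SepSum (R : V₁ ⊕ V₂ → V₁ ⊕ V₂ → Prop) : Prop :=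
  (∀ a b, ¬ R (.inl a) (.inr b)) ∧ (∀ a b, ¬ R (.inr b) (.inl a)) ∧
    Conn (fun a b => R (.inl a) (.inl b)) ∧ Conn (fun a b => R (.inr a) (.inr b))

theorem linked_sumCongr_inl {D₁ D₂ : Type} (p₁ : D₁ → V₁) (p₂ : D₂ → V₂) (α₁ : Perm D₁) (α₂ : Perm D₂) :
    (fun a b => Linked (Sum.map p₁ p₂) (Equiv.sumCongr α₁ α₂) (.inl a) (.inl b)) = Linked p₁ α₁ := by
  ext a b; simp [Linked]

theorem linked_sumCongr_inr {D₁ D₂ : Type} (p₁ : D₁ → V₁) (p₂ : D₂ → V₂) (α₁ : Perm D₁) (α₂ : Perm D₂) :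
    (fun a b => Linked (Sum.map p₁ p₂) (Equiv.sumCongr α₁ α₂) (.inr a) (.inr b)) = Linked p₂ α₂ := by
  ext a b; simp [Linked]

theorem numFaces_sumCongr {D₁ D₂ : Type} [Finite D₁] [Finite D₂] [Finite V₁] [Finite V₂]
    (p₁ : D₁ → V₁) (p₂ : D₂ → V₂) (φ₁ : Perm D₁) (φ₂ : Perm D₂) :
    numFaces (Sum.map p₁ p₂) (Equiv.sumCongr φ₁ φ₂) = numFaces p₁ φ₁ + numFaces p₂ φ₂ := by
  unfold numFaces
  rw [numCycles_sumCongr]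
  have : (Set.range (Sum.map p₁ p₂))ᶜ = Sum.inl '' (Set.range p₁)ᶜ ∪ Sum.inr '' (Set.range p₂)ᶜ := by
    ext (v | v) <;> simp
  rw [this, Set.ncard_union_eq, Set.ncard_image_of_injective _ Sum.inl_injective,
    Set.ncard_image_of_injective _ Sum.inr_injective]
  · ring
  · rw [Set.disjoint_left]
    rintro _ ⟨a, -, rfl⟩ ⟨b, -, h⟩
    simp at h

theorem isGluing_sumCongr_iff {D₁ D₂ : Type} [Finite D₁] [Finite D₂] [Finite V₁] [Finite V₂]
    (p₁ : D₁ → V₁) (p₂ : D₂ → V₂) (σ₁ : Perm D₁) (σ₂ : Perm D₂) (α₁ : Perm D₁) (α₂ : Perm D₂) (F : ℕ) :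
    IsGluing (Sum.map p₁ p₂) (Equiv.sumCongr σ₁ σ₂) SepSum F (Equiv.sumCongr α₁ α₂) ↔
      ∃ F₁ F₂, F₁ + F₂ = F ∧ IsGluing p₁ σ₁ Conn F₁ α₁ ∧ IsGluing p₂ σ₂ Conn F₂ α₂ := by
  have hm : (Equiv.sumCongr σ₁ σ₂ : Perm (D₁ ⊕ D₂)) * Equiv.sumCongr α₁ α₂ =
      Equiv.sumCongr (σ₁ * α₁) (σ₂ * α₂) := Perm.sumCongr_mul _ _ _ _
  constructor
  · rintro ⟨h1, h2, ⟨-, -, h3, h4⟩, h5⟩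
    rw [hm, numFaces_sumCongr] at h5
    rw [linked_sumCongr_inl] at h3
    rw [linked_sumCongr_inr] at h4
    exact ⟨_, _, h5, ⟨fun x => by simpa using h1 (.inl x), fun x => by simpa using h2 (.inl x), h3, rfl⟩,
      ⟨fun x => by simpa using h1 (.inr x), fun x => by simpa using h2 (.inr x), h4, rfl⟩⟩
  · rintro ⟨F₁, F₂, hF, ⟨a1, a2, a3, a4⟩, ⟨b1, b2, b3, b4⟩⟩
    refine ⟨?_, ?_, ⟨?_, ?_, ?_, ?_⟩, ?_⟩
    · rintro (x | x) <;> simp [a1, b1]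
    · rintro (x | x) <;> simp [a2, b2]
    · rintro a b ⟨(x | x), h, h'⟩ <;> simp at h h'
    · rintro a b ⟨(x | x), h, h'⟩ <;> simp at h h'
    · rw [linked_sumCongr_inl]; exact a3
    · rw [linked_sumCongr_inr]; exact b3
    · rw [hm, numFaces_sumCongr, a4, b4, hF]

/-- A gluing without links between the two sides is a pair of gluings, and the numbers of faces add
up. -/
theorem cnt_sumCongr {D₁ D₂ : Type} [Finite D₁] [Finite D₂] [Finite V₁] [Finite V₂]
    (p₁ : D₁ → V₁) (p₂ : D₂ → V₂) (σ₁ : Perm D₁) (σ₂ : Perm D₂) (F : ℕ) :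
    cnt (Sum.map p₁ p₂) (Equiv.sumCongr σ₁ σ₂) SepSum F =
      ∑ x ∈ Finset.HasAntidiagonal.antidiagonal F, cnt p₁ σ₁ Conn x.1 * cnt p₂ σ₂ Conn x.2 := by
  classical
  unfold cnt
  simp only [← Nat.card_prod]
  rw [← Finset.sum_coe_sort, ← Nat.card_sigma]
  symm
  refine Nat.card_eq_of_bijective (fun x => ⟨Equiv.sumCongr x.2.1.1 x.2.2.1,
    (isGluing_sumCongr_iff _ _ _ _ _ _ _).2 ⟨_, _, Finset.HasAntidiagonal.mem_antidiagonal.1 x.1.2, x.2.1.2, x.2.2.2⟩⟩) ⟨?_, ?_⟩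
  · rintro ⟨⟨⟨F₁, F₂⟩, hF⟩, ⟨α₁, hα₁⟩, ⟨α₂, hα₂⟩⟩ ⟨⟨⟨F₁', F₂'⟩, hF'⟩, ⟨β₁, hβ₁⟩, ⟨β₂, hβ₂⟩⟩ h
    have h' : Equiv.sumCongr α₁ α₂ = Equiv.sumCongr β₁ β₂ := congrArg Subtype.val h
    obtain rfl : α₁ = β₁ := by
      ext x; simpa using Equiv.congr_fun h' (.inl x)
    obtain rfl : α₂ = β₂ := by
      ext x; simpa using Equiv.congr_fun h' (.inr x)
    obtain rfl : F₁ = F₁' := hα₁.faces.symm.trans hβ₁.faces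
    obtain rfl : F₂ = F₂' := hα₂.faces.symm.trans hβ₂.faces
    rfl
  · rintro ⟨α, hα⟩
    -- A permutation of a finite sum that maps the left summand into itself is a pair of
    -- permutations.
    have hmem : α ∈ (Perm.sumCongrHom D₁ D₂).range := by
      refine Perm.mem_sumCongrHom_range_of_perm_mapsTo_inl ?_
      rintro _ ⟨x, rfl⟩
      rcases h : α (.inl x) with y | y
      · exact ⟨y, rfl⟩
      · exact absurd ⟨.inl x, rfl, by rw [h]; rfl⟩ (hα.adj.1 (p₁ x) (p₂ y))
    obtain ⟨⟨α₁, α₂⟩, rfl⟩ := hmem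
    obtain ⟨F₁, F₂, hF, h1, h2⟩ := (isGluing_sumCongr_iff _ _ _ _ _ _ _).1 hα
    exact ⟨⟨⟨⟨F₁, F₂⟩, Finset.HasAntidiagonal.mem_antidiagonal.2 hF⟩, ⟨α₁, h1⟩, ⟨α₂, h2⟩⟩, rfl⟩

theorem gluings_sepSum [Finite V₁] [Finite V₂] (d₁ : V₁ → ℕ) (d₂ : V₂ → ℕ) (F : ℕ) :
    gluings (Sum.elim d₁ d₂) SepSum F =
      ∑ x ∈ Finset.HasAntidiagonal.antidiagonal F, gluings d₁ Conn x.1 * gluings d₂ Conn x.2 := by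
  unfold gluings
  rw [← cnt_sumCongr]
  symm
  refine cnt_congr ((Equiv.sumSigmaDistrib fun v => Fin (Sum.elim d₁ d₂ v)).symm) (Equiv.refl _) ?_ ?_ _ _
    (fun _ => Iff.rfl) F
  · rintro (⟨v, i⟩ | ⟨v, i⟩) <;> rfl
  · rintro (⟨v, i⟩ | ⟨v, i⟩) <;> rfl

end Components

/-! ### Components after the root is split, and the recursion for gluings -/

section Roots
variable {ι : Type} [Fintype ι] [DecidableEq ι]

/-- The vertices on the side of the first root, when the other ones there are those of `I`. -/
def side (I : Finset ι) : Option (Option ι) → Prop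
  | none => True
  | some none => False
  | some (some i) => i ∈ I

/-- The components of the relation `R` are the first root with `I` and the second one with the rest. -/
def SepRoots (I : Finset ι) (R : Option (Option ι) → Option (Option ι) → Prop) : Prop :=
  (∀ x y, R x y → (side I x ↔ side I y)) ∧ (∀ x, side I x → Relation.EqvGen R none x) ∧
    ∀ x, ¬ side I x → Relation.EqvGen R (some none) x

theorem SepRoots.side_iff {I : Finset ι} {R : Option (Option ι) → Option (Option ι) → Prop}
    (h : SepRoots I R) {x y} (hxy : Relation.EqvGen R x y) : side I x ↔ side I y :=
  rel_of_eqvGen (r := fun x y => side I x ↔ side I y)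
    ⟨fun _ => Iff.rfl, fun h => h.symm, fun h h' => h.trans h'⟩ h.1 hxy

/-- If linking the two roots connects everything, every vertex was already linked to one of them.
Either the roots were linked as well, or I consists of the vertices on the side of the first root.
-/
theorem connRoots_iff (R : Option (Option ι) → Option (Option ι) → Prop) :
    ConnRoots R ↔ Conn R ∨ ∃ I, SepRoots I R := by
  classical
  have hmono : ∀ {x y}, Relation.EqvGen R x y →
      Relation.EqvGen (fun a b => R a b ∨ a = none ∧ b = some none) x y := fun h =>
    Relation.EqvGen.mono (fun _ _ h => Or.inl h) _ _ h
  have h0 : Relation.EqvGen (fun a b => R a b ∨ a = none ∧ b = some none) none (some none) :=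
    .rel _ _ (Or.inr ⟨rfl, rfl⟩)
  constructor
  · intro h
    by_cases h1 : Relation.EqvGen R none (some none)
    · left
      intro a b
      refine rel_of_eqvGen (Relation.EqvGen.is_equivalence R) ?_ (h a b)
      rintro x y (h' | ⟨rfl, rfl⟩)
      · exact .rel _ _ h'
      · exact h1
    · right
      have hor : ∀ x, Relation.EqvGen R none x ∨ Relation.EqvGen R (some none) x := by
        intro x
        have := rel_of_eqvGen (r := fun x y => (Relation.EqvGen R none x ∨ Relation.EqvGen R (some none) x) ↔
          (Relation.EqvGen R none y ∨ Relation.EqvGen R (some none) y))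
          ⟨fun _ => Iff.rfl, fun h => h.symm, fun h h' => h.trans h'⟩ ?_ (h none x)
        · exact this.1 (Or.inl (.refl _))
        · rintro x y (h' | ⟨rfl, rfl⟩)
          · have hxy : Relation.EqvGen R x y := .rel _ _ h'
            exact or_congr ⟨fun h => h.trans _ _ _ hxy, fun h => h.trans _ _ _ hxy.symm⟩
              ⟨fun h => h.trans _ _ _ hxy, fun h => h.trans _ _ _ hxy.symm⟩
          · exact iff_of_true (Or.inl (.refl _)) (Or.inr (.refl _))
      have hs : ∀ x, side (Finset.univ.filter fun i : ι => Relation.EqvGen R none (some (some i))) x ↔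
          Relation.EqvGen R none x := by
        rintro (_ | _ | i)
        · exact iff_of_true trivial (.refl _)
        · exact iff_of_false id h1
        · simp [side]
      refine ⟨_, ?_, fun x hx => (hs x).1 hx, fun x hx => (hor x).resolve_left fun h' => hx ((hs x).2 h')⟩
      intro x y hxy
      have hxy' : Relation.EqvGen R x y := .rel _ _ hxy
      rw [hs, hs]
      exact ⟨fun h => h.trans _ _ _ hxy', fun h => h.trans _ _ _ hxy'.symm⟩
  · rintro (h | ⟨I, -, h1, h2⟩)
    · exact fun a b => hmono (h a b)
    · have : ∀ x, Relation.EqvGen (fun a b => R a b ∨ a = none ∧ b = some none) none x := by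
        intro x
        by_cases hx : side I x
        · exact hmono (h1 x hx)
        · exact h0.trans _ _ _ (hmono (h2 x hx))
      exact fun a b => (this a).symm.trans _ _ _ (this b)

/-- The vertices of the two components. -/
def sepEquiv (I : Finset ι) : Option {i // i ∈ I} ⊕ Option {i // i ∉ I} ≃ Option (Option ι) :=
  Equiv.ofBijective (Sum.elim (fun o => o.elim none fun i => some (some i.1))
    (fun o => o.elim (some none) fun i => some (some i.1))) (by
    constructor
    · rintro ((_ | ⟨i, hi⟩) | (_ | ⟨i, hi⟩)) ((_ | ⟨j, hj⟩) | (_ | ⟨j, hj⟩)) h <;>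
        simp at h <;> grind
    · rintro (_ | _ | i)
      · exact ⟨.inl none, rfl⟩
      · exact ⟨.inr none, rfl⟩
      · by_cases hi : i ∈ I
        · exact ⟨.inl (some ⟨i, hi⟩), rfl⟩
        · exact ⟨.inr (some ⟨i, hi⟩), rfl⟩)

theorem side_sepEquiv_inl (I : Finset ι) (x) : side I (sepEquiv I (.inl x)) := by
  rcases x with _ | ⟨i, hi⟩
  · trivial
  · exact hi

theorem side_sepEquiv_inr (I : Finset ι) (x) : ¬ side I (sepEquiv I (.inr x)) := by
  rcases x with _ | ⟨i, hi⟩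
  · exact id
  · exact hi

theorem sepRoots_iff (I : Finset ι) (R : Option (Option ι) → Option (Option ι) → Prop) :
    SepRoots I R ↔ SepSum fun a b => R (sepEquiv I a) (sepEquiv I b) := by
  constructor
  · intro h
    have key : ∀ x y, Relation.EqvGen R x y →
        (∃ u v, sepEquiv I (.inl u) = x ∧ sepEquiv I (.inl v) = y ∧
          Relation.EqvGen (fun a b => R (sepEquiv I (.inl a)) (sepEquiv I (.inl b))) u v) ∨
        (∃ u v, sepEquiv I (.inr u) = x ∧ sepEquiv I (.inr v) = y ∧
          Relation.EqvGen (fun a b => R (sepEquiv I (.inr a)) (sepEquiv I (.inr b))) u v) := by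
      intro x y hxy
      induction hxy with
      | rel x y hxy =>
        obtain ⟨u | u, rfl⟩ := (sepEquiv I).surjective x <;>
        obtain ⟨v | v, rfl⟩ := (sepEquiv I).surjective y
        · exact Or.inl ⟨u, v, rfl, rfl, .rel _ _ hxy⟩
        · exact absurd ((h.1 _ _ hxy).1 (side_sepEquiv_inl I u)) (side_sepEquiv_inr I v)
        · exact absurd ((h.1 _ _ hxy).2 (side_sepEquiv_inl I v)) (side_sepEquiv_inr I u)
        · exact Or.inr ⟨u, v, rfl, rfl, .rel _ _ hxy⟩
      | refl x =>
        obtain ⟨u | u, rfl⟩ := (sepEquiv I).surjective x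
        · exact Or.inl ⟨u, u, rfl, rfl, .refl _⟩
        · exact Or.inr ⟨u, u, rfl, rfl, .refl _⟩
      | symm x y _ ih =>
        rcases ih with ⟨u, v, h1, h2, h3⟩ | ⟨u, v, h1, h2, h3⟩
        · exact Or.inl ⟨v, u, h2, h1, h3.symm⟩
        · exact Or.inr ⟨v, u, h2, h1, h3.symm⟩
      | trans x y z _ _ ih1 ih2 =>
        rcases ih1 with ⟨u, v, h1, h2, h3⟩ | ⟨u, v, h1, h2, h3⟩ <;>
        rcases ih2 with ⟨u', v', h1', h2', h3'⟩ | ⟨u', v', h1', h2', h3'⟩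
        · obtain rfl : v = u' := by simpa using h2.trans h1'.symm
          exact Or.inl ⟨u, v', h1, h2', h3.trans _ _ _ h3'⟩
        · simpa using h2.trans h1'.symm
        · simpa using h2.trans h1'.symm
        · obtain rfl : v = u' := by simpa using h2.trans h1'.symm
          exact Or.inr ⟨u, v', h1, h2', h3.trans _ _ _ h3'⟩
    refine ⟨fun a b hab => side_sepEquiv_inr I b ((h.1 _ _ hab).1 (side_sepEquiv_inl I a)),
      fun a b hab => side_sepEquiv_inr I b ((h.1 _ _ hab).2 (side_sepEquiv_inl I a)), ?_, ?_⟩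
    · intro a b
      have := (h.2.1 _ (side_sepEquiv_inl I a)).symm.trans _ _ _ (h.2.1 _ (side_sepEquiv_inl I b))
      rcases key _ _ this with ⟨u, v, h1, h2, h3⟩ | ⟨u, v, h1, h2, h3⟩
      · obtain rfl : u = a := by simpa using h1
        obtain rfl : v = b := by simpa using h2
        exact h3
      · simp at h1
    · intro a b
      have := (h.2.2 _ (side_sepEquiv_inr I a)).symm.trans _ _ _ (h.2.2 _ (side_sepEquiv_inr I b))
      rcases key _ _ this with ⟨u, v, h1, h2, h3⟩ | ⟨u, v, h1, h2, h3⟩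
      · simp at h1
      · obtain rfl : u = a := by simpa using h1
        obtain rfl : v = b := by simpa using h2
        exact h3
  · rintro ⟨h1, h2, h3, h4⟩
    refine ⟨?_, ?_, ?_⟩
    · intro x y hxy
      obtain ⟨u | u, rfl⟩ := (sepEquiv I).surjective x <;>
      obtain ⟨v | v, rfl⟩ := (sepEquiv I).surjective y
      · exact iff_of_true (side_sepEquiv_inl I _) (side_sepEquiv_inl I _)
      · exact absurd hxy (h1 _ _)
      · exact absurd hxy (h2 _ _)
      · exact iff_of_false (side_sepEquiv_inr I _) (side_sepEquiv_inr I _)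
    · intro x hx
      obtain ⟨u | u, rfl⟩ := (sepEquiv I).surjective x
      · exact eqvGen_lift (f := fun a => sepEquiv I (.inl a)) (fun a b h => .rel _ _ h) (h3 none u)
      · exact absurd hx (side_sepEquiv_inr I _)
    · intro x hx
      obtain ⟨u | u, rfl⟩ := (sepEquiv I).surjective x
      · exact absurd (side_sepEquiv_inl I _) hx
      · exact eqvGen_lift (f := fun a => sepEquiv I (.inr a)) (fun a b h => .rel _ _ h) (h4 none u)

theorem gluings_connRoots (a b : ℕ) (μ : ι → ℕ) (F : ℕ) :
    gluings (cons a (cons b μ)) ConnRoots F = gluings (cons a (cons b μ)) Conn F +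
      ∑ I : Finset ι, ∑ x ∈ Finset.HasAntidiagonal.antidiagonal F,
        gluings (cons a fun i : {i // i ∈ I} => μ i) Conn x.1 *
          gluings (cons b fun i : {i // i ∉ I} => μ i) Conn x.2 := by
  have h1 : gluings (cons a (cons b μ)) ConnRoots F = gluings (cons a (cons b μ)) Conn F +
      ∑ I : Finset ι, gluings (cons a (cons b μ)) (SepRoots I) F := by
    unfold gluings
    rw [cnt_iff _ _ connRoots_iff, cnt_or, cnt_exists]
    · rintro R I J hI hJ
      ext i
      constructor
      · exact fun hi => (hJ.side_iff (hI.2.1 (some (some i)) hi)).1 trivial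
      · exact fun hi => (hI.side_iff (hJ.2.1 (some (some i)) hi)).1 trivial
    · rintro R hR ⟨I, hI⟩
      exact (hI.side_iff (hR none (some none))).1 trivial
  rw [h1]
  congr 1
  refine Finset.sum_congr rfl fun I _ => ?_
  rw [← gluings_sepSum]
  symm
  refine gluings_congr (sepEquiv I) ?_ _ _ (sepRoots_iff I) F
  rintro ((_ | i) | (_ | i)) <;> rfl

/-- Removing the edge at the arrow of the root. -/
theorem gluings_conn_succ (m : ℕ) (μ : ι → ℕ) (F : ℕ) :
    gluings (cons (m + 1) μ) Conn F =
      ∑ j, μ j * gluings (cons (m + μ j - 1) fun i : {i // i ≠ j} => μ i) Conn F +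
      ∑ k ∈ Finset.range m, (gluings (cons (m - 1 - k) (cons k μ)) Conn F +
        ∑ I : Finset ι, ∑ x ∈ Finset.HasAntidiagonal.antidiagonal F,
          gluings (cons (m - 1 - k) fun i : {i // i ∈ I} => μ i) Conn x.1 *
            gluings (cons k fun i : {i // i ∉ I} => μ i) Conn x.2) := by
  have h1 : gluings (cons (m + 1) μ) Conn F = ∑ b : Σ v, Fin (cons (m + 1) μ v),
      Nat.card {α // IsGluing (Sigma.fst : (Σ v, Fin (cons (m + 1) μ v)) → Option ι)
        (stdRot (cons (m + 1) μ)) Conn F α ∧ α ⟨none, (0 : Fin (m + 1))⟩ = b} := by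
    rw [← Nat.card_sigma]
    refine Nat.card_congr
      ⟨fun α => ⟨α.1 ⟨none, (0 : Fin (m + 1))⟩, α.1, α.2, rfl⟩, fun x => ⟨x.2.1, x.2.2.1⟩, fun _ => rfl, ?_⟩
    rintro ⟨_, α, hα, rfl⟩
    rfl
  rw [h1, Fintype.sum_sigma, Fintype.sum_option, add_comm]
  congr 1
  · refine Finset.sum_congr rfl fun j _ => ?_
    refine (Finset.sum_eq_card_nsmul fun (k : Fin (μ j)) _ => card_isGluing_merge m μ j k F).trans ?_
    rw [smul_eq_mul]
    exact congrArg (· * _) (Finset.card_fin _)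
  · change ∑ i : Fin (m + 1), _ = _
    rw [Fin.sum_univ_succ]
    have h0 : Nat.card {α // IsGluing (Sigma.fst : (Σ v, Fin (cons (m + 1) μ v)) → Option ι)
        (stdRot (cons (m + 1) μ)) Conn F α ∧ α ⟨none, (0 : Fin (m + 1))⟩ = ⟨none, (0 : Fin (m + 1))⟩} = 0 := by
      have : IsEmpty {α // IsGluing (Sigma.fst : (Σ v, Fin (cons (m + 1) μ v)) → Option ι)
        (stdRot (cons (m + 1) μ)) Conn F α ∧ α ⟨none, (0 : Fin (m + 1))⟩ = ⟨none, (0 : Fin (m + 1))⟩} :=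
        ⟨fun α => α.2.1.ne _ α.2.2⟩
      exact Nat.card_of_isEmpty
    rw [h0, zero_add, Finset.sum_range]
    refine Finset.sum_congr rfl fun k _ => ?_
    rw [card_isGluing_split, gluings_connRoots]

end Roots
end BCMotzkin
end

noncomputable section
open Equiv Equiv.Perm
namespace BCMotzkin

/-! ### Gluings with an isolated root, and Euler's formula -/

section Vanishing
variable {ι : Type} [Fintype ι] [DecidableEq ι]

/-- A root without half-edges is linked to nothing. -/
theorem gluings_cons_zero_of_nonempty [Nonempty ι] (μ : ι → ℕ) (F : ℕ) :
    gluings (cons 0 μ) Conn F = 0 := by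
  have : IsEmpty {α // IsGluing (Sigma.fst : (Σ v, Fin (cons 0 μ v)) → Option ι) (stdRot (cons 0 μ)) Conn F α} := by
    refine ⟨fun ⟨α, hα⟩ => ?_⟩
    obtain ⟨i⟩ := ‹Nonempty ι›
    have := rel_of_eqvGen (r := fun x y : Option ι => x = none ↔ y = none)
      ⟨fun _ => Iff.rfl, fun h => h.symm, fun h h' => h.trans h'⟩ ?_ (hα.adj none (some i))
    · simp at this
    · have hne : ∀ x : Σ v, Fin (cons 0 μ v), x.1 ≠ none := by
        rintro ⟨_ | v, k⟩
        · exact Fin.elim0 k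
        · simp
      rintro _ _ ⟨x, rfl, rfl⟩
      exact iff_of_false (hne _) (hne _)
  exact Nat.card_of_isEmpty

/-- The single isolated vertex on the sphere: one gluing, and the one face around the vertex. -/
theorem gluings_cons_zero_of_isEmpty [IsEmpty ι] (μ : ι → ℕ) (F : ℕ) :
    gluings (cons 0 μ) Conn F = if F = 1 then 1 else 0 := by
  have hE : IsEmpty (Σ v, Fin (cons 0 μ v)) := by
    refine ⟨?_⟩
    rintro ⟨_ | v, k⟩
    · exact Fin.elim0 k
    · exact isEmptyElim v
  have hF : ∀ φ, numFaces (Sigma.fst : (Σ v, Fin (cons 0 μ v)) → Option ι) φ = 1 := by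
    intro φ
    have h1 : numCycles φ = 0 := by
      have : IsEmpty (Quotient (SameCycle.setoid φ)) := ⟨fun q => by
        induction q using Quotient.ind with
        | _ a => exact hE.false a⟩
      exact Nat.card_of_isEmpty
    have h2 : (Set.range (Sigma.fst : (Σ v, Fin (cons 0 μ v)) → Option ι))ᶜ = Set.univ := by
      rw [Set.range_eq_empty, Set.compl_empty]
    rw [numFaces, h1, h2, Set.ncard_univ]
    simp
  split_ifs with h
  · have : Unique {α // IsGluing (Sigma.fst : (Σ v, Fin (cons 0 μ v)) → Option ι) (stdRot (cons 0 μ)) Conn F α} :=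
      { default := ⟨1, fun x => (hE.false x).elim, fun x => (hE.false x).elim, fun a b => by
          rw [Subsingleton.elim a b]; exact .refl _, by rw [hF, h]⟩
        uniq := fun x => Subtype.ext (Subsingleton.elim _ _) }
    exact Nat.card_unique
  · have : IsEmpty {α // IsGluing (Sigma.fst : (Σ v, Fin (cons 0 μ v)) → Option ι) (stdRot (cons 0 μ)) Conn F α} :=
      ⟨fun α => h (by rw [← α.2.faces, hF])⟩
    exact Nat.card_of_isEmpty

theorem sum_cons (m : ℕ) (μ : ι → ℕ) : ∑ v, cons m μ v = m + ∑ i, μ i := Fintype.sum_option _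

theorem sum_subtype_ne (μ : ι → ℕ) (j : ι) : μ j + ∑ i : {i // i ≠ j}, μ i = ∑ i, μ i :=
  (Fintype.sum_eq_add_sum_subtype_ne μ j).symm

theorem card_subtype_ne (j : ι) : Fintype.card {i // i ≠ j} + 1 = Fintype.card ι := by
  have := sum_subtype_ne (fun _ => 1) j
  simp only [Finset.sum_const, Finset.card_univ, smul_eq_mul, mul_one] at this
  omega

theorem sum_mem_add_sum_notMem (μ : ι → ℕ) (I : Finset ι) :
    ∑ i : {i // i ∈ I}, μ i + ∑ i : {i // i ∉ I}, μ i = ∑ i, μ i := by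
  rw [← Fintype.sum_subtype_add_sum_subtype (· ∈ I) μ]
  congr!

theorem card_mem_add_card_notMem (I : Finset ι) :
    Fintype.card {i // i ∈ I} + Fintype.card {i // i ∉ I} = Fintype.card ι := by
  have := sum_mem_add_sum_notMem (fun _ => 1) I
  simpa only [Finset.sum_const, Finset.card_univ, smul_eq_mul, mul_one] using this

end Vanishing

/-- Euler's formula: the genus of a connected gluing is a natural number. -/
theorem exists_genus (n : ℕ) : ∀ (ι : Type) [Fintype ι] [DecidableEq ι] (m : ℕ) (μ : ι → ℕ) (F : ℕ),
    m + ∑ i, μ i = n → gluings (cons m μ) Conn F ≠ 0 →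
      ∃ g E, n = 2 * E ∧ Fintype.card ι + 1 + F + 2 * g = E + 2 := by
  induction n using Nat.strong_induction_on with
  | _ n ih =>
    intro ι _ _ m μ F hn h
    rcases m with _ | m
    · rcases isEmpty_or_nonempty ι with hι | hι
      · rw [gluings_cons_zero_of_isEmpty] at h
        obtain rfl : F = 1 := by
          by_contra hF; exact h (if_neg hF)
        have : ∑ i, μ i = 0 := by simp
        have : Fintype.card ι = 0 := Fintype.card_eq_zero
        exact ⟨0, 0, by omega, by omega⟩
      · exact absurd (gluings_cons_zero_of_nonempty μ F) h
    · rw [gluings_conn_succ] at h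
      -- A sum of natural numbers is nonzero only if some term is, so one of the contracted gluings
      -- exists and the induction applies to it.
      have h' : (∃ j, μ j * gluings (cons (m + μ j - 1) fun i : {i // i ≠ j} => μ i) Conn F ≠ 0) ∨
          (∃ k < m, gluings (cons (m - 1 - k) (cons k μ)) Conn F ≠ 0) ∨
          ∃ k < m, ∃ I : Finset ι, ∃ x : ℕ × ℕ, x.1 + x.2 = F ∧
            gluings (cons (m - 1 - k) fun i : {i // i ∈ I} => μ i) Conn x.1 *
              gluings (cons k fun i : {i // i ∉ I} => μ i) Conn x.2 ≠ 0 := by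
        by_contra hcon
        push Not at hcon
        obtain ⟨h1, h2, h3⟩ := hcon
        apply h
        rw [Finset.sum_eq_zero fun j _ => h1 j, zero_add]
        refine Finset.sum_eq_zero fun k hk => ?_
        rw [h2 k (Finset.mem_range.1 hk), zero_add]
        refine Finset.sum_eq_zero fun I _ => Finset.sum_eq_zero fun x hx => ?_
        exact h3 k (Finset.mem_range.1 hk) I x (Finset.HasAntidiagonal.mem_antidiagonal.1 hx)
      rcases h' with ⟨j, hj⟩ | ⟨k, hk, h'⟩ | ⟨k, hk, I, ⟨F₁, F₂⟩, rfl, h'⟩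
      · have h1 : μ j ≠ 0 := left_ne_zero_of_mul hj
        have h2 := right_ne_zero_of_mul hj
        have h3 := sum_subtype_ne μ j
        have h4 := card_subtype_ne j
        obtain ⟨g, E, h5, h6⟩ := ih (n - 2) (by omega) _ _ _ _ (by omega) h2
        exact ⟨g, E + 1, by omega, by omega⟩
      -- A connected splitting has one vertex more, one edge fewer and the same faces, so
      -- contraction lowers the genus by one.
      · obtain ⟨g, E, h5, h6⟩ := ih (n - 2) (by omega) _ _ _ _ (by rw [sum_cons]; omega) h'
        rw [Fintype.card_option] at h6
        exact ⟨g + 1, E + 1, by omega, by omega⟩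
      · have h1 := sum_mem_add_sum_notMem μ I
        have h2 := card_mem_add_card_notMem I
        obtain ⟨g₁, E₁, h5, h6⟩ := ih _ (by omega) _ _ _ _ rfl (left_ne_zero_of_mul h')
        obtain ⟨g₂, E₂, h7, h8⟩ := ih _ (by omega) _ _ _ _ rfl (right_ne_zero_of_mul h')
        exact ⟨g₁ + g₂, E₁ + E₂ + 1, by omega, by simp only at h6 h8; omega⟩

/-! ### Generalized Catalan numbers and their recursion -/

section Genus
variable {V ι : Type} [Fintype V] [Fintype ι] [DecidableEq ι]

/-- The number of connected gluings of genus `g` with vertex degrees `d`. -/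
def cat (g : ℕ) (d : V → ℕ) : ℕ :=
  if (∑ v, d v) % 2 = 0 ∧ Fintype.card V + 2 * g ≤ (∑ v, d v) / 2 + 2 then
    gluings d Conn ((∑ v, d v) / 2 + 2 - (Fintype.card V + 2 * g)) else 0

theorem cat_congr {V' : Type} [Fintype V'] (e : V ≃ V') {d : V → ℕ} {d' : V' → ℕ} (h : ∀ v, d' (e v) = d v)
    (g : ℕ) : cat g d = cat g d' := by
  unfold cat
  rw [← Fintype.card_congr e, ← Equiv.sum_comp e d']
  simp only [h]
  congr 1
  refine gluings_congr e h _ _ (fun R => ?_) _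
  exact (conn_iff_of_surjective e.surjective (fun v w h => by rw [e.injective h]; exact .refl _)
    (fun v w h => .rel _ _ h) (fun v w h => by
      obtain ⟨v, rfl⟩ := e.surjective v
      obtain ⟨w, rfl⟩ := e.surjective w
      exact ⟨v, w, rfl, rfl, .rel _ _ h⟩)).symm

theorem gluings_eq_cat {d : V → ℕ} {g E F : ℕ} (hE : ∑ v, d v = 2 * E)
    (h : Fintype.card V + F + 2 * g = E + 2) : gluings d Conn F = cat g d := by
  unfold cat
  rw [hE, if_pos ⟨by omega, by omega⟩]
  congr 1
  omega

theorem cat_ne_zero {d : V → ℕ} {g : ℕ} (h : cat g d ≠ 0) :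
    ∃ E F, ∑ v, d v = 2 * E ∧ Fintype.card V + F + 2 * g = E + 2 := by
  unfold cat at h
  split_ifs at h with h'
  · exact ⟨(∑ v, d v) / 2, (∑ v, d v) / 2 + 2 - (Fintype.card V + 2 * g), by omega, by omega⟩
  · exact absurd rfl h

theorem cat_cons_zero_of_nonempty [Nonempty ι] (g : ℕ) (μ : ι → ℕ) : cat g (cons 0 μ) = 0 := by
  unfold cat
  rw [gluings_cons_zero_of_nonempty, ite_self]

theorem cat_cons_zero_of_isEmpty [IsEmpty ι] (g : ℕ) (μ : ι → ℕ) :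
    cat g (cons 0 μ) = if g = 0 then 1 else 0 := by
  unfold cat
  rw [gluings_cons_zero_of_isEmpty, sum_cons]
  have : Fintype.card ι = 0 := Fintype.card_eq_zero
  simp only [Fintype.card_option, this, Finset.univ_eq_empty, Finset.sum_empty]
  split_ifs <;> omega

/-- Euler's formula for each component converts a distribution of the faces into one of the genus.
The correspondence is only made on nonzero terms: elsewhere the genus may fail to exist and the
truncated subtraction is meaningless. -/
theorem sum_gluings_mul_gluings {W : Type} [Fintype W] [DecidableEq W]
    (a b : ℕ) (μ : ι → ℕ) (ν : W → ℕ) {g E F : ℕ}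
    (hE : a + b + ∑ i, μ i + ∑ i, ν i = 2 * E)
    (h : Fintype.card ι + Fintype.card W + 2 + F + 2 * g = E + 4) :
    ∑ x ∈ Finset.HasAntidiagonal.antidiagonal F, gluings (cons a μ) Conn x.1 * gluings (cons b ν) Conn x.2 =
      ∑ x ∈ Finset.HasAntidiagonal.antidiagonal g, cat x.1 (cons a μ) * cat x.2 (cons b ν) := by
  symm
  have key : ∀ x : ℕ × ℕ, cat x.1 (cons a μ) * cat x.2 (cons b ν) ≠ 0 → ∃ E₁ F₁ E₂ F₂,
      a + ∑ i, μ i = 2 * E₁ ∧ Fintype.card ι + 1 + F₁ + 2 * x.1 = E₁ + 2 ∧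
      b + ∑ i, ν i = 2 * E₂ ∧ Fintype.card W + 1 + F₂ + 2 * x.2 = E₂ + 2 := by
    intro x hx
    obtain ⟨E₁, F₁, h1, h2⟩ := cat_ne_zero (left_ne_zero_of_mul hx)
    obtain ⟨E₂, F₂, h3, h4⟩ := cat_ne_zero (right_ne_zero_of_mul hx)
    rw [sum_cons] at h1 h3
    rw [Fintype.card_option] at h2 h4
    exact ⟨E₁, F₁, E₂, F₂, h1, h2, h3, h4⟩
  refine Finset.sum_bij_ne_zero (fun x _ _ => ((a + ∑ i, μ i) / 2 + 2 - (Fintype.card ι + 1 + 2 * x.1),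
    (b + ∑ i, ν i) / 2 + 2 - (Fintype.card W + 1 + 2 * x.2))) ?_ ?_ ?_ ?_
  · intro x hx hne
    rw [Finset.HasAntidiagonal.mem_antidiagonal] at hx ⊢
    obtain ⟨E₁, F₁, E₂, F₂, h1, h2, h3, h4⟩ := key x hne
    simp only
    omega
  · intro x hx hne y hy hne' hxy
    obtain ⟨E₁, F₁, E₂, F₂, h1, h2, h3, h4⟩ := key x hne
    obtain ⟨E₁', F₁', E₂', F₂', h1', h2', h3', h4'⟩ := key y hne'
    simp only [Prod.mk.injEq] at hxy
    ext
    · omega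
    · omega
  · intro x hx hne
    rw [Finset.HasAntidiagonal.mem_antidiagonal] at hx
    obtain ⟨g₁, E₁, h1, h2⟩ := exists_genus _ _ _ _ _ rfl (left_ne_zero_of_mul hne)
    obtain ⟨g₂, E₂, h3, h4⟩ := exists_genus _ _ _ _ _ rfl (right_ne_zero_of_mul hne)
    refine ⟨(g₁, g₂), ?_, ?_, ?_⟩
    · rw [Finset.HasAntidiagonal.mem_antidiagonal]; simp only; omega
    · rw [gluings_eq_cat (E := E₁) (g := g₁) (by rw [sum_cons, h1]) (by rw [Fintype.card_option]; omega),
        gluings_eq_cat (E := E₂) (g := g₂) (by rw [sum_cons, h3]) (by rw [Fintype.card_option]; omega)] at hne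
      exact hne
    · ext
      · simp only; omega
      · simp only; omega
  · intro x hx hne
    obtain ⟨E₁, F₁, E₂, F₂, h1, h2, h3, h4⟩ := key x hne
    rw [gluings_eq_cat (E := E₁) (g := x.1) (by rw [sum_cons, h1]) (by rw [Fintype.card_option]; omega),
      gluings_eq_cat (E := E₂) (g := x.2) (by rw [sum_cons, h3]) (by rw [Fintype.card_option]; omega)]

/-- The recursion for the generalized Catalan numbers. -/
theorem cat_succ (g m : ℕ) (μ : ι → ℕ) :
    cat g (cons (m + 1) μ) =
      ∑ j, μ j * cat g (cons (m + μ j - 1) fun i : {i // i ≠ j} => μ i) +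
      ∑ k ∈ Finset.range m, ((if 1 ≤ g then cat (g - 1) (cons (m - 1 - k) (cons k μ)) else 0) +
        ∑ I : Finset ι, ∑ x ∈ Finset.HasAntidiagonal.antidiagonal g,
          cat x.1 (cons (m - 1 - k) fun i : {i // i ∈ I} => μ i) *
            cat x.2 (cons k fun i : {i // i ∉ I} => μ i)) := by
  by_cases h : ∃ E F, m + 1 + ∑ i, μ i = 2 * E ∧ Fintype.card ι + 1 + F + 2 * g = E + 2
  · obtain ⟨E, F, hE, hF⟩ := h
    rw [← gluings_eq_cat (E := E) (F := F) (by rw [sum_cons, hE]) (by rw [Fintype.card_option, hF]),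
      gluings_conn_succ]
    congr 1
    · refine Finset.sum_congr rfl fun j _ => ?_
      rcases Nat.eq_zero_or_pos (μ j) with h0 | h0
      · rw [h0, zero_mul, zero_mul]
      have h3 := sum_subtype_ne μ j
      have h4 := card_subtype_ne j
      rw [gluings_eq_cat (E := E - 1) (g := g) (by rw [sum_cons]; omega) (by rw [Fintype.card_option]; omega)]
    · refine Finset.sum_congr rfl fun k hk => ?_
      rw [Finset.mem_range] at hk
      congr 1
      · split_ifs with hg
        · rw [gluings_eq_cat (E := E - 1) (g := g - 1) (by rw [sum_cons, sum_cons]; omega)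
            (by rw [Fintype.card_option, Fintype.card_option]; omega)]
        -- In genus 0 a connected splitting would leave a gluing of genus -1, which `exists_genus`
        -- excludes.
        · by_contra hne
          obtain ⟨g', E', h1, h2⟩ := exists_genus _ _ _ _ _ rfl hne
          rw [sum_cons] at h1
          rw [Fintype.card_option] at h2
          omega
      · refine Finset.sum_congr rfl fun I _ => ?_
        have h1 := sum_mem_add_sum_notMem μ I
        have h2 := card_mem_add_card_notMem I
        exact sum_gluings_mul_gluings (E := E - 1) _ _ _ _ (by omega) (by omega)
  · have h0 : cat g (cons (m + 1) μ) = 0 := by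
      by_contra hne
      obtain ⟨E, F, h1, h2⟩ := cat_ne_zero hne
      rw [sum_cons] at h1
      rw [Fintype.card_option] at h2
      exact h ⟨E, F, h1, h2⟩
    rw [h0]
    symm
    rw [Nat.add_eq_zero_iff]
    constructor
    · refine Finset.sum_eq_zero fun j _ => ?_
      by_contra hne
      have hj := left_ne_zero_of_mul hne
      obtain ⟨E, F, h1, h2⟩ := cat_ne_zero (right_ne_zero_of_mul hne)
      rw [sum_cons] at h1
      rw [Fintype.card_option] at h2
      have h3 := sum_subtype_ne μ j
      have h4 := card_subtype_ne j
      exact h ⟨E + 1, F, by omega, by omega⟩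
    · refine Finset.sum_eq_zero fun k hk => ?_
      rw [Finset.mem_range] at hk
      rw [Nat.add_eq_zero_iff]
      constructor
      · split_ifs with hg
        · by_contra hne
          obtain ⟨E, F, h1, h2⟩ := cat_ne_zero hne
          rw [sum_cons, sum_cons] at h1
          rw [Fintype.card_option, Fintype.card_option] at h2
          exact h ⟨E + 1, F, by omega, by omega⟩
        · rfl
      · refine Finset.sum_eq_zero fun I _ => Finset.sum_eq_zero fun x hx => ?_
        rw [Finset.HasAntidiagonal.mem_antidiagonal] at hx
        by_contra hne
        obtain ⟨E₁, F₁, h1, h2⟩ := cat_ne_zero (left_ne_zero_of_mul hne)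
        obtain ⟨E₂, F₂, h3, h4⟩ := cat_ne_zero (right_ne_zero_of_mul hne)
        rw [sum_cons] at h1 h3
        rw [Fintype.card_option] at h2 h4
        have h5 := sum_mem_add_sum_notMem μ I
        have h6 := card_mem_add_card_notMem I
        exact h ⟨E₁ + E₂ + 1, F₁ + F₂, by omega, by omega⟩

theorem conn_iff_connected {v : ℕ} (hv : 1 ≤ v) (μ : Fin v → ℕ) (α : Perm (HalfEdge μ)) :
    (vertexGraph μ α).Connected ↔ Conn (Linked (Sigma.fst : HalfEdge μ → Fin v) α) := by
  rw [SimpleGraph.connected_iff]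
  have : Nonempty (Fin v) := ⟨⟨0, hv⟩⟩
  constructor
  · rintro ⟨h, -⟩ a b
    obtain ⟨p⟩ := h a b
    induction p with
    | nil => exact .refl _
    | cons hadj _ ih =>
      refine Relation.EqvGen.trans _ _ _ ?_ ih
      obtain ⟨-, h' | h'⟩ := (SimpleGraph.fromRel_adj _ _ _).1 hadj
      · exact .rel _ _ h'
      · exact .symm _ _ (.rel _ _ h')
  · intro h
    refine ⟨fun a b => ?_, this⟩
    refine rel_of_eqvGen (r := (vertexGraph μ α).Reachable)
      ⟨fun _ => .refl _, fun h => h.symm, fun h h' => h.trans h'⟩ ?_ (h a b)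
    intro a b hab
    by_cases hne : a = b
    · rw [hne]
    · exact SimpleGraph.Adj.reachable ((SimpleGraph.fromRel_adj _ _ _).2 ⟨hne, Or.inl hab⟩)

theorem faceCount_eq_numFaces {v : ℕ} (μ : Fin v → ℕ) (α : Perm (HalfEdge μ)) :
    faceCount μ α = numFaces (Sigma.fst : HalfEdge μ → Fin v) (stdRot μ * α) := by
  unfold faceCount numFaces
  congr 1
  rw [← Nat.card_coe_set_eq]
  refine Nat.card_congr (Equiv.subtypeEquivRight fun i => ?_)
  rw [Set.mem_compl_iff, Set.mem_range]
  constructor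
  · rintro h ⟨⟨j, k⟩, rfl⟩
    have := k.2
    simp only at h
    omega
  · intro h
    by_contra hne
    exact h ⟨⟨i, ⟨0, Nat.pos_of_ne_zero hne⟩⟩, rfl⟩

/-- The two definitions differ by the treatment of an odd degree sum: Euler's formula in
`IsCatalanGraph` halves it with rounding, while `cat` returns 0. No gluing exists in that case. -/
theorem genCatalan_eq_cat {v : ℕ} (hv : 1 ≤ v) (g : ℕ) (μ : Fin v → ℕ) : genCatalan g μ = cat g μ := by
  have hiff : ∀ α, IsCatalanGraph g μ α ↔ ∃ F, IsGluing (Sigma.fst : HalfEdge μ → Fin v) (stdRot μ) Conn F α ∧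
      v + F + 2 * g = (∑ i, μ i) / 2 + 2 := by
    intro α
    constructor
    · rintro ⟨h1, h2, h3, h4⟩
      refine ⟨_, ⟨h1, h2, (conn_iff_connected hv μ α).1 h3, rfl⟩, ?_⟩
      rw [← faceCount_eq_numFaces]
      omega
    · rintro ⟨F, ⟨h1, h2, h3, h4⟩, h5⟩
      refine ⟨h1, h2, (conn_iff_connected hv μ α).2 h3, ?_⟩
      rw [faceCount_eq_numFaces, h4]
      omega
  unfold genCatalan
  by_cases h : (∑ i, μ i) % 2 = 0 ∧ v + 2 * g ≤ (∑ i, μ i) / 2 + 2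
  · unfold cat
    rw [Fintype.card_fin, if_pos h]
    refine Nat.card_congr (Equiv.subtypeEquivRight fun α => ?_)
    rw [hiff]
    constructor
    · rintro ⟨F, h1, h2⟩
      rwa [show (∑ i, μ i) / 2 + 2 - (v + 2 * g) = F by omega]
    · exact fun h1 => ⟨_, h1, by omega⟩
  · have h0 : cat g μ = 0 := by
      unfold cat
      rw [Fintype.card_fin, if_neg h]
    rw [h0]
    have : IsEmpty {α // IsCatalanGraph g μ α} := by
      refine ⟨fun ⟨α, hα⟩ => h ?_⟩
      obtain ⟨F, h1, h2⟩ := (hiff α).1 hα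
      refine ⟨?_, by omega⟩
      obtain ⟨n, rfl⟩ : ∃ n, v = n + 1 := ⟨v - 1, by omega⟩
      -- The parity of the degree sum is taken from `exists_genus`, after the vertex 0 has been made
      -- the root.
      have h3 : gluings μ Conn F ≠ 0 := by
        have : Nonempty {α // IsGluing (Sigma.fst : HalfEdge μ → Fin (n + 1)) (stdRot μ) Conn F α} := ⟨⟨α, h1⟩⟩
        exact Nat.card_pos.ne'
      have h4 : gluings (cons (μ 0) fun i : Fin n => μ i.succ) Conn F ≠ 0 := by
        rw [gluings_congr (finSuccEquiv n).symm (d' := μ) _ Conn Conn]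
        · exact h3
        · intro R
          refine (conn_iff_of_surjective (finSuccEquiv n).symm.surjective (fun v w h => by
              rw [(finSuccEquiv n).symm.injective h]; exact .refl _)
            (fun v w h => .rel _ _ h) (fun v w h => by
              obtain ⟨v, rfl⟩ := (finSuccEquiv n).symm.surjective v
              obtain ⟨w, rfl⟩ := (finSuccEquiv n).symm.surjective w
              exact ⟨v, w, rfl, rfl, .rel _ _ h⟩)).symm
        · rintro (_ | i)
          · simp
          · simp
      obtain ⟨g', E, h5, -⟩ := exists_genus _ _ _ _ _ rfl h4
      rw [Fin.sum_univ_succ, h5]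
      omega
    exact Nat.card_of_isEmpty

end Genus
end BCMotzkin
end

noncomputable section
open PowerSeries Finset
namespace BCMotzkin

/-! ### Generating series in the degree of the root -/

section Generating
variable {ι : Type} [Fintype ι] [DecidableEq ι]

/-- The generating series of the generalized Catalan numbers in the degree of the root. -/
def gf (g : ℕ) (μ : ι → ℕ) : PowerSeries ℝ := .mk fun m => (cat g (cons m μ) : ℝ)

@[simp] theorem coeff_gf (g m : ℕ) (μ : ι → ℕ) : coeff m (gf g μ) = cat g (cons m μ) := coeff_mk _ _

theorem gf_congr {κ : Type} [Fintype κ] [DecidableEq κ] (e : ι ≃ κ) {μ : ι → ℕ} {ν : κ → ℕ}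
    (h : ∀ i, ν (e i) = μ i) (g : ℕ) : gf g μ = gf g ν := by
  ext m
  rw [coeff_gf, coeff_gf, cat_congr (e.optionCongr) (d' := cons m ν)]
  rintro (_ | i)
  · rfl
  · exact h i

/-- The series of the gluings obtained by merging a vertex of degree `n` with the root. -/
def cut (n : ℕ) (f : PowerSeries ℝ) : PowerSeries ℝ :=
  .mk fun m => if m = 0 then 0 else (n : ℝ) * coeff (m + n) f

/-- The series of the gluings obtained by splitting the root in a connected way. -/
def dbl (g : ℕ) (μ : ι → ℕ) : PowerSeries ℝ :=
  if 1 ≤ g then .mk fun n => ∑ x ∈ antidiagonal n, (cat (g - 1) (cons x.1 (cons x.2 μ)) : ℝ) else 0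

theorem sum_range_sub_eq_sum_antidiagonal (f : ℕ → ℕ → ℝ) (m : ℕ) :
    ∑ k ∈ range (m + 1), f (m - k) k = ∑ x ∈ antidiagonal m, f x.1 x.2 := by
  rw [← Nat.sum_antidiagonal_swap]
  exact (Nat.sum_antidiagonal_eq_sum_range_succ (fun i j => f j i) m).symm

/-- This is `cat_succ` summed over the degree of the root. The removed edge has two ends, whence X²;
the constant term, about which the recursion says nothing, is added separately, and `cut` vanishes
in degree 0 for the same reason. -/
theorem gf_eq (g : ℕ) (μ : ι → ℕ) :
    gf g μ = C (cat g (cons 0 μ) : ℝ) + ∑ j, cut (μ j) (X ^ 2 * gf g fun i : {i // i ≠ j} => μ i) +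
      X ^ 2 * (dbl g μ + ∑ I : Finset ι, ∑ x ∈ antidiagonal g,
        gf x.1 (fun i : {i // i ∈ I} => μ i) * gf x.2 fun i : {i // i ∉ I} => μ i) := by
  ext m
  rw [map_add, map_add, map_sum, coeff_C, coeff_gf, coeff_X_pow_mul']
  rcases m with _ | m
  · simp [cut]
  rw [cat_succ, if_neg (Nat.succ_ne_zero m), zero_add]
  push_cast
  congr 1
  · refine sum_congr rfl fun j _ => ?_
    rw [cut, coeff_mk, if_neg (Nat.succ_ne_zero m)]
    rcases Nat.eq_zero_or_pos (μ j) with h | h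
    · rw [h, Nat.cast_zero, zero_mul, zero_mul]
    · rw [coeff_X_pow_mul', if_pos (by omega), coeff_gf, show m + 1 + μ j - 2 = m + μ j - 1 by omega]
  · rcases m with _ | m
    · simp
    rw [if_pos (by omega)]
    simp only [Nat.add_sub_cancel]
    rw [
      sum_range_sub_eq_sum_antidiagonal
        (fun a b => (if 1 ≤ g then (cat (g - 1) (cons a (cons b μ)) : ℝ) else 0) +
        ∑ I : Finset ι, ∑ x ∈ antidiagonal g,
          (cat x.1 (cons a fun i : {i // i ∈ I} => μ i) : ℝ) *
            cat x.2 (cons b fun i : {i // i ∉ I} => μ i)) m, sum_add_distrib, map_add, map_sum]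
    congr 1
    · unfold dbl
      split_ifs
      · rw [coeff_mk]
      · simp
    · rw [sum_comm]
      refine sum_congr rfl fun I _ => ?_
      rw [sum_comm, map_sum]
      refine sum_congr rfl fun x _ => ?_
      rw [coeff_mul]
      simp only [coeff_gf]

end Generating

/-! ### The one-vertex sphere, the coordinate u, and the basic series -/

section OneVertex

/-- The generating series of the gluings of genus `0` with one vertex. -/
def cSer : PowerSeries ℝ := gf 0 (Empty.elim : Empty → ℕ)

theorem gf_zero_of_isEmpty {ι : Type} [Fintype ι] [DecidableEq ι] [IsEmpty ι] (μ : ι → ℕ) :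
    gf 0 μ = cSer := gf_congr (Equiv.equivOfIsEmpty _ _) (fun i => isEmptyElim i) 0

/-- With a single vertex in genus 0 only the disconnected splitting survives: the classical Catalan
equation. -/
theorem cSer_eq : cSer = 1 + X ^ 2 * (cSer * cSer) := by
  conv_lhs => rw [cSer, gf_eq]
  rw [cat_cons_zero_of_isEmpty]
  simp [dbl, gf_zero_of_isEmpty]

/-- The square root of `1 - 4 X ^ 2`. -/
def rSer : PowerSeries ℝ := 1 - 2 * X ^ 2 * cSer

theorem rSer_sq : rSer ^ 2 = 1 - 4 * X ^ 2 := by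
  unfold rSer
  linear_combination -(4 * X ^ 2) * cSer_eq

theorem constantCoeff_rSer : constantCoeff rSer = 1 := by
  simp [rSer]

/-- The series `∑ a ^ m X ^ m`. -/
def geom (a : ℝ) : PowerSeries ℝ := .mk fun m => a ^ m

theorem geom_mul (a : ℝ) : geom a * (1 - C a * X) = 1 := by
  ext m
  rw [mul_sub, mul_one, map_sub, mul_comm (C a) X, ← mul_assoc, coeff_mul_C]
  rcases m with _ | m
  · simp [geom]
  · rw [coeff_succ_mul_X]
    simp [geom, coeff_one, pow_succ]

/-- The square root of `(1 + 2 X) / (1 - 2 X)`. -/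
def uUnit : (PowerSeries ℝ)ˣ where
  val := rSer * geom 2
  inv := rSer * geom (-2)
  val_inv := by
    have h1 := geom_mul 2
    have h2 := geom_mul (-2)
    rw [map_neg] at h2
    have h3 : (C 2 : PowerSeries ℝ) = 2 := map_ofNat _ 2
    rw [h3] at h1 h2
    linear_combination geom 2 * geom (-2) * rSer_sq + (1 + 2 * X) * geom (-2) * h1 + h2
  inv_val := by
    have h1 := geom_mul 2
    have h2 := geom_mul (-2)
    rw [map_neg] at h2
    have h3 : (C 2 : PowerSeries ℝ) = 2 := map_ofNat _ 2
    rw [h3] at h1 h2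
    linear_combination geom 2 * geom (-2) * rSer_sq + (1 + 2 * X) * geom (-2) * h1 + h2

/-- The powers of `uUnit`. -/
def uPow (n : ℤ) : PowerSeries ℝ := ((uUnit ^ n : (PowerSeries ℝ)ˣ) : PowerSeries ℝ)

theorem uPow_add (m n : ℤ) : uPow (m + n) = uPow m * uPow n := by
  rw [uPow, zpow_add, Units.val_mul]; rfl

theorem uPow_zero : uPow 0 = 1 := by simp [uPow]

theorem uPow_one : uPow 1 = rSer * geom 2 := by simp [uPow]; rfl

theorem uPow_neg_one : uPow (-1) = rSer * geom (-2) := by simp [uPow]; rfl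

theorem uPow_ne_zero (n : ℤ) : uPow n ≠ 0 := Units.ne_zero _

theorem uPow_one_mul : uPow 1 * (1 - 2 * X) = rSer := by
  have h1 := geom_mul 2
  have h3 : (C 2 : PowerSeries ℝ) = 2 := map_ofNat _ 2
  rw [h3] at h1
  rw [uPow_one]
  linear_combination rSer * h1

theorem uPow_one_sq : uPow 1 ^ 2 * (1 - 2 * X) = 1 + 2 * X := by
  have h1 := geom_mul 2
  have h3 : (C 2 : PowerSeries ℝ) = 2 := map_ofNat _ 2
  rw [h3] at h1
  rw [uPow_one]
  linear_combination geom 2 ^ 2 * (1 - 2 * X) * rSer_sq + (geom 2 * (1 - 4 * X ^ 2) + (1 + 2 * X)) * h1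

theorem two_X_mul : 2 * X * (uPow 1 ^ 2 + 1) = uPow 1 ^ 2 - 1 := by
  linear_combination -uPow_one_sq

theorem rSer_mul : rSer * (uPow 1 ^ 2 + 1) = 2 * uPow 1 := by
  rw [← uPow_one_mul]
  linear_combination uPow 1 * uPow_one_sq

theorem constantCoeff_uPow_one : constantCoeff (uPow 1) = 1 := by
  rw [uPow_one, map_mul, constantCoeff_rSer]; simp [geom]

theorem constantCoeff_uPow (n : ℤ) : constantCoeff (uPow n) = 1 := by
  have : Units.map (constantCoeff (R := ℝ) : PowerSeries ℝ →* ℝ) uUnit = 1 := by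
    ext
    have := constantCoeff_uPow_one
    rw [uPow, zpow_one] at this
    exact this
  have h2 : Units.map (constantCoeff (R := ℝ) : PowerSeries ℝ →* ℝ) (uUnit ^ n) = 1 := by
    rw [map_zpow, this, one_zpow]
  exact congrArg Units.val h2

theorem uPow_one_sq_add_one_ne_zero : uPow 1 ^ 2 + 1 ≠ 0 := by
  intro h
  have := congrArg (constantCoeff (R := ℝ)) h
  rw [map_add, map_pow, constantCoeff_uPow_one] at this
  norm_num at this

theorem X_mul_derivative_uPow_one :
    4 * uPow 1 * (X * d⁄dX ℝ (uPow 1)) = uPow 1 ^ 4 - 1 := by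
  have h := congrArg (d⁄dX ℝ) two_X_mul
  rw [show (2 : PowerSeries ℝ) * X * (uPow 1 ^ 2 + 1) =
      X * (uPow 1 * uPow 1) + X * (uPow 1 * uPow 1) + X + X by ring,
    show uPow 1 ^ 2 - 1 = uPow 1 * uPow 1 - 1 by ring] at h
  simp only [map_add, map_sub, Derivation.leibniz, Derivation.map_one_eq_zero, derivative_X,
    smul_eq_mul] at h
  linear_combination (2 * uPow 1 * X * d⁄dX ℝ (uPow 1) + (uPow 1 ^ 2 + 1)) * two_X_mul -
    X * (uPow 1 ^ 2 + 1) * h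

/-- Follows from the differential equation X u' = (u⁴ - 1)/(4u) by the power rule, proved by
induction in both directions because u is a unit. It makes X d/dX act on the span of the powers of u
and preserve the parity of the exponent. -/
theorem X_mul_derivative_uPow (n : ℤ) :
    4 * (X * d⁄dX ℝ (uPow n)) = (n : PowerSeries ℝ) * (uPow (n + 2) - uPow (n - 2)) := by
  have hstep : ∀ n : ℤ, 4 * (X * d⁄dX ℝ (uPow (n + 1))) =
      uPow 1 * (4 * (X * d⁄dX ℝ (uPow n))) + (uPow (n + 3) - uPow (n - 1)) := by
    intro n
    have h1 := X_mul_derivative_uPow_one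
    have h2 : uPow (n + 3) = uPow (n - 1) * uPow 1 ^ 4 := by
      rw [← one_mul (uPow 1), show n + 3 = n - 1 + 1 + 1 + 1 + 1 by ring]
      simp only [uPow_add]; ring
    have h3 : uPow n = uPow (n - 1) * uPow 1 := by rw [← uPow_add, sub_add_cancel]
    rw [uPow_add n 1, Derivation.leibniz, h2]
    simp only [smul_eq_mul]
    linear_combination uPow (n - 1) * h1 + 4 * X * d⁄dX ℝ (uPow 1) * h3
  induction n using Int.induction_on with
  | zero => simp [uPow_zero]
  | succ n ih =>
    rw [hstep, ih]
    have h2 : uPow 1 * uPow ((n : ℤ) + 2) = uPow (n + 3) := by rw [← uPow_add]; congr 1; ring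
    have h3 : uPow 1 * uPow ((n : ℤ) - 2) = uPow (n - 1) := by rw [← uPow_add]; congr 1; ring
    rw [show (n : ℤ) + 1 + 2 = n + 3 by ring, show (n : ℤ) + 1 - 2 = n - 1 by ring]
    push_cast
    linear_combination (n : PowerSeries ℝ) * (h2 - h3)
  | pred n ih =>
    have h := hstep (-(n : ℤ) - 1)
    rw [sub_add_cancel, ih] at h
    refine mul_left_cancel₀ (uPow_ne_zero 1) ?_
    have h2 : uPow 1 * uPow (-(n : ℤ) - 1 + 2) = uPow (-n + 2) := by rw [← uPow_add]; congr 1; ring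
    have h3 : uPow 1 * uPow (-(n : ℤ) - 1 - 2) = uPow (-n - 2) := by rw [← uPow_add]; congr 1; ring
    rw [show -(n : ℤ) - 1 + 3 = -n + 2 by ring, show -(n : ℤ) - 1 - 1 = -n - 2 by ring] at h
    push_cast at h ⊢
    linear_combination -h + (n + 1 : PowerSeries ℝ) * (h2 - h3)

/-- The basic odd series: `X d/dX` of `uPow (2 * k + 1) / (2 * k + 1)`. -/
def eSer (k : ℤ) : PowerSeries ℝ := C (1 / 4) * (uPow (2 * k + 3) - uPow (2 * k - 1))

theorem four_mul_C : (4 : PowerSeries ℝ) * C (1 / 4) = 1 := by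
  rw [show (4 : PowerSeries ℝ) = C 4 from (map_ofNat _ 4).symm, ← map_mul]; norm_num

theorem X_mul_derivative_uPow_odd (k : ℤ) :
    X * d⁄dX ℝ (uPow (2 * k + 1)) = C (2 * k + 1 : ℝ) * eSer k := by
  have h := X_mul_derivative_uPow (2 * k + 1)
  rw [show 2 * k + 1 + 2 = 2 * k + 3 by ring, show 2 * k + 1 - 2 = 2 * k - 1 by ring] at h
  have h1 : (C (2 * k + 1 : ℝ) : PowerSeries ℝ) = ((2 * k + 1 : ℤ) : PowerSeries ℝ) := by
    rw [show (2 * k + 1 : ℝ) = ((2 * k + 1 : ℤ) : ℝ) by push_cast; ring, map_intCast]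
  rw [h1, eSer]
  linear_combination C (1 / 4) * h - (X * d⁄dX ℝ (uPow (2 * k + 1))) * four_mul_C

/-- The coefficients of `eSer k`. -/
def eCoeff (k : ℤ) (m : ℕ) : ℝ := coeff m (eSer k)

/-- The factor m is what later absorbs the denominator n of the Laplace transform. -/
theorem eCoeff_mul (k : ℤ) (m : ℕ) : (2 * k + 1) * eCoeff k m = m * coeff m (uPow (2 * k + 1)) := by
  have h := congrArg (coeff m) (X_mul_derivative_uPow_odd k)
  rw [coeff_C_mul] at h
  rw [eCoeff, ← h]
  rcases m with _ | m
  · simp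
  · rw [coeff_succ_X_mul, coeff_derivative]; push_cast; ring

theorem eCoeff_zero (k : ℤ) : eCoeff k 0 = 0 := by
  simp [eCoeff, eSer, constantCoeff_uPow]

/-- Here e_k = u^(2k-1)(u⁴ - 1)/4, X = (u² - 1)/(2(u² + 1)) and r = 2u/(u² + 1). Dividing X² e_k e_l
by r leaves the factor (u² - 1)³, whose expansion is the third difference. The leading coefficient
1/32 is positive, which matters for the degree. -/
theorem X_sq_mul_eSer_mul_eSer (k l : ℤ) : X ^ 2 * (eSer k * eSer l) =
    rSer * (C (1 / 32) * (eSer (k + l + 2) - 3 * eSer (k + l + 1) + 3 * eSer (k + l) - eSer (k + l - 1))) := by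
  set u := uPow 1
  have hu : ∀ (j : ℤ), uPow j = uPow (2 * (k + l) - 3) * uPow (j - (2 * (k + l) - 3)) := fun j => by
    rw [← uPow_add]; congr 1; ring
  have hn : ∀ n : ℕ, uPow n = u ^ n := fun n => by simp [u, uPow]
  have e1 : eSer k * eSer l = C (1 / 4) ^ 2 * (uPow (2 * (k + l) - 3) * (u ^ 9 - 2 * u ^ 5 + u)) := by
    have : (uPow (2 * k + 3) - uPow (2 * k - 1)) * (uPow (2 * l + 3) - uPow (2 * l - 1)) =
        uPow (2 * (k + l) - 3) * (u ^ 9 - 2 * u ^ 5 + u) := by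
      have h9 : uPow (2 * k + 3) * uPow (2 * l + 3) = uPow (2 * (k + l) - 3) * u ^ 9 := by
        rw [← hn, ← uPow_add, ← uPow_add]; congr 1; push_cast; ring
      have h5 : uPow (2 * k + 3) * uPow (2 * l - 1) = uPow (2 * (k + l) - 3) * u ^ 5 := by
        rw [← hn, ← uPow_add, ← uPow_add]; congr 1; push_cast; ring
      have h5' : uPow (2 * k - 1) * uPow (2 * l + 3) = uPow (2 * (k + l) - 3) * u ^ 5 := by
        rw [← hn, ← uPow_add, ← uPow_add]; congr 1; push_cast; ring
      have h1 : uPow (2 * k - 1) * uPow (2 * l - 1) = uPow (2 * (k + l) - 3) * u := by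
        rw [← uPow_add, ← uPow_add]; congr 1; ring
      linear_combination h9 - h5 - h5' + h1
    rw [eSer, eSer]
    linear_combination C (1 / 4) ^ 2 * this
  have e2 : eSer (k + l + 2) - 3 * eSer (k + l + 1) + 3 * eSer (k + l) - eSer (k + l - 1) =
      C (1 / 4) * (uPow (2 * (k + l) - 3) * ((u ^ 4 - 1) * (u ^ 2 - 1) ^ 3)) := by
    have a10 : uPow (2 * (k + l + 2) + 3) = uPow (2 * (k + l) - 3) * u ^ 10 := by
      rw [← hn, ← uPow_add]; congr 1; push_cast; ring
    have a6 : uPow (2 * (k + l + 2) - 1) = uPow (2 * (k + l) - 3) * u ^ 6 := by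
      rw [← hn, ← uPow_add]; congr 1; push_cast; ring
    have b8 : uPow (2 * (k + l + 1) + 3) = uPow (2 * (k + l) - 3) * u ^ 8 := by
      rw [← hn, ← uPow_add]; congr 1; push_cast; ring
    have b4 : uPow (2 * (k + l + 1) - 1) = uPow (2 * (k + l) - 3) * u ^ 4 := by
      rw [← hn, ← uPow_add]; congr 1; push_cast; ring
    have c6 : uPow (2 * (k + l) + 3) = uPow (2 * (k + l) - 3) * u ^ 6 := by
      rw [← hn, ← uPow_add]; congr 1; push_cast; ring
    have c2 : uPow (2 * (k + l) - 1) = uPow (2 * (k + l) - 3) * u ^ 2 := by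
      rw [← hn, ← uPow_add]; congr 1; push_cast; ring
    have d4 : uPow (2 * (k + l - 1) + 3) = uPow (2 * (k + l) - 3) * u ^ 4 := by
      rw [← hn, ← uPow_add]; congr 1; push_cast; ring
    have d0 : uPow (2 * (k + l - 1) - 1) = uPow (2 * (k + l) - 3) := by
      congr 1; ring
    simp only [eSer, a10, a6, b8, b4, c6, c2, d4, d0]
    ring
  rw [e1, e2]
  have h0 := uPow_one_sq_add_one_ne_zero
  -- After multiplication by (u² + 1)², the series X² and r enter through polynomials in u.
  refine mul_left_cancel₀ (pow_ne_zero 2 h0) ?_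
  have h32 : (C (1 / 32) : PowerSeries ℝ) = 2 * C (1 / 4) ^ 3 := by
    rw [show (2 : PowerSeries ℝ) = C 2 from (map_ofNat _ 2).symm, ← map_pow, ← map_mul]; norm_num
  have h4 : (4 : PowerSeries ℝ) * C (1 / 4) = 1 := four_mul_C
  have hX := two_X_mul
  have hr := rSer_mul
  change 2 * X * (u ^ 2 + 1) = u ^ 2 - 1 at hX
  change rSer * (u ^ 2 + 1) = 2 * u at hr
  rw [h32]
  have hX' : X * (u ^ 2 + 1) = 2 * C (1 / 4) * (u ^ 2 - 1) := by
    linear_combination 2 * C (1 / 4) * hX - X * (u ^ 2 + 1) * h4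
  linear_combination C (1 / 4) ^ 2 * uPow (2 * (k + l) - 3) * (u ^ 9 - 2 * u ^ 5 + u) *
    (X * (u ^ 2 + 1) + 2 * C (1 / 4) * (u ^ 2 - 1)) * hX' -
    2 * C (1 / 4) ^ 4 * uPow (2 * (k + l) - 3) * (u ^ 2 + 1) * ((u ^ 4 - 1) * (u ^ 2 - 1) ^ 3) * hr

end OneVertex
end BCMotzkin
end

noncomputable section
open PowerSeries Finset
namespace BCMotzkin

/-! ### Series in two variables and divided differences -/

section TwoVariables

/-- The power series in two variables, the first one being inner. -/
abbrev Two : Type := PowerSeries (PowerSeries ℝ)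

/-- A series in the first variable. -/
abbrev inFst : PowerSeries ℝ →+* Two := C

/-- A series in the second variable. -/
abbrev inSnd : PowerSeries ℝ →+* Two := PowerSeries.map C

/-- The generating series of `fun n => cut n f`. -/
def cutSer (f : PowerSeries ℝ) : Two := .mk fun n => cut n f

theorem coeff_cut (m n : ℕ) (f : PowerSeries ℝ) :
    coeff m (cut n f) = if m = 0 then 0 else (n : ℝ) * coeff (m + n) f := coeff_mk _ _

theorem coeff_X_mul' {R : Type*} [Semiring R] (n : ℕ) (f : PowerSeries R) :
    coeff n (X * f) = if n = 0 then 0 else coeff (n - 1) f := by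
  rcases n with _ | n
  · simp
  · simp [coeff_succ_X_mul]

theorem coeff_inSnd (m n : ℕ) (f : PowerSeries ℝ) :
    coeff m (coeff n (inSnd f)) = if m = 0 then coeff n f else 0 := by
  rw [inSnd, coeff_map, coeff_C]

theorem coeff_inFst (n : ℕ) (f : PowerSeries ℝ) :
    coeff n (inFst f) = if n = 0 then f else 0 := coeff_C _ _

/-- Write X and Y for the two variables. The sum of g_(m+n) X^m Y^n over m ≥ 1, n ≥ 0 is X(g(X) -
g(Y))/(X - Y). Applying Y d/dY inserts the factor n, and (X - Y)² clears the denominator. -/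
theorem cutSer_mul (g : PowerSeries ℝ) :
    (inFst X - X) ^ 2 * cutSer g = inFst X * X * (inFst g - inSnd g) -
      inFst X * (inFst X - X) * inSnd (X * d⁄dX ℝ g) := by
  have e1 : (inFst X - X) ^ 2 * cutSer g = inFst X * (inFst X * cutSer g) -
      (inFst X * (X * cutSer g) + inFst X * (X * cutSer g)) + X * (X * cutSer g) := by ring
  have e2 : inFst X * X * (inFst g - inSnd g) -
      inFst X * (inFst X - X) * inSnd (X * d⁄dX ℝ g) = inFst X * (X * inFst g) -
      inFst X * (X * inSnd g) - inFst X * (inFst X * inSnd (X * d⁄dX ℝ g)) +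
      inFst X * (X * inSnd (X * d⁄dX ℝ g)) := by ring
  rw [e1, e2]
  ext n m
  simp only [map_add, map_sub, inFst, coeff_C_mul, coeff_X_mul', apply_ite (coeff (R := ℝ) _),
    map_zero, coeff_inSnd, cutSer, coeff_mk, coeff_cut, coeff_inFst, coeff_derivative]
  rcases n with _ | _ | n
  · rcases m with _ | _ | _ | m <;> simp
  · rcases m with _ | _ | _ | m <;> simp
  · rcases m with _ | _ | _ | m <;> simp <;> ring_nf

end TwoVariables

/-! ### Series as rational functions of u in a field -/

section Evaluation

variable {K : Type*} [Field K] [CharZero K] (ψ : PowerSeries ℝ →+* K)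

theorem map_uPow (n : ℤ) : ψ (uPow n) = ψ (uPow 1) ^ n := by
  have h : ∀ n : ℤ, ψ (uPow n) = ((Units.map (ψ : PowerSeries ℝ →* K) uUnit ^ n : Kˣ) : K) := by
    intro n
    rw [← map_zpow]; rfl
  rw [h n, h 1, Units.val_zpow_eq_zpow_val, zpow_one]

theorem map_uPow_one_ne_zero : ψ (uPow 1) ≠ 0 := by
  have h : ψ (uPow 1) * ψ (uPow (-1)) = 1 := by
    rw [← map_mul, ← uPow_add]; simp [uPow_zero]
  exact left_ne_zero_of_mul_eq_one h

theorem map_C_ratCast (q : ℚ) : ψ (C (q : ℝ)) = q := map_ratCast (ψ.comp (C : ℝ →+* _)) q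

theorem map_sq_add_one_ne_zero (h : Function.Injective ψ) : ψ (uPow 1) ^ 2 + 1 ≠ 0 := by
  have := (map_ne_zero_iff ψ h).2 uPow_one_sq_add_one_ne_zero
  simpa using this

/-- Together with the two lemmas below this rewrites X, r and e_k as rational functions of u, so
that identities between series can be checked by `field_simp` and `ring` in a field of fractions. -/
theorem map_X_eq (h : Function.Injective ψ) : ψ X = (ψ (uPow 1) ^ 2 - 1) / (2 * (ψ (uPow 1) ^ 2 + 1)) := by
  have h0 := map_sq_add_one_ne_zero ψ h
  have h1 := congrArg ψ two_X_mul
  simp only [map_mul, map_add, map_sub, map_pow, map_one, map_ofNat] at h1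
  field_simp
  linear_combination h1

theorem map_rSer_eq (h : Function.Injective ψ) : ψ rSer = 2 * ψ (uPow 1) / (ψ (uPow 1) ^ 2 + 1) := by
  have h0 := map_sq_add_one_ne_zero ψ h
  have h1 := congrArg ψ rSer_mul
  simp only [map_mul, map_add, map_pow, map_one, map_ofNat] at h1
  field_simp
  linear_combination h1

theorem map_eSer_eq (k : ℤ) : ψ (eSer k) =
    ψ (uPow 1) ^ (2 * k) * (ψ (uPow 1) ^ 4 - 1) / (4 * ψ (uPow 1)) := by
  have h0 := map_uPow_one_ne_zero ψ
  have h4 : ψ (C (1 / 4)) = 1 / 4 := by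
    have := map_C_ratCast ψ (1 / 4)
    push_cast at this; exact this
  rw [eSer, map_mul, map_sub, map_uPow ψ (2 * k + 3), map_uPow ψ (2 * k - 1), h4, zpow_add₀ h0, zpow_sub₀ h0]
  have : ψ (uPow 1) ^ (3 : ℤ) = ψ (uPow 1) ^ 3 := by norm_cast
  rw [this, zpow_one]
  field_simp

end Evaluation
end BCMotzkin
end

noncomputable section
open PowerSeries Finset
namespace BCMotzkin

/-! ### The recursion without the trivial splittings -/

section Splitting
variable {ι : Type} [Fintype ι] [DecidableEq ι]

/-- The contribution to `gf g μ` of the splittings of the root of type `p`. -/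
def splitTerm (μ : ι → ℕ) (p : Finset ι × (ℕ × ℕ)) : PowerSeries ℝ :=
  gf p.2.1 (fun i : {i // i ∈ p.1} => μ i) * gf p.2.2 fun i : {i // i ∉ p.1} => μ i

/-- The types of splittings of the root. -/
def splits (ι : Type) [Fintype ι] (g : ℕ) : Finset (Finset ι × (ℕ × ℕ)) :=
  univ ×ˢ antidiagonal g

theorem mem_splits {g : ℕ} {p : Finset ι × (ℕ × ℕ)} : p ∈ splits ι g ↔ p.2.1 + p.2.2 = g := by
  simp [splits]

theorem splitTerm_empty (g : ℕ) (μ : ι → ℕ) : splitTerm μ (∅, (0, g)) = cSer * gf g μ := by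
  have : IsEmpty {i : ι // i ∈ (∅ : Finset ι)} := ⟨fun i => absurd i.2 (notMem_empty _)⟩
  rw [splitTerm, gf_zero_of_isEmpty]
  congr 1
  exact gf_congr (Equiv.subtypeUnivEquiv fun i => notMem_empty i) (fun _ => rfl) g

theorem splitTerm_univ (g : ℕ) (μ : ι → ℕ) : splitTerm μ (univ, (g, 0)) = cSer * gf g μ := by
  have : IsEmpty {i : ι // i ∉ (univ : Finset ι)} := ⟨fun i => i.2 (mem_univ _)⟩
  rw [splitTerm, gf_zero_of_isEmpty, mul_comm]
  congr 1
  exact gf_congr (Equiv.subtypeUnivEquiv fun i => mem_univ i) (fun _ => rfl) g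

/-- The two splittings that cut off a one-vertex sphere contribute 2X² `cSer` times the unknown
itself. On the left they turn the coefficient 1 into r = 1 - 2X² `cSer`. The hypothesis says that
these two splittings are distinct. -/
theorem rSer_mul_gf (g : ℕ) (μ : ι → ℕ) (h : Nonempty ι ∨ g ≠ 0) :
    rSer * gf g μ = C (cat g (cons 0 μ) : ℝ) +
      ∑ j, cut (μ j) (X ^ 2 * gf g fun i : {i // i ≠ j} => μ i) + X ^ 2 * (dbl g μ +
        ∑ p ∈ (splits ι g).filter (fun p => p ≠ (∅, (0, g)) ∧ p ≠ (univ, (g, 0))),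
          splitTerm μ p) := by
  have h1 := gf_eq g μ
  have h2 : ∑ I : Finset ι, ∑ x ∈ antidiagonal g,
      gf x.1 (fun i : {i // i ∈ I} => μ i) * gf x.2 (fun i : {i // i ∉ I} => μ i) =
      ∑ p ∈ splits ι g, splitTerm μ p := (sum_product univ (antidiagonal g) (splitTerm μ)).symm
  have hne : (∅, (0, g)) ≠ ((univ, (g, 0)) : Finset ι × (ℕ × ℕ)) := by
    rintro heq
    simp only [Prod.mk.injEq] at heq
    rcases h with h | h
    · exact univ_nonempty.ne_empty heq.1.symm
    · exact h heq.2.1.symm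
  have h3 : ∑ p ∈ (splits ι g).filter (fun p => ¬ (p ≠ (∅, (0, g)) ∧ p ≠ (univ, (g, 0)))),
      splitTerm μ p = 2 * (cSer * gf g μ) := by
    rw [show (splits ι g).filter (fun p => ¬ (p ≠ (∅, (0, g)) ∧ p ≠ (univ, (g, 0)))) =
      {(∅, (0, g)), (univ, (g, 0))} by
        ext p
        rw [mem_filter, mem_splits, mem_insert, mem_singleton]
        constructor
        · rintro ⟨_, hp⟩; tauto
        · rintro (rfl | rfl) <;> simp, sum_pair hne, splitTerm_empty, splitTerm_univ]
    ring
  rw [h2, ← sum_filter_add_sum_filter_not _ (fun p => p ≠ (∅, (0, g)) ∧ p ≠ (univ, (g, 0))), h3]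
    at h1
  rw [rSer]
  linear_combination h1

end Splitting

/-! ### The two-vertex sphere -/

section TwoVertices

/-- The generating series of the gluings of genus `0` with two vertices, the second one of degree `n`. -/
def wTwo (n : ℕ) : PowerSeries ℝ := gf 0 (fun _ : Unit => n)

/-- With two vertices in genus 0 both splittings are trivial, so only the merging remains. -/
theorem rSer_mul_wTwo (n : ℕ) : rSer * wTwo n = cut n (X ^ 2 * cSer) := by
  have : IsEmpty {i : Unit // i ≠ ()} := ⟨fun i => i.2 rfl⟩
  rw [wTwo, rSer_mul_gf 0 _ (Or.inl ⟨()⟩), cat_cons_zero_of_nonempty, filter_false_of_mem]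
  · simp [dbl, gf_zero_of_isEmpty]
  · rintro ⟨I, a, b⟩ hp
    rw [mem_splits] at hp
    obtain ⟨rfl, rfl⟩ : a = 0 ∧ b = 0 := by simpa using hp
    rcases (Finset.eq_empty_or_nonempty I) with rfl | ⟨⟨⟩, h⟩
    · simp
    · rw [show I = univ from eq_univ_iff_forall.2 fun _ => h]; simp

/-- The generating series of the gluings of genus `0` with two vertices. -/
def wSer : Two := .mk wTwo

theorem fst_ne_snd : inFst X - X ≠ 0 := by
  intro h
  have := congrArg (fun f => coeff 1 (coeff 0 f)) h
  simp at this

theorem inFst_injective : Function.Injective inFst := C_injective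

theorem inSnd_injective : Function.Injective inSnd := PowerSeries.map_injective _ C_injective

/-- The sum of the `(2 q + 1) * eCoeff q n * eSer p` over `p + q = a - 1`, with `p` and `q` of the
sign of `a`. -/
def eeSum (n : ℕ) (a : ℤ) : PowerSeries ℝ :=
  ∑ q ∈ Ico 0 a, C ((2 * q + 1) * eCoeff q n) * eSer (a - 1 - q) +
    ∑ q ∈ Ico a 0, C (-(2 * q + 1) * eCoeff q n) * eSer (a - 1 - q)

instance : CharZero (PowerSeries ℝ) := algebraRat.charZero _

instance : CharZero (FractionRing Two) :=
  have : CharZero Two := algebraRat.charZero Two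
  charZero_of_injective_algebraMap (IsFractionRing.injective Two (FractionRing Two))

/-- Evaluation of a series in the first variable in the field of fractions. -/
abbrev evFst : PowerSeries ℝ →+* FractionRing Two := (algebraMap Two (FractionRing Two)).comp inFst

/-- Evaluation of a series in the second variable in the field of fractions. -/
abbrev evSnd : PowerSeries ℝ →+* FractionRing Two := (algebraMap Two (FractionRing Two)).comp inSnd

theorem evFst_injective : Function.Injective evFst :=
  (IsFractionRing.injective Two (FractionRing Two)).comp inFst_injective

theorem evSnd_injective : Function.Injective evSnd :=
  (IsFractionRing.injective Two (FractionRing Two)).comp inSnd_injective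

theorem inSnd_X : inSnd X = X := PowerSeries.map_X _

theorem evFst_sq_sub_evSnd_sq_ne_zero : evFst (uPow 1) ^ 2 - evSnd (uPow 1) ^ 2 ≠ 0 := by
  have h1 := map_X_eq evFst evFst_injective
  have h2 := map_X_eq evSnd evSnd_injective
  have h3 : evFst X - evSnd X ≠ 0 := by
    have := (map_ne_zero_iff _ (IsFractionRing.injective Two (FractionRing Two))).2 fst_ne_snd
    rwa [map_sub, ← inSnd_X] at this
  intro h
  refine h3 ?_
  rw [h1, h2, sub_eq_zero.1 h, sub_self]

theorem evFst_add_evSnd_ne_zero : evFst (uPow 1) + evSnd (uPow 1) ≠ 0 := by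
  intro h
  refine evFst_sq_sub_evSnd_sq_ne_zero ?_
  linear_combination (evFst (uPow 1) - evSnd (uPow 1)) * h

theorem rSer_mul_derivative : rSer * d⁄dX ℝ rSer = -(4 * X) := by
  have h := congrArg (d⁄dX ℝ) rSer_sq
  rw [show (1 : PowerSeries ℝ) - 4 * X ^ 2 = 1 - (X * X + X * X + X * X + X * X) by ring, sq] at h
  simp only [map_add, map_sub, Derivation.leibniz, Derivation.map_one_eq_zero, derivative_X,
    smul_eq_mul] at h
  refine mul_left_cancel₀ (two_ne_zero : (2 : PowerSeries ℝ) ≠ 0) ?_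
  linear_combination h

theorem two_mul_X_sq_mul_cSer : 2 * (X ^ 2 * cSer) = 1 - rSer := by rw [rSer]; ring

theorem rSer_mul_X_mul_derivative : rSer * (X * d⁄dX ℝ (X ^ 2 * cSer)) = 2 * X ^ 2 := by
  have h := congrArg (d⁄dX ℝ) two_mul_X_sq_mul_cSer
  rw [two_mul, map_add, map_sub, Derivation.map_one_eq_zero] at h
  refine mul_left_cancel₀ (two_ne_zero : (2 : PowerSeries ℝ) ≠ 0) ?_
  linear_combination rSer * X * h - X * rSer_mul_derivative

theorem algebraMap_cutSer (f : PowerSeries ℝ) :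
    (evFst X - evSnd X) ^ 2 * algebraMap Two (FractionRing Two) (cutSer f) =
      evFst X * evSnd X * (evFst f - evSnd f) -
        evFst X * (evFst X - evSnd X) * evSnd (X * d⁄dX ℝ f) := by
  have h := congrArg (algebraMap Two (FractionRing Two)) (cutSer_mul f)
  rw [← inSnd_X] at h
  simpa using h

theorem sq_sub_div (u v : FractionRing Two) (hu : u ^ 2 + 1 ≠ 0) (hv : v ^ 2 + 1 ≠ 0) :
    (u ^ 2 - 1) / (2 * (u ^ 2 + 1)) - (v ^ 2 - 1) / (2 * (v ^ 2 + 1)) =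
      (u ^ 2 - v ^ 2) / ((u ^ 2 + 1) * (v ^ 2 + 1)) := by
  field_simp
  ring

/-- Substitution of X² `cSer` = (1 - r)/2 in `cutSer_mul`. With u and v the coordinates of the two
variables, the factors (u - v)² from the denominator cancel and only (u + v)² remains. -/
theorem algebraMap_wSer : algebraMap Two (FractionRing Two) wSer =
    (evFst (uPow 1) ^ 4 - 1) * (evSnd (uPow 1) ^ 4 - 1) /
      (16 * evFst (uPow 1) * evSnd (uPow 1) * (evFst (uPow 1) + evSnd (uPow 1)) ^ 2) := by
  have e : inFst rSer * wSer = cutSer (X ^ 2 * cSer) := by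
    ext n : 1
    rw [inFst, coeff_C_mul, wSer, coeff_mk, rSer_mul_wTwo, cutSer, coeff_mk]
  have h := algebraMap_cutSer (X ^ 2 * cSer)
  rw [← e, map_mul] at h
  have c1 : 2 * evFst (X ^ 2 * cSer) = 1 - evFst rSer := by
    have := congrArg evFst two_mul_X_sq_mul_cSer
    rwa [map_mul, map_ofNat, map_sub, map_one] at this
  have c2 : 2 * evSnd (X ^ 2 * cSer) = 1 - evSnd rSer := by
    have := congrArg evSnd two_mul_X_sq_mul_cSer
    rwa [map_mul, map_ofNat, map_sub, map_one] at this
  have d2 : evSnd rSer * evSnd (X * d⁄dX ℝ (X ^ 2 * cSer)) = 2 * evSnd X ^ 2 := by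
    have := congrArg evSnd rSer_mul_X_mul_derivative
    rwa [map_mul, map_mul evSnd 2, map_ofNat, map_pow] at this
  have e1 : algebraMap Two (FractionRing Two) (inFst rSer) = evFst rSer := rfl
  rw [e1] at h
  have hX1 := map_X_eq evFst evFst_injective
  have hX2 := map_X_eq evSnd evSnd_injective
  have hr1 := map_rSer_eq evFst evFst_injective
  have hr2 := map_rSer_eq evSnd evSnd_injective
  have n1 := map_uPow_one_ne_zero evFst
  have n2 := map_uPow_one_ne_zero evSnd
  have p1 := map_sq_add_one_ne_zero evFst evFst_injective
  have p2 := map_sq_add_one_ne_zero evSnd evSnd_injective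
  have q := evFst_add_evSnd_ne_zero
  have q' : evFst (uPow 1) - evSnd (uPow 1) ≠ 0 := by
    intro h0
    refine evFst_sq_sub_evSnd_sq_ne_zero ?_
    linear_combination (evFst (uPow 1) + evSnd (uPow 1)) * h0
  generalize evFst (X ^ 2 * cSer) = f1 at *
  generalize evSnd (X ^ 2 * cSer) = f2 at *
  generalize evSnd (X * d⁄dX ℝ (X ^ 2 * cSer)) = f3 at *
  generalize algebraMap Two (FractionRing Two) wSer = W at *
  rw [hX1, hX2, hr1, sq_sub_div _ _ p1 p2] at h
  rw [hr1] at c1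
  rw [hr2] at c2 d2
  rw [hX2] at d2
  generalize evFst (uPow 1) = u at *
  generalize evSnd (uPow 1) = v at *
  have c1' : f1 = (u - 1) ^ 2 / (2 * (u ^ 2 + 1)) := by
    field_simp at c1 ⊢
    linear_combination c1
  have c2' : f2 = (v - 1) ^ 2 / (2 * (v ^ 2 + 1)) := by
    field_simp at c2 ⊢
    linear_combination c2
  have d2' : f3 = (v ^ 2 - 1) ^ 2 / (4 * v * (v ^ 2 + 1)) := by
    field_simp at d2 ⊢
    linear_combination d2
  rw [c1', c2', d2'] at h
  have hk : ((u ^ 2 - v ^ 2) / ((u ^ 2 + 1) * (v ^ 2 + 1))) ^ 2 * (2 * u / (u ^ 2 + 1)) ≠ 0 := by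
    have : u ^ 2 - v ^ 2 ≠ 0 := by rw [sq_sub_sq]; exact mul_ne_zero q q'
    exact mul_ne_zero (pow_ne_zero _ (div_ne_zero this (mul_ne_zero p1 p2)))
      (div_ne_zero (mul_ne_zero two_ne_zero n1) p1)
  refine mul_left_cancel₀ hk ?_
  rw [mul_assoc, h]
  rw [sq_sub_sq]
  field_simp
  ring

end TwoVertices
end BCMotzkin
end

noncomputable section
open PowerSeries Finset
namespace BCMotzkin

/-! ### Merging a vertex with the root, on the basic series -/

section CutTerm

/-- The difference of the two sums is the oriented sum from 0 to a; this is its recursion, valid for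
either sign of a. -/
theorem sum_Ico_zero_add_one {M : Type*} [AddCommGroup M] (f : ℤ → M) (a : ℤ) :
    ∑ q ∈ Ico 0 (a + 1), f q - ∑ q ∈ Ico (a + 1) 0, f q =
      ∑ q ∈ Ico 0 a, f q - ∑ q ∈ Ico a 0, f q + f a := by
  rcases le_or_gt 0 a with h | h
  · rw [Ico_eq_empty_of_le h, Ico_eq_empty_of_le (show (0 : ℤ) ≤ a + 1 by omega),
      show Ico 0 (a + 1) = insert a (Ico 0 a) by ext; simp; omega, sum_insert (by simp)]
    simp [add_comm]
  · rw [Ico_eq_empty_of_le h.le, Ico_eq_empty_of_le (show a + 1 ≤ 0 by omega),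
      show Ico a 0 = insert a (Ico (a + 1) 0) by ext; simp; omega, sum_insert (by simp)]
    simp

/-- Closed form of an arithmetic-geometric sum, to be used at s = u², t = v². Dividing by s^a first
makes the summand independent of a, so that induction on a in both directions applies. -/
theorem sum_Ico_two_mul_add_one {K : Type*} [Field K] {s t : K} (hs : s ≠ 0) (ht : t ≠ 0) (a : ℤ) :
    (s - t) ^ 2 * (∑ q ∈ Ico 0 a, ((2 * q + 1 : ℤ) : K) * t ^ q * s ^ (a - 1 - q) -
      ∑ q ∈ Ico a 0, ((2 * q + 1 : ℤ) : K) * t ^ q * s ^ (a - 1 - q)) =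
      (s + t) * (s ^ a - t ^ a) - 2 * a * t ^ a * (s - t) := by
  have key : ∀ a : ℤ, (s - t) ^ 2 * (∑ q ∈ Ico 0 a, ((2 * q + 1 : ℤ) : K) * t ^ q * s ^ (-1 - q) -
      ∑ q ∈ Ico a 0, ((2 * q + 1 : ℤ) : K) * t ^ q * s ^ (-1 - q)) =
      ((s + t) * (s ^ a - t ^ a) - 2 * a * t ^ a * (s - t)) * s ^ (-a) := by
    intro a
    have hstep : ∀ a : ℤ, ((s + t) * (s ^ (a + 1) - t ^ (a + 1)) -
        2 * ((a + 1 : ℤ) : K) * t ^ (a + 1) * (s - t)) * s ^ (-(a + 1)) =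
        ((s + t) * (s ^ a - t ^ a) - 2 * a * t ^ a * (s - t)) * s ^ (-a) +
          (s - t) ^ 2 * (((2 * a + 1 : ℤ) : K) * t ^ a * s ^ (-1 - a)) := by
      intro a
      rw [zpow_add₀ hs, zpow_add₀ ht, show -(a + 1) = -1 + -a by ring, show -1 - a = -1 + -a by ring,
        zpow_add₀ hs]
      simp only [zpow_one, zpow_neg]
      push_cast
      field_simp
      ring
    induction a using Int.induction_on with
    | zero => simp
    | succ n ih => rw [sum_Ico_zero_add_one, mul_add, ih, hstep]
    | pred n ih =>
      have h1 := hstep (-(n : ℤ) - 1)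
      have h2 := sum_Ico_zero_add_one (fun q : ℤ => ((2 * q + 1 : ℤ) : K) * t ^ q * s ^ (-1 - q))
        (-(n : ℤ) - 1)
      rw [sub_add_cancel] at h1 h2
      rw [h2] at ih
      linear_combination ih + h1
  have hf : ∀ q : ℤ, ((2 * q + 1 : ℤ) : K) * t ^ q * s ^ (a - 1 - q) =
      s ^ a * (((2 * q + 1 : ℤ) : K) * t ^ q * s ^ (-1 - q)) := by
    intro q
    rw [show a - 1 - q = a + (-1 - q) by ring, zpow_add₀ hs]
    ring
  simp only [hf, ← mul_sum, ← mul_sub]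
  have hsa : s ^ a * s ^ (-a) = 1 := by rw [← zpow_add₀ hs]; simp
  linear_combination s ^ a * key a + ((s + t) * (s ^ a - t ^ a) - 2 * a * t ^ a * (s - t)) * hsa

/-- The generating series of `fun n => eeSum n a`. -/
def eeSer (a : ℤ) : Two := .mk fun n => eeSum n a

theorem coeff_inFst_mul_inSnd (f h : PowerSeries ℝ) (n : ℕ) :
    coeff n (inFst f * inSnd h) = C (coeff n h) * f := by
  rw [inFst, coeff_C_mul, inSnd, coeff_map, mul_comm]

theorem eeSer_eq (a : ℤ) : eeSer a =
    ∑ q ∈ Ico 0 a, ((2 * q + 1 : ℤ) : Two) * (inFst (eSer (a - 1 - q)) * inSnd (eSer q)) -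
    ∑ q ∈ Ico a 0, ((2 * q + 1 : ℤ) : Two) * (inFst (eSer (a - 1 - q)) * inSnd (eSer q)) := by
  have h : ∀ (z : ℤ) (F : Two) (n : ℕ), coeff n ((z : Two) * F) = C (z : ℝ) * coeff n F := by
    intro z F n
    rw [← map_intCast (C : PowerSeries ℝ →+* Two), coeff_C_mul, map_intCast]
  ext n : 1
  rw [eeSer, coeff_mk, map_sub, map_sum, map_sum, sub_eq_add_neg, ← sum_neg_distrib, eeSum]
  congr 1 <;> refine sum_congr rfl fun q _ => ?_
  · rw [h, coeff_inFst_mul_inSnd, ← mul_assoc, ← map_mul, eCoeff]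
    push_cast
    rfl
  · rw [h, coeff_inFst_mul_inSnd, ← mul_assoc, ← map_mul, eCoeff, ← neg_mul, ← map_neg, neg_mul]
    push_cast
    rfl

theorem algebraMap_eeSer (a : ℤ) :
    (evFst (uPow 1) ^ 2 - evSnd (uPow 1) ^ 2) ^ 2 * algebraMap Two (FractionRing Two) (eeSer a) =
      (evFst (uPow 1) ^ 4 - 1) / (4 * evFst (uPow 1)) * ((evSnd (uPow 1) ^ 4 - 1) /
      (4 * evSnd (uPow 1))) * ((evFst (uPow 1) ^ 2 + evSnd (uPow 1) ^ 2) *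
        (evFst (uPow 1) ^ (2 * a) - evSnd (uPow 1) ^ (2 * a)) -
        2 * a * evSnd (uPow 1) ^ (2 * a) * (evFst (uPow 1) ^ 2 - evSnd (uPow 1) ^ 2)) := by
  have h1 : ∀ k, algebraMap Two (FractionRing Two) (inFst (eSer k)) = _ := map_eSer_eq evFst
  have h2 : ∀ k, algebraMap Two (FractionRing Two) (inSnd (eSer k)) = _ := map_eSer_eq evSnd
  have n1 := map_uPow_one_ne_zero evFst
  have n2 := map_uPow_one_ne_zero evSnd
  have hc := sum_Ico_two_mul_add_one (pow_ne_zero 2 n1) (pow_ne_zero 2 n2) a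
  rw [eeSer_eq, map_sub, map_sum, map_sum]
  simp only [map_mul, map_intCast, h1, h2]
  generalize evFst (uPow 1) = u at *
  generalize evSnd (uPow 1) = v at *
  have z1 : ∀ (w : FractionRing Two) (k : ℤ), w ^ (2 * k) = (w ^ 2) ^ k := by
    intro w k
    rw [zpow_mul]; norm_cast
  have hf : ∀ q : ℤ, ((2 * q + 1 : ℤ) : FractionRing Two) *
      (u ^ (2 * (a - 1 - q)) * (u ^ 4 - 1) / (4 * u) * (v ^ (2 * q) * (v ^ 4 - 1) / (4 * v))) =
      (u ^ 4 - 1) / (4 * u) * ((v ^ 4 - 1) / (4 * v)) *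
      (((2 * q + 1 : ℤ) : FractionRing Two) * (v ^ 2) ^ q * (u ^ 2) ^ (a - 1 - q)) := by
    intro q
    rw [z1, z1]
    ring
  simp only [hf, ← mul_sum, ← mul_sub]
  rw [z1, z1, ← hc]
  ring

theorem four_mul_X_mul_derivative_eSer (k : ℤ) : 4 * (X * d⁄dX ℝ (eSer k)) =
    C (1 / 4) * (((2 * k + 3 : ℤ) : PowerSeries ℝ) * (uPow (2 * k + 5) - uPow (2 * k + 1)) -
      ((2 * k - 1 : ℤ) : PowerSeries ℝ) * (uPow (2 * k + 1) - uPow (2 * k - 3))) := by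
  have h1 := X_mul_derivative_uPow (2 * k + 3)
  have h2 := X_mul_derivative_uPow (2 * k - 1)
  rw [show 2 * k + 3 + 2 = 2 * k + 5 by ring, show 2 * k + 3 - 2 = 2 * k + 1 by ring] at h1
  rw [show 2 * k - 1 + 2 = 2 * k + 1 by ring, show 2 * k - 1 - 2 = 2 * k - 3 by ring] at h2
  rw [eSer, Derivation.leibniz, derivative_C, map_sub]
  simp only [smul_eq_mul]
  linear_combination C (1 / 4) * (h1 - h2)

theorem map_four_mul_X_mul_derivative {K : Type*} [Field K] [CharZero K] (ψ : PowerSeries ℝ →+* K)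
    (k : ℤ) : ψ (X * d⁄dX ℝ (X ^ 2 * eSer k)) = ψ X ^ 2 * ψ (uPow 1) ^ (2 * k) *
      ((ψ (uPow 1) ^ 4 - 1) / (2 * ψ (uPow 1)) +
      ((2 * k + 3) * (ψ (uPow 1) ^ 8 - ψ (uPow 1) ^ 4) -
        (2 * k - 1) * (ψ (uPow 1) ^ 4 - 1)) / (16 * ψ (uPow 1) ^ 3)) := by
  have h := congrArg ψ (four_mul_X_mul_derivative_eSer k)
  have e : X * d⁄dX ℝ (X ^ 2 * eSer k) = 2 * (X ^ 2 * eSer k) + X ^ 2 * (X * d⁄dX ℝ (eSer k)) := by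
    rw [sq, Derivation.leibniz, Derivation.leibniz, derivative_X]
    simp only [smul_eq_mul]
    ring
  have h4 : ψ (C (1 / 4)) = 1 / 4 := by
    have := map_C_ratCast ψ (1 / 4)
    push_cast at this; exact this
  have h0 := map_uPow_one_ne_zero ψ
  have hp : ∀ (n : ℕ), ψ (uPow (2 * k + n)) = ψ (uPow 1) ^ (2 * k) * ψ (uPow 1) ^ n := by
    intro n
    rw [map_uPow, zpow_add₀ h0, zpow_natCast]
  have hm : ψ (uPow (2 * k - 3)) = ψ (uPow 1) ^ (2 * k) / ψ (uPow 1) ^ 3 := by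
    rw [map_uPow, zpow_sub₀ h0]; norm_cast
  have h5 := hp 5
  have h1 := hp 1
  rw [map_mul ψ 4, map_ofNat, map_mul ψ (C _), map_sub, map_mul ψ (Int.cast _),
    map_mul ψ (Int.cast _), map_intCast, map_intCast, map_sub, map_sub, h4] at h
  push_cast at h5 h1 h
  rw [h5, h1, hm] at h
  rw [e, map_add, map_mul, map_mul ψ (X ^ 2), map_mul ψ (X ^ 2), map_eSer_eq, map_pow, map_ofNat]
  rw [(eq_div_iff (by norm_num : (4 : K) ≠ 0)).2 ((mul_comm _ _).trans h)]
  field_simp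
  ring

/-- Each of the two terms on the left has a pole along u + v = 0, so neither is a finite combination
of products of basic series. The poles cancel in the sum. After division by r the rest is a Laurent
polynomial in u and v, and it is matched with the third difference through the closed form of
`eeSer`. -/
theorem cutSer_add (k : ℤ) :
    cutSer (X ^ 2 * eSer k) + 2 * (inFst (X ^ 2 * eSer k) * wSer) =
      inFst (rSer * C (1 / 16)) *
        (eeSer (k + 2) - 3 * eeSer (k + 1) + 3 * eeSer k - eeSer (k - 1)) := by
  refine IsFractionRing.injective Two (FractionRing Two) ?_
  have hcut := algebraMap_cutSer (X ^ 2 * eSer k)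
  have hw := algebraMap_wSer
  have hS := algebraMap_eeSer
  have hE : ∀ f, algebraMap Two (FractionRing Two) (inFst f) = evFst f := fun _ => rfl
  have h16 : evFst (C (1 / 16)) = 1 / 16 := by
    have := map_C_ratCast evFst (1 / 16)
    push_cast at this; exact this
  have hm := map_mul (algebraMap Two (FractionRing Two))
  rw [map_add, hm, hm, hm, map_sub, map_add, map_sub, hm, hm, map_ofNat, map_ofNat, hE, hE]
  rw [map_four_mul_X_mul_derivative, map_mul, map_mul evSnd, map_pow, map_pow evSnd, map_eSer_eq,
    map_eSer_eq] at hcut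
  rw [map_mul, map_pow, map_eSer_eq, map_mul, h16]
  have hX1 := map_X_eq evFst evFst_injective
  have hX2 := map_X_eq evSnd evSnd_injective
  have hr1 := map_rSer_eq evFst evFst_injective
  have n1 := map_uPow_one_ne_zero evFst
  have n2 := map_uPow_one_ne_zero evSnd
  have p1 := map_sq_add_one_ne_zero evFst evFst_injective
  have p2 := map_sq_add_one_ne_zero evSnd evSnd_injective
  have q := evFst_add_evSnd_ne_zero
  have q2 := evFst_sq_sub_evSnd_sq_ne_zero
  rw [hX1, hX2, sq_sub_div _ _ p1 p2] at hcut
  rw [hX1, hr1, hw]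
  generalize evFst (uPow 1) = u at *
  generalize evSnd (uPow 1) = v at *
  have hz : ∀ (w : FractionRing Two), w ≠ 0 → w ^ (2 * (k + 2)) = w ^ (2 * k) * w ^ 4 ∧
      w ^ (2 * (k + 1)) = w ^ (2 * k) * w ^ 2 ∧ w ^ (2 * (k - 1)) = w ^ (2 * k) / w ^ 2 := by
    intro w hw
    refine ⟨?_, ?_, ?_⟩
    · rw [mul_add, zpow_add₀ hw]; norm_cast
    · rw [mul_add, zpow_add₀ hw]; norm_cast
    · rw [mul_sub, zpow_sub₀ hw]; norm_cast
  have s2 := hS (k + 2)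
  have s1 := hS (k + 1)
  have s0 := hS k
  have s3 := hS (k - 1)
  rw [(hz u n1).1, (hz v n2).1] at s2
  rw [(hz u n1).2.1, (hz v n2).2.1] at s1
  rw [(hz u n1).2.2, (hz v n2).2.2] at s3
  push_cast at s2 s1 s3
  generalize algebraMap Two (FractionRing Two) (cutSer (X ^ 2 * eSer k)) = J at *
  generalize algebraMap Two (FractionRing Two) (eeSer (k + 2)) = S2 at *
  generalize algebraMap Two (FractionRing Two) (eeSer (k + 1)) = S1 at *
  generalize algebraMap Two (FractionRing Two) (eeSer k) = S0 at *
  generalize algebraMap Two (FractionRing Two) (eeSer (k - 1)) = S3 at *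
  generalize u ^ (2 * k) = a at *
  generalize v ^ (2 * k) = b at *
  generalize (k : FractionRing Two) = κ at *
  -- In the coordinates u and v, X - Y = (u² - v²)/((u² + 1)(v² + 1)); multiplying by (u² - v²)²
  -- clears the denominators of the divided difference and of `eeSer` at once.
  have hJ : (u ^ 2 - v ^ 2) ^ 2 * J = ((u ^ 2 + 1) * (v ^ 2 + 1)) ^ 2 *
      (((u ^ 2 - v ^ 2) / ((u ^ 2 + 1) * (v ^ 2 + 1))) ^ 2 * J) := by field_simp
  rw [hcut] at hJ
  refine mul_left_cancel₀ (pow_ne_zero 2 q2) ?_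
  have hL : ∀ W R S, (u ^ 2 - v ^ 2) ^ 2 * (J + W) = (u ^ 2 - v ^ 2) ^ 2 * (R * S) ↔
      (u ^ 2 - v ^ 2) ^ 2 * J + (u ^ 2 - v ^ 2) ^ 2 * W = R * ((u ^ 2 - v ^ 2) ^ 2 * S) := by
    intro W R S
    rw [mul_add, mul_left_comm]
  rw [hL, hJ, show (u ^ 2 - v ^ 2) ^ 2 * (S2 - 3 * S1 + 3 * S0 - S3) = (u ^ 2 - v ^ 2) ^ 2 * S2 -
    3 * ((u ^ 2 - v ^ 2) ^ 2 * S1) + 3 * ((u ^ 2 - v ^ 2) ^ 2 * S0) - (u ^ 2 - v ^ 2) ^ 2 * S3 by ring,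
    s2, s1, s0, s3]
  have hq : (u ^ 2 - v ^ 2) ^ 2 = (u + v) ^ 2 * (u - v) ^ 2 := by ring
  rw [hq]
  field_simp
  ring

/-- The terms of the recursion that involve a merged vertex, on the basic series. -/
theorem cut_add (n : ℕ) (k : ℤ) :
    cut n (X ^ 2 * eSer k) + 2 * (X ^ 2 * (wTwo n * eSer k)) =
      rSer * (C (1 / 16) *
        (eeSum n (k + 2) - 3 * eeSum n (k + 1) + 3 * eeSum n k - eeSum n (k - 1))) := by
  have h := congrArg (coeff n) (cutSer_add k)
  have h3 : (3 : Two) = C (3 : PowerSeries ℝ) := (map_ofNat _ 3).symm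
  have h2 : (2 : Two) = C (2 : PowerSeries ℝ) := (map_ofNat _ 2).symm
  rw [h2, h3] at h
  simp only [inFst, map_add, map_sub, coeff_C_mul, cutSer, wSer, eeSer, coeff_mk] at h
  linear_combination h

end CutTerm
end BCMotzkin
end

noncomputable section
open PowerSeries Finset
namespace BCMotzkin

/-! ### The initial case of genus 1 with one vertex -/

section Torus

/-- The restriction of a series in two variables to the diagonal. -/
def diag (F : Two) : PowerSeries ℝ := .mk fun N => ∑ x ∈ antidiagonal N, coeff x.1 (coeff x.2 F)

theorem coeff_diag (F : Two) (N : ℕ) :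
    coeff N (diag F) = ∑ x ∈ antidiagonal N, coeff x.1 (coeff x.2 F) := coeff_mk _ _

theorem diag_inFst_mul (f : PowerSeries ℝ) (F : Two) : diag (inFst f * F) = f * diag F := by
  ext N
  rw [coeff_diag, coeff_mul]
  simp only [inFst, coeff_C_mul]
  simp only [coeff_mul, coeff_diag, mul_sum]
  rw [sum_sigma', sum_sigma']
  refine sum_nbij' (fun x => ⟨(x.2.1, x.2.2 + x.1.2), (x.2.2, x.1.2)⟩)
    (fun x => ⟨(x.1.1 + x.2.1, x.2.2), (x.1.1, x.2.1)⟩) ?_ ?_ ?_ ?_ ?_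
  · rintro ⟨⟨a, b⟩, ⟨c, d⟩⟩ h
    simp only [mem_sigma, HasAntidiagonal.mem_antidiagonal] at h ⊢
    obtain ⟨rfl, rfl⟩ := h
    exact ⟨by ring, trivial⟩
  · rintro ⟨⟨a, b⟩, ⟨c, d⟩⟩ h
    simp only [mem_sigma, HasAntidiagonal.mem_antidiagonal] at h ⊢
    obtain ⟨rfl, rfl⟩ := h
    exact ⟨by ring, trivial⟩
  · rintro ⟨⟨a, b⟩, ⟨c, d⟩⟩ h
    simp only [mem_sigma, HasAntidiagonal.mem_antidiagonal] at h ⊢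
    obtain ⟨rfl, rfl⟩ := h
    rfl
  · rintro ⟨⟨a, b⟩, ⟨c, d⟩⟩ h
    simp only [mem_sigma, HasAntidiagonal.mem_antidiagonal] at h ⊢
    obtain ⟨rfl, rfl⟩ := h
    rfl
  · rintro ⟨⟨a, b⟩, ⟨c, d⟩⟩ h
    rfl

/-- On the diagonal the coefficient f_N is met once for each n < N, with factor n, hence in total
N(N - 1)/2 times. -/
theorem two_mul_diag_cutSer (f : PowerSeries ℝ) :
    2 * diag (cutSer f) = X ^ 2 * d⁄dX ℝ (d⁄dX ℝ f) := by
  ext N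
  rw [two_mul, map_add, coeff_diag, coeff_X_pow_mul']
  have h : ∑ x ∈ antidiagonal N, coeff x.1 (coeff x.2 (cutSer f)) =
      (∑ k ∈ range N, (k : ℝ)) * coeff N f := by
    rw [← Nat.sum_antidiagonal_swap, Nat.sum_antidiagonal_eq_sum_range_succ_mk, sum_range_succ,
      sum_mul]
    simp only [Prod.swap_prod_mk, cutSer, coeff_mk, coeff_cut]
    rw [if_pos (Nat.sub_self N), add_zero]
    refine sum_congr rfl fun k hk => ?_
    rw [mem_range] at hk
    rw [if_neg (by omega), Nat.sub_add_cancel hk.le]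
  have h2 : (∑ k ∈ range N, (k : ℝ)) * 2 = N * (N - 1) := by
    induction N with
    | zero => simp
    | succ N ih =>
      have : (∑ k ∈ range N, (k : ℝ)) * 2 = N * (N - 1) := by
        clear ih h
        induction N with
        | zero => simp
        | succ N ih => rw [sum_range_succ, add_mul, ih]; push_cast; ring
      rw [sum_range_succ, add_mul, this]; push_cast; ring
  rw [h, ← two_mul, ← mul_assoc, mul_comm 2, h2]
  rcases N with _ | _ | N
  · simp
  · simp
  · rw [if_pos (by omega), coeff_derivative, coeff_derivative,
      show N + 1 + 1 - 2 + 1 + 1 = N + 1 + 1 by omega, show N + 1 + 1 - 2 = N by omega]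
    push_cast
    ring

theorem pow_mul_pow_of_ne_zero {K : Type*} [Field K] [CharZero K] (u : K) (n1 : u ≠ 0)
    (p1 : u ^ 2 + 1 ≠ 0) : (2 * u / (u ^ 2 + 1)) ^ 5 *
      (1 / 128 * (u ^ 2 * (u ^ 4 - 1) / (4 * u) - 3 * ((u ^ 4 - 1) / (4 * u)) +
        3 * ((u ^ 2)⁻¹ * (u ^ 4 - 1) / (4 * u)) - (u ^ 4)⁻¹ * (u ^ 4 - 1) / (4 * u))) =
      ((u ^ 2 - 1) / (2 * (u ^ 2 + 1))) ^ 4 := by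
  field_simp
  ring

instance : CharZero (FractionRing (PowerSeries ℝ)) :=
  charZero_of_injective_algebraMap (IsFractionRing.injective (PowerSeries ℝ) _)

/-- Expresses X⁴/r⁵, the one-vertex series of genus 1, in the basic series. Again the factor (u² -
1)³ is behind the third difference. -/
theorem rSer_pow_mul_eSer : rSer ^ 5 *
    (C (1 / 128) * (eSer 1 - 3 * eSer 0 + 3 * eSer (-1) - eSer (-2))) = X ^ 4 := by
  let ψ : PowerSeries ℝ →+* FractionRing (PowerSeries ℝ) := algebraMap _ _
  have hψ : Function.Injective ψ := IsFractionRing.injective (PowerSeries ℝ) _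
  refine hψ ?_
  have h128 : ψ (C (1 / 128)) = 1 / 128 := by
    have := map_C_ratCast ψ (1 / 128)
    push_cast at this; exact this
  have h := pow_mul_pow_of_ne_zero _ (map_uPow_one_ne_zero ψ) (map_sq_add_one_ne_zero ψ hψ)
  rw [map_mul, map_pow, map_pow, map_rSer_eq ψ hψ, map_X_eq ψ hψ, map_mul, map_sub, map_add,
    map_sub, map_mul ψ 3, map_mul ψ 3, map_ofNat, h128, map_eSer_eq, map_eSer_eq, map_eSer_eq,
    map_eSer_eq, ← h]
  norm_num

/-- For a single vertex of genus 1 only the connected splitting is left, and it gives the two-vertex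
sphere restricted to the diagonal. -/
theorem gf_one_of_isEmpty {ι : Type} [Fintype ι] [DecidableEq ι] [IsEmpty ι] (μ : ι → ℕ) :
    gf 1 μ = C (1 / 128) * (eSer 1 - 3 * eSer 0 + 3 * eSer (-1) - eSer (-2)) := by
  have h := rSer_mul_gf 1 μ (Or.inr one_ne_zero)
  have hf : (splits ι 1).filter (fun p => p ≠ (∅, (0, 1)) ∧ p ≠ (univ, (1, 0))) = ∅ := by
    refine filter_false_of_mem ?_
    rintro ⟨I, a, b⟩ hp
    rw [mem_splits] at hp
    have hI : I = ∅ := Subsingleton.elim _ _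
    have hI' : (univ : Finset ι) = ∅ := Subsingleton.elim _ _
    rw [hI, hI']
    have : a = 0 ∧ b = 1 ∨ a = 1 ∧ b = 0 := by simp at hp; omega
    rcases this with ⟨rfl, rfl⟩ | ⟨rfl, rfl⟩ <;> simp
  have hd : dbl 1 μ = diag wSer := by
    ext N
    rw [dbl, if_pos le_rfl, coeff_mk, coeff_diag]
    refine sum_congr rfl fun x _ => ?_
    rw [wSer, coeff_mk, wTwo, coeff_gf, Nat.sub_self]
    congr 1
    refine cat_congr (Equiv.optionCongr (Equiv.ofUnique _ _)) ?_ 0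
    rintro (_ | _ | i)
    · rfl
    · rfl
    · exact isEmptyElim i
  have e : inFst rSer * wSer = cutSer (X ^ 2 * cSer) := by
    ext n : 1
    rw [inFst, coeff_C_mul, wSer, coeff_mk, rSer_mul_wTwo, cutSer, coeff_mk]
  have h2 := two_mul_diag_cutSer (X ^ 2 * cSer)
  rw [← e, diag_inFst_mul] at h2
  rw [hf, cat_cons_zero_of_isEmpty, hd] at h
  simp only [univ_eq_empty, sum_empty, add_zero, if_neg one_ne_zero, Nat.cast_zero, map_zero,
    zero_add] at h
  have h3' := two_mul_X_sq_mul_cSer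
  clear e
  generalize X ^ 2 * cSer = f at *
  have h3 := congrArg (fun f => d⁄dX ℝ (d⁄dX ℝ f)) h3'
  have h4 := rSer_mul_derivative
  have h5 := congrArg (d⁄dX ℝ) h4
  have h6 := rSer_sq
  rw [show -(4 * X : PowerSeries ℝ) = -(X + X + X + X) by ring] at h5
  simp only [two_mul, map_add, map_neg, map_sub, Derivation.leibniz, Derivation.map_one_eq_zero,
    derivative_X, smul_eq_mul, zero_sub] at h3 h5
  generalize d⁄dX ℝ (d⁄dX ℝ f) = g2 at *
  generalize d⁄dX ℝ (d⁄dX ℝ rSer) = r2 at *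
  generalize d⁄dX ℝ rSer = r1 at *
  -- Derived from r · r' = -4X, its derivative, and r² = 1 - 4X². The factor 4 clears the two
  -- halves, from X² `cSer` = (1 - r)/2 and from the diagonal.
  have h7 : rSer ^ 5 * gf 1 μ = X ^ 4 := by
    refine mul_left_cancel₀ (by norm_num : (4 : PowerSeries ℝ) ≠ 0) ?_
    linear_combination 4 * rSer ^ 4 * h + 2 * rSer ^ 3 * X ^ 2 * h2 + rSer ^ 3 * X ^ 4 * h3 -
      X ^ 4 * rSer ^ 2 * h5 + X ^ 4 * (rSer * r1 - 4 * X) * h4 + 4 * X ^ 4 * h6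
  refine mul_left_cancel₀ (pow_ne_zero 5 ?_) (h7.trans rSer_pow_mul_eSer.symm)
  intro h0
  simpa [h0] using constantCoeff_rSer

end Torus
end BCMotzkin
end

noncomputable section
open PowerSeries Finset
namespace BCMotzkin

/-! ### Series in three variables and the merging terms of the three-vertex sphere -/

section ThreeVariables

/-- The operator `X₁ d/dX₁` on the ring of series in two variables, as an additive map. -/
def thetaHom : Two →+ Two where
  toFun F := .mk fun n => X * d⁄dX ℝ (coeff n F)
  map_zero' := by ext n : 1; simp
  map_add' F G := by ext n : 1; simp [mul_add]

theorem coeff_thetaHom (F : Two) (n : ℕ) :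
    coeff n (thetaHom F) = X * d⁄dX ℝ (coeff n F) := by
  change coeff n (PowerSeries.mk fun n => X * d⁄dX ℝ (coeff n F)) = _
  rw [coeff_mk]

theorem thetaHom_mul (F G : Two) : thetaHom (F * G) = F * thetaHom G + G * thetaHom F := by
  ext n : 1
  simp only [coeff_thetaHom, map_add, coeff_mul, map_sum, Derivation.leibniz, mul_sum,
    sum_add_distrib, smul_eq_mul, mul_add]
  congr 1
  · exact sum_congr rfl fun x _ => by ring
  · rw [← Nat.sum_antidiagonal_swap]
    exact sum_congr rfl fun x _ => by simp only [Prod.fst_swap, Prod.snd_swap]; ring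

/-- The derivation `X₁ d/dX₁` of the ring of series in two variables. -/
def theta : Derivation ℤ Two Two := Derivation.mk' thetaHom.toIntLinearMap thetaHom_mul

theorem coeff_theta (F : Two) (n : ℕ) : coeff n (theta F) = X * d⁄dX ℝ (coeff n F) :=
  coeff_thetaHom F n

theorem theta_inFst (f : PowerSeries ℝ) : theta (inFst f) = inFst (X * d⁄dX ℝ f) := by
  ext n : 1
  rw [coeff_theta, coeff_inFst, coeff_inFst]
  split_ifs
  · rfl
  · simp

theorem theta_inSnd (f : PowerSeries ℝ) : theta (inSnd f) = 0 := by
  ext n : 1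
  rw [coeff_theta, inSnd, coeff_map]
  simp

/-- With denominators cleared the formula holds in the ring of series, so it can be differentiated
by `theta` and transported along any homomorphism. -/
theorem wSer_mul : 16 * inFst (uPow 1) * inSnd (uPow 1) * (inFst (uPow 1) + inSnd (uPow 1)) ^ 2 *
    wSer = (inFst (uPow 1) ^ 4 - 1) * (inSnd (uPow 1) ^ 4 - 1) := by
  refine IsFractionRing.injective Two (FractionRing Two) ?_
  have h := algebraMap_wSer
  have n1 := map_uPow_one_ne_zero evFst
  have n2 := map_uPow_one_ne_zero evSnd
  have q := evFst_add_evSnd_ne_zero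
  have h' := (eq_div_iff (mul_ne_zero (mul_ne_zero (mul_ne_zero (by norm_num) n1) n2)
    (pow_ne_zero 2 q))).1 h
  simp only [map_mul, map_pow, map_add, map_sub, map_one, map_ofNat]
  rw [mul_comm]
  exact h'

theorem theta_uPow_one : 4 * inFst (uPow 1) * theta (inFst (uPow 1)) = inFst (uPow 1) ^ 4 - 1 := by
  have h := congrArg inFst X_mul_derivative_uPow_one
  rw [theta_inFst]
  simpa only [map_mul, map_sub, map_pow, map_ofNat, map_one] using h

/-- The values of `wSer` and its derivative under a homomorphism to a field. -/
theorem map_theta_wSer {K : Type*} [Field K] [CharZero K] (Ψ : Two →+* K)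
    (h : Ψ (inFst (uPow 1)) + Ψ (inSnd (uPow 1)) ≠ 0) :
    Ψ (theta wSer) = (Ψ (inFst (uPow 1)) ^ 4 - 1) * (Ψ (inSnd (uPow 1)) ^ 4 - 1) *
      ((3 * Ψ (inFst (uPow 1)) ^ 4 + 1) * (Ψ (inFst (uPow 1)) + Ψ (inSnd (uPow 1))) -
        2 * Ψ (inFst (uPow 1)) * (Ψ (inFst (uPow 1)) ^ 4 - 1)) /
      (64 * Ψ (inFst (uPow 1)) ^ 3 * Ψ (inSnd (uPow 1)) *
        (Ψ (inFst (uPow 1)) + Ψ (inSnd (uPow 1))) ^ 3) := by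
  have n1 : Ψ (inFst (uPow 1)) ≠ 0 := map_uPow_one_ne_zero (Ψ.comp inFst)
  have n2 : Ψ (inSnd (uPow 1)) ≠ 0 := map_uPow_one_ne_zero (Ψ.comp inSnd)
  have h16 : theta (16 : Two) = 0 := by
    exact_mod_cast Derivation.map_natCast theta 16
  have h0 := congrArg Ψ wSer_mul
  have h1 := congrArg Ψ theta_uPow_one
  have e1 : (16 : Two) * inFst (uPow 1) * inSnd (uPow 1) * (inFst (uPow 1) + inSnd (uPow 1)) ^ 2 *
    wSer = (16 : ℤ) • (inFst (uPow 1) * inSnd (uPow 1) * (inFst (uPow 1) + inSnd (uPow 1)) ^ 2 *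
      wSer) := by rw [zsmul_eq_mul]; push_cast; ring
  have h2 := congrArg (fun F => Ψ (theta F)) (e1.symm.trans wSer_mul)
  simp only [Derivation.leibniz, Derivation.leibniz_pow, map_add, map_sub,
    theta_inSnd, Derivation.map_one_eq_zero, smul_eq_mul, nsmul_eq_mul, map_mul, map_pow, map_one,
    zsmul_eq_mul, map_zero, map_ofNat, Nat.cast_ofNat, Int.cast_ofNat, h16] at h0 h1 h2
  generalize Ψ (inFst (uPow 1)) = u at *
  generalize Ψ (inSnd (uPow 1)) = w at *
  generalize Ψ (theta (inFst (uPow 1))) = e at *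
  generalize Ψ (theta wSer) = T at *
  generalize Ψ wSer = W at *
  have he : e = (u ^ 4 - 1) / (4 * u) := by
    field_simp
    linear_combination h1
  have hW : W = (u ^ 4 - 1) * (w ^ 4 - 1) / (16 * u * w * (u + w) ^ 2) := by
    field_simp
    linear_combination h0
  rw [he, hW] at h2
  have hk : 16 * u * w * (u + w) ^ 2 ≠ 0 :=
    mul_ne_zero (mul_ne_zero (mul_ne_zero (by norm_num) n1) n2) (pow_ne_zero 2 h)
  refine mul_left_cancel₀ hk ?_
  norm_num at h2
  field_simp at h2 ⊢
  linear_combination h2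

/-- The power series in three variables, the first one innermost, the third one outermost. -/
abbrev Three : Type := PowerSeries Two

/-- A series in the first and second variables. -/
abbrev emb₁₂ : Two →+* Three := C

/-- A series in the first and third variables. -/
abbrev emb₁₃ : Two →+* Three := PowerSeries.map inFst

/-- A series in the second and third variables. -/
abbrev emb₂₃ : Two →+* Three := PowerSeries.map inSnd

/-- The exchange of the two outer variables. -/
def exch : Three →+* Three where
  toFun F := .mk fun n => .mk fun m => coeff n (coeff m F)
  map_zero' := by ext n m : 2; simp
  map_one' := by
    ext n m : 2
    simp only [coeff_mk, coeff_one]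
    split_ifs <;> simp [coeff_one, *]
  map_add' F G := by ext n m : 2; simp
  map_mul' F G := by
    ext n m : 2
    simp only [coeff_mk, coeff_mul, map_sum]
    exact sum_comm

theorem coeff_exch (F : Three) (m n : ℕ) : coeff m (coeff n (exch F)) = coeff n (coeff m F) := by
  change coeff m (coeff n (PowerSeries.mk fun n => PowerSeries.mk fun m => coeff n (coeff m F))) = _
  rw [coeff_mk, coeff_mk]

theorem exch_emb₁₂ (F : Two) : exch (emb₁₂ F) = emb₁₃ F := by
  ext n m : 2
  rw [coeff_exch, coeff_C, emb₁₃, coeff_map, coeff_C]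
  split_ifs <;> simp

theorem exch_emb₁₃ (F : Two) : exch (emb₁₃ F) = emb₁₂ F := by
  ext n m : 2
  rw [coeff_exch, coeff_C, emb₁₃, coeff_map, coeff_C]
  split_ifs <;> simp

theorem emb₁₃_inFst (f : PowerSeries ℝ) : emb₁₃ (inFst f) = emb₁₂ (inFst f) := map_C _ _

theorem emb₂₃_inFst (f : PowerSeries ℝ) : emb₂₃ (inFst f) = emb₁₂ (inSnd f) := map_C _ _

theorem emb₂₃_inSnd (f : PowerSeries ℝ) : emb₂₃ (inSnd f) = emb₁₃ (inSnd f) := by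
  ext n : 1
  rw [emb₁₃, emb₂₃, coeff_map, coeff_map, inSnd, coeff_map]
  exact map_C _ _

/-- The generating series of the `cutSer (X ^ 2 * wTwo n)`. -/
def mSer : Three := .mk fun n => cutSer (X ^ 2 * wTwo n)

/-- `cutSer_mul` for X² `wTwo n`, summed over n as third variable. The logarithmic derivative in the
second variable becomes `theta` under `emb₂₃`, which puts the inner variable of `Two` in second
place. -/
theorem mSer_mul : (emb₁₂ (inFst X) - emb₁₂ (inSnd X)) ^ 2 * mSer =
    emb₁₂ (inFst X) * emb₁₂ (inSnd X) *
      (emb₁₃ (inFst (X ^ 2) * wSer) - emb₂₃ (inFst (X ^ 2) * wSer)) -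
    emb₁₂ (inFst X) * (emb₁₂ (inFst X) - emb₁₂ (inSnd X)) *
      emb₂₃ (theta (inFst (X ^ 2) * wSer)) := by
  have hc : ∀ n, coeff n (inFst (X ^ 2) * wSer) = X ^ 2 * wTwo n := fun n => by
    rw [inFst, coeff_C_mul, wSer, coeff_mk]
  rw [← map_sub, ← map_pow, ← map_mul emb₁₂, ← map_mul emb₁₂]
  ext n : 1
  rw [map_sub, emb₁₂, coeff_C_mul, coeff_C_mul, coeff_C_mul, mSer, coeff_mk, map_sub, emb₁₃,
    coeff_map, emb₂₃, coeff_map, coeff_map, coeff_theta, hc, inSnd_X, cutSer_mul]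

theorem map_sq_sub_sq_ne_zero {K : Type*} [Field K] [CharZero K] (Ψ : Two →+* K)
    (h : Function.Injective Ψ) : Ψ (inFst (uPow 1)) ^ 2 - Ψ (inSnd (uPow 1)) ^ 2 ≠ 0 := by
  have h1 : Ψ (inFst X) = _ := map_X_eq (Ψ.comp inFst) (h.comp inFst_injective)
  have h2 : Ψ (inSnd X) = _ := map_X_eq (Ψ.comp inSnd) (h.comp inSnd_injective)
  have h3 : Ψ (inFst X) - Ψ (inSnd X) ≠ 0 := by
    rw [← map_sub, inSnd_X]
    exact (map_ne_zero_iff _ h).2 fst_ne_snd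
  intro h4
  refine h3 ?_
  rw [h1, h2]
  simp only [RingHom.comp_apply]
  rw [sub_eq_zero.1 h4, sub_self]

theorem map_add_ne_zero {K : Type*} [Field K] [CharZero K] (Ψ : Two →+* K)
    (h : Function.Injective Ψ) : Ψ (inFst (uPow 1)) + Ψ (inSnd (uPow 1)) ≠ 0 := by
  intro h0
  refine map_sq_sub_sq_ne_zero Ψ h ?_
  linear_combination (Ψ (inFst (uPow 1)) - Ψ (inSnd (uPow 1))) * h0

theorem map_wSer {K : Type*} [Field K] [CharZero K] (Ψ : Two →+* K)
    (h : Ψ (inFst (uPow 1)) + Ψ (inSnd (uPow 1)) ≠ 0) :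
    Ψ wSer = (Ψ (inFst (uPow 1)) ^ 4 - 1) * (Ψ (inSnd (uPow 1)) ^ 4 - 1) /
      (16 * Ψ (inFst (uPow 1)) * Ψ (inSnd (uPow 1)) *
        (Ψ (inFst (uPow 1)) + Ψ (inSnd (uPow 1))) ^ 2) := by
  have n1 : Ψ (inFst (uPow 1)) ≠ 0 := map_uPow_one_ne_zero (Ψ.comp inFst)
  have n2 : Ψ (inSnd (uPow 1)) ≠ 0 := map_uPow_one_ne_zero (Ψ.comp inSnd)
  have h0 := congrArg Ψ wSer_mul
  simp only [map_add, map_sub, map_mul, map_pow, map_one, map_ofNat] at h0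
  field_simp
  linear_combination h0

/-- The numerator of `mSer` as a rational function of the `uPow 1`. -/
def mNum {R : Type*} [CommRing R] (u v w : R) : R :=
  2 * v ^ 3 * (v + w) ^ 3 * (v ^ 2 + 1) * (u ^ 2 - 1) ^ 3 -
    2 * u * v ^ 2 * (u + w) ^ 2 * (v + w) * (u ^ 2 + 1) * (v ^ 2 - 1) ^ 3 -
    u * (u + w) ^ 2 * (u ^ 2 - v ^ 2) * (v ^ 2 - 1) ^ 2 *
      ((v + w) * (3 * v ^ 4 + 8 * v ^ 2 + 1) - 2 * v * (v ^ 4 - 1))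

/-- The polynomial identity behind the three-vertex sphere: on the right stand the two mergings and
the splitting over a common denominator. On the left the factor u²v²w² - 1 produces the two terms of
`wThreeSer_eq`, and the factors that do not belong there cancel against the denominator. -/
theorem mNum_add {R : Type*} [CommRing R] (u v w : R) :
    (v ^ 2 + 1) * (w ^ 2 + 1) * (u ^ 2 * v ^ 2 * w ^ 2 - 1) * (u + v) ^ 2 * (u + w) ^ 2 *
      (v + w) ^ 3 * (u - v) ^ 2 * (u - w) ^ 2 =
    (w ^ 2 + 1) * mNum u v w * u * w ^ 2 * (u - w) ^ 2 +
      (v ^ 2 + 1) * mNum u w v * u * v ^ 2 * (u - v) ^ 2 +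
      (u ^ 2 - 1) ^ 3 * (v ^ 2 + 1) * (w ^ 2 + 1) * v ^ 2 * w ^ 2 * (v + w) ^ 3 * (u - v) ^ 2 *
        (u - w) ^ 2 := by
  unfold mNum
  ring

theorem theta_X_sq_mul (F : Two) :
    theta (inFst (X ^ 2) * F) = inFst (X ^ 2) * (2 * F + theta F) := by
  rw [Derivation.leibniz, theta_inFst, sq, Derivation.leibniz, derivative_X]
  simp only [smul_eq_mul, map_mul, map_add, mul_one]
  ring

theorem mSer_field {K : Type*} [Field K] [CharZero K] {u v w M : K} (hu : u ≠ 0) (hv : v ≠ 0)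
    (hw : w ≠ 0) (hu1 : u ^ 2 + 1 ≠ 0) (hv1 : v ^ 2 + 1 ≠ 0) (huw : u + w ≠ 0) (hvw : v + w ≠ 0)
    (h : ((u ^ 2 - 1) / (2 * (u ^ 2 + 1)) - (v ^ 2 - 1) / (2 * (v ^ 2 + 1))) ^ 2 * M =
      (u ^ 2 - 1) / (2 * (u ^ 2 + 1)) * ((v ^ 2 - 1) / (2 * (v ^ 2 + 1))) *
      (((u ^ 2 - 1) / (2 * (u ^ 2 + 1))) ^ 2 *
          ((u ^ 4 - 1) * (w ^ 4 - 1) / (16 * u * w * (u + w) ^ 2)) -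
        ((v ^ 2 - 1) / (2 * (v ^ 2 + 1))) ^ 2 *
          ((v ^ 4 - 1) * (w ^ 4 - 1) / (16 * v * w * (v + w) ^ 2))) -
      (u ^ 2 - 1) / (2 * (u ^ 2 + 1)) *
        ((u ^ 2 - 1) / (2 * (u ^ 2 + 1)) - (v ^ 2 - 1) / (2 * (v ^ 2 + 1))) *
        (((v ^ 2 - 1) / (2 * (v ^ 2 + 1))) ^ 2 *
          (2 * ((v ^ 4 - 1) * (w ^ 4 - 1) / (16 * v * w * (v + w) ^ 2)) +
            (v ^ 4 - 1) * (w ^ 4 - 1) * ((3 * v ^ 4 + 1) * (v + w) - 2 * v * (v ^ 4 - 1)) /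
              (64 * v ^ 3 * w * (v + w) ^ 3)))) :
    512 * u * v ^ 3 * w * (u + w) ^ 2 * (v + w) ^ 3 * (u ^ 2 - v ^ 2) ^ 2 * M =
      (w ^ 4 - 1) * (u ^ 2 - 1) * (v ^ 2 - 1) * mNum u v w := by
  have hd : (u ^ 2 - 1) / (2 * (u ^ 2 + 1)) - (v ^ 2 - 1) / (2 * (v ^ 2 + 1)) =
      (u ^ 2 - v ^ 2) / ((u ^ 2 + 1) * (v ^ 2 + 1)) := by
    field_simp
    ring
  rw [hd] at h
  have h' : 512 * u * v ^ 3 * w * (u + w) ^ 2 * (v + w) ^ 3 * (u ^ 2 - v ^ 2) ^ 2 * M =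
      512 * u * v ^ 3 * w * (u + w) ^ 2 * (v + w) ^ 3 * ((u ^ 2 + 1) * (v ^ 2 + 1)) ^ 2 *
        (((u ^ 2 - v ^ 2) / ((u ^ 2 + 1) * (v ^ 2 + 1))) ^ 2 * M) := by
    field_simp
  rw [h', h, mNum]
  field_simp
  ring

instance : CharZero (FractionRing Three) :=
  have : CharZero Three := algebraRat.charZero Three
  charZero_of_injective_algebraMap (IsFractionRing.injective Three (FractionRing Three))

/-- The embedding in the field of fractions. -/
abbrev ψ₃ : Three →+* FractionRing Three := algebraMap _ _

theorem mSer_mul_eq :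
    512 * emb₁₂ (inFst (uPow 1)) * emb₁₂ (inSnd (uPow 1)) ^ 3 * emb₁₃ (inSnd (uPow 1)) *
      (emb₁₂ (inFst (uPow 1)) + emb₁₃ (inSnd (uPow 1))) ^ 2 *
      (emb₁₂ (inSnd (uPow 1)) + emb₁₃ (inSnd (uPow 1))) ^ 3 *
      (emb₁₂ (inFst (uPow 1)) ^ 2 - emb₁₂ (inSnd (uPow 1)) ^ 2) ^ 2 * mSer =
    (emb₁₃ (inSnd (uPow 1)) ^ 4 - 1) * (emb₁₂ (inFst (uPow 1)) ^ 2 - 1) *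
      (emb₁₂ (inSnd (uPow 1)) ^ 2 - 1) *
      mNum (emb₁₂ (inFst (uPow 1))) (emb₁₂ (inSnd (uPow 1))) (emb₁₃ (inSnd (uPow 1))) := by
  have hinj : Function.Injective ψ₃ := IsFractionRing.injective Three _
  have j12 : Function.Injective emb₁₂ := C_injective
  have j13 : Function.Injective emb₁₃ := PowerSeries.map_injective _ inFst_injective
  have j23 : Function.Injective emb₂₃ := PowerSeries.map_injective _ inSnd_injective
  have h := congrArg ψ₃ mSer_mul
  have x1 : ψ₃ (emb₁₂ (inFst X)) = _ := map_X_eq ((ψ₃.comp emb₁₂).comp inFst)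
    ((hinj.comp j12).comp inFst_injective)
  have x2 : ψ₃ (emb₁₂ (inSnd X)) = _ := map_X_eq ((ψ₃.comp emb₁₂).comp inSnd)
    ((hinj.comp j12).comp inSnd_injective)
  have p1 := map_sq_add_one_ne_zero ((ψ₃.comp emb₁₂).comp inFst)
    ((hinj.comp j12).comp inFst_injective)
  have p2 := map_sq_add_one_ne_zero ((ψ₃.comp emb₁₂).comp inSnd)
    ((hinj.comp j12).comp inSnd_injective)
  have n1 := map_uPow_one_ne_zero ((ψ₃.comp emb₁₂).comp inFst)
  have n2 := map_uPow_one_ne_zero ((ψ₃.comp emb₁₂).comp inSnd)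
  have n3 := map_uPow_one_ne_zero ((ψ₃.comp emb₁₃).comp inSnd)
  have q13 := map_add_ne_zero (ψ₃.comp emb₁₃) (hinj.comp j13)
  have q23 := map_add_ne_zero (ψ₃.comp emb₂₃) (hinj.comp j23)
  have w13 := map_wSer (ψ₃.comp emb₁₃) q13
  have w23 := map_wSer (ψ₃.comp emb₂₃) q23
  have t23 := map_theta_wSer (ψ₃.comp emb₂₃) q23
  simp only [RingHom.comp_apply, emb₁₃_inFst, emb₂₃_inFst, emb₂₃_inSnd] at *
  rw [theta_X_sq_mul] at h
  simp only [map_mul, map_add, map_sub, map_pow, map_ofNat, emb₁₃_inFst, emb₂₃_inFst, w13, w23, t23,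
    x1, x2] at h
  refine hinj ?_
  have h' := mSer_field n1 n2 n3 p1 p2 q13 q23 h
  simp only [mNum, map_mul, map_add, map_sub, map_pow, map_ofNat, map_one] at h' ⊢
  exact h'

end ThreeVariables
end BCMotzkin
end

noncomputable section
open PowerSeries Finset
namespace BCMotzkin

/-! ### The initial case of genus 0 with three vertices -/

section ThreeVertices

/-- The generating series of the gluings of genus `0` with three vertices, the second and the third
one of degree `n` and `m`. -/
def wThree (n m : ℕ) : PowerSeries ℝ := gf 0 (fun b : Bool => cond b n m)

theorem gf_zero_bool_ne (b : Bool) (f : Bool → ℕ) :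
    gf 0 (fun i : {i : Bool // i ≠ b} => f i) = wTwo (f (!b)) := by
  let e : {i : Bool // i ≠ b} ≃ Unit :=
    { toFun := fun _ => ()
      invFun := fun _ => ⟨!b, by simp⟩
      left_inv := fun i => Subtype.ext (Bool.eq_not.2 i.2).symm
      right_inv := fun _ => rfl }
  rw [wTwo]
  exact gf_congr (ν := fun _ => f (!b)) e (fun i => congrArg f (Bool.eq_not.2 i.2).symm) 0

theorem splitTerm_bool (b : Bool) (f : Bool → ℕ) :
    splitTerm f ({b}, (0, 0)) = wTwo (f b) * wTwo (f (!b)) := by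
  rw [splitTerm]
  congr 1
  · let e : {i : Bool // i ∈ ({b} : Finset Bool)} ≃ Unit :=
      { toFun := fun _ => ()
        invFun := fun _ => ⟨b, by simp⟩
        left_inv := fun i => Subtype.ext (mem_singleton.1 i.2).symm
        right_inv := fun _ => rfl }
    rw [wTwo]
    exact gf_congr (ν := fun _ => f b) e (fun i => congrArg f (mem_singleton.1 i.2).symm) 0
  · have hne : ∀ i : {i : Bool // i ∉ ({b} : Finset Bool)}, (!b) = i.1 := fun i =>
      (Bool.eq_not.2 fun h => i.2 (mem_singleton.2 h)).symm
    let e : {i : Bool // i ∉ ({b} : Finset Bool)} ≃ Unit :=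
      { toFun := fun _ => ()
        invFun := fun _ => ⟨!b, by simp⟩
        left_inv := fun i => Subtype.ext (hne i)
        right_inv := fun _ => rfl }
    rw [wTwo]
    exact gf_congr (ν := fun _ => f (!b)) e (fun i => congrArg f (hne i)) 0

theorem filter_splits_bool :
    (splits Bool 0).filter (fun p => p ≠ (∅, (0, 0)) ∧ p ≠ (univ, (0, 0))) =
      {({true}, (0, 0)), ({false}, (0, 0))} := by
  ext ⟨I, a, b⟩
  rw [mem_filter, mem_splits, mem_insert, mem_singleton]
  simp only [Nat.add_eq_zero_iff, Prod.mk.injEq, ne_eq]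
  constructor
  · rintro ⟨⟨rfl, rfl⟩, h⟩
    simp only [and_true] at h ⊢
    revert h
    revert I
    decide
  · rintro (⟨rfl, rfl, rfl⟩ | ⟨rfl, rfl, rfl⟩) <;> simp <;> decide

/-- Besides the two mergings there are two nontrivial splittings, which separate the other vertices
from each other in either order. -/
theorem rSer_mul_wThree (n m : ℕ) : rSer * wThree n m =
    cut n (X ^ 2 * wTwo m) + cut m (X ^ 2 * wTwo n) + 2 * (X ^ 2 * (wTwo n * wTwo m)) := by
  rw [wThree, rSer_mul_gf 0 _ (Or.inl ⟨true⟩), cat_cons_zero_of_nonempty,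
    filter_splits_bool, sum_pair (by simp), splitTerm_bool, splitTerm_bool, Fintype.sum_bool,
    gf_zero_bool_ne true (fun b => cond b n m), gf_zero_bool_ne false (fun b => cond b n m)]
  simp only [dbl, Nat.cast_zero, map_zero, zero_add, cond_true, cond_false, Bool.not_true,
    Bool.not_false, Nat.one_ne_zero, nonpos_iff_eq_zero, if_false]
  ring

/-- The generating series of the gluings of genus `0` with three vertices. -/
def wThreeSer : Three := .mk fun m => .mk fun n => wThree n m

theorem rSer_mul_wThreeSer : emb₁₂ (inFst rSer) * wThreeSer =
    mSer + exch mSer + 2 * (emb₁₂ (inFst X) ^ 2 * (emb₁₂ wSer * emb₁₃ wSer)) := by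
  have h2 : ∀ m n : ℕ, coeff n (coeff m (2 * (emb₁₂ (inFst X) ^ 2 * (emb₁₂ wSer * emb₁₃ wSer)))) =
      2 * (X ^ 2 * (wTwo n * wTwo m)) := by
    intro m n
    have e : (2 : Three) * (emb₁₂ (inFst X) ^ 2 * (emb₁₂ wSer * emb₁₃ wSer)) =
        emb₁₂ (inFst (2 * X ^ 2) * wSer) * emb₁₃ wSer := by
      simp only [map_mul, map_pow, map_ofNat]; ring
    have e2 : coeff m wSer = wTwo m := coeff_mk _ _
    have e3 : coeff n wSer = wTwo n := coeff_mk _ _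
    rw [e, emb₁₂, coeff_C_mul, emb₁₃, coeff_map, mul_right_comm, ← map_mul, inFst, coeff_C_mul, e2,
      e3]
    ring
  ext m n : 2
  rw [map_add, map_add, map_add, map_add, h2, coeff_exch, emb₁₂, coeff_C_mul, inFst, coeff_C_mul,
    wThreeSer, coeff_mk, coeff_mk, rSer_mul_wThree, mSer, coeff_mk, coeff_mk, cutSer, cutSer,
    coeff_mk, coeff_mk]

theorem exch_mSer_mul_eq :
    512 * emb₁₂ (inFst (uPow 1)) * emb₁₃ (inSnd (uPow 1)) ^ 3 * emb₁₂ (inSnd (uPow 1)) *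
      (emb₁₂ (inFst (uPow 1)) + emb₁₂ (inSnd (uPow 1))) ^ 2 *
      (emb₁₃ (inSnd (uPow 1)) + emb₁₂ (inSnd (uPow 1))) ^ 3 *
      (emb₁₂ (inFst (uPow 1)) ^ 2 - emb₁₃ (inSnd (uPow 1)) ^ 2) ^ 2 * exch mSer =
    (emb₁₂ (inSnd (uPow 1)) ^ 4 - 1) * (emb₁₂ (inFst (uPow 1)) ^ 2 - 1) *
      (emb₁₃ (inSnd (uPow 1)) ^ 2 - 1) *
      mNum (emb₁₂ (inFst (uPow 1))) (emb₁₃ (inSnd (uPow 1))) (emb₁₂ (inSnd (uPow 1))) := by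
  have h := congrArg exch mSer_mul_eq
  simpa only [mNum, map_mul, map_add, map_sub, map_pow, map_ofNat, map_one, exch_emb₁₂, exch_emb₁₃,
    emb₁₃_inFst] using h

theorem wThree_field {K : Type*} [Field K] [CharZero K] {u v w M N W : K} (hu : u ≠ 0) (hv : v ≠ 0)
    (hw : w ≠ 0) (hu1 : u ^ 2 + 1 ≠ 0) (huv : u + v ≠ 0) (huw : u + w ≠ 0) (hvw : v + w ≠ 0)
    (huv' : u ^ 2 - v ^ 2 ≠ 0) (huw' : u ^ 2 - w ^ 2 ≠ 0)
    (hM : 512 * u * v ^ 3 * w * (u + w) ^ 2 * (v + w) ^ 3 * (u ^ 2 - v ^ 2) ^ 2 * M =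
      (w ^ 4 - 1) * (u ^ 2 - 1) * (v ^ 2 - 1) * mNum u v w)
    (hN : 512 * u * w ^ 3 * v * (u + v) ^ 2 * (w + v) ^ 3 * (u ^ 2 - w ^ 2) ^ 2 * N =
      (v ^ 4 - 1) * (u ^ 2 - 1) * (w ^ 2 - 1) * mNum u w v)
    (h : 2 * u / (u ^ 2 + 1) * W = M + N + 2 * (((u ^ 2 - 1) / (2 * (u ^ 2 + 1))) ^ 2 *
      ((u ^ 4 - 1) * (v ^ 4 - 1) / (16 * u * v * (u + v) ^ 2) *
        ((u ^ 4 - 1) * (w ^ 4 - 1) / (16 * u * w * (u + w) ^ 2))))) :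
    W = 1 / 16 * ((u ^ 4 - 1) / (4 * u) * ((v ^ 4 - 1) / (4 * v)) * ((w ^ 4 - 1) / (4 * w)) -
      (u ^ 2)⁻¹ * (u ^ 4 - 1) / (4 * u) * ((v ^ 2)⁻¹ * (v ^ 4 - 1) / (4 * v)) *
        ((w ^ 2)⁻¹ * (w ^ 4 - 1) / (4 * w))) := by
  have huv2 : u - v ≠ 0 := by
    intro h0; refine huv' ?_; linear_combination (u + v) * h0
  have huw2 : u - w ≠ 0 := by
    intro h0; refine huw' ?_; linear_combination (u + w) * h0
  have hD : 512 * u ^ 2 * v ^ 3 * w ^ 3 * (u + v) ^ 2 * (u + w) ^ 2 * (v + w) ^ 3 * (u - v) ^ 2 *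
      (u - w) ^ 2 ≠ 0 := by
    refine mul_ne_zero (mul_ne_zero (mul_ne_zero (mul_ne_zero (mul_ne_zero (mul_ne_zero
      (mul_ne_zero (mul_ne_zero (by norm_num) ?_) ?_) ?_) ?_) ?_) ?_) ?_) ?_ <;>
    exact pow_ne_zero _ ‹_›
  have hW : W = (u ^ 2 + 1) / (2 * u) * (2 * u / (u ^ 2 + 1) * W) := by field_simp
  have hk := mNum_add u v w
  rw [hW, h]
  have hM' : M = (w ^ 4 - 1) * (u ^ 2 - 1) * (v ^ 2 - 1) * mNum u v w /
      (512 * u * v ^ 3 * w * (u + w) ^ 2 * (v + w) ^ 3 * ((u + v) * (u - v)) ^ 2) := by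
    rw [← hM, sq_sub_sq u v]
    field_simp
  have hN' : N = (v ^ 4 - 1) * (u ^ 2 - 1) * (w ^ 2 - 1) * mNum u w v /
      (512 * u * w ^ 3 * v * (u + v) ^ 2 * (v + w) ^ 3 * ((u + w) * (u - w)) ^ 2) := by
    rw [← hN, add_comm w v, sq_sub_sq u w]
    field_simp
  have hS : M + N + 2 * (((u ^ 2 - 1) / (2 * (u ^ 2 + 1))) ^ 2 *
      ((u ^ 4 - 1) * (v ^ 4 - 1) / (16 * u * v * (u + v) ^ 2) *
        ((u ^ 4 - 1) * (w ^ 4 - 1) / (16 * u * w * (u + w) ^ 2)))) =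
      (u ^ 2 - 1) * (v ^ 2 - 1) * (w ^ 2 - 1) * ((v ^ 2 + 1) * (w ^ 2 + 1) *
        (u ^ 2 * v ^ 2 * w ^ 2 - 1) * (u + v) ^ 2 * (u + w) ^ 2 * (v + w) ^ 3 * (u - v) ^ 2 *
        (u - w) ^ 2) / (512 * u ^ 2 * v ^ 3 * w ^ 3 * (u + v) ^ 2 * (u + w) ^ 2 * (v + w) ^ 3 *
          (u - v) ^ 2 * (u - w) ^ 2) := by
    rw [hk, hM', hN']
    generalize mNum u v w = A
    generalize mNum u w v = B
    field_simp
    ring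
  rw [hS]
  field_simp
  ring

/-- A computation with rational functions in the three coordinates: the poles along the sums of two
coordinates, present in each term of the recursion, all cancel. -/
theorem wThreeSer_eq : wThreeSer = emb₁₂ (inFst (C (1 / 16))) *
    (emb₁₂ (inFst (eSer 0)) * emb₁₂ (inSnd (eSer 0)) * emb₁₃ (inSnd (eSer 0)) -
      emb₁₂ (inFst (eSer (-1))) * emb₁₂ (inSnd (eSer (-1))) * emb₁₃ (inSnd (eSer (-1)))) := by
  have hinj : Function.Injective ψ₃ := IsFractionRing.injective Three _
  have j12 : Function.Injective emb₁₂ := C_injective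
  have j13 : Function.Injective emb₁₃ := PowerSeries.map_injective _ inFst_injective
  have j23 : Function.Injective emb₂₃ := PowerSeries.map_injective _ inSnd_injective
  have h := congrArg ψ₃ rSer_mul_wThreeSer
  have x1 : ψ₃ (emb₁₂ (inFst X)) = _ := map_X_eq ((ψ₃.comp emb₁₂).comp inFst)
    ((hinj.comp j12).comp inFst_injective)
  have r1 : ψ₃ (emb₁₂ (inFst rSer)) = _ := map_rSer_eq ((ψ₃.comp emb₁₂).comp inFst)
    ((hinj.comp j12).comp inFst_injective)
  have p1 := map_sq_add_one_ne_zero ((ψ₃.comp emb₁₂).comp inFst)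
    ((hinj.comp j12).comp inFst_injective)
  have n1 := map_uPow_one_ne_zero ((ψ₃.comp emb₁₂).comp inFst)
  have n2 := map_uPow_one_ne_zero ((ψ₃.comp emb₁₂).comp inSnd)
  have n3 := map_uPow_one_ne_zero ((ψ₃.comp emb₁₃).comp inSnd)
  have q12 := map_add_ne_zero (ψ₃.comp emb₁₂) (hinj.comp j12)
  have q13 := map_add_ne_zero (ψ₃.comp emb₁₃) (hinj.comp j13)
  have q23 := map_add_ne_zero (ψ₃.comp emb₂₃) (hinj.comp j23)
  have s12 := map_sq_sub_sq_ne_zero (ψ₃.comp emb₁₂) (hinj.comp j12)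
  have s13 := map_sq_sub_sq_ne_zero (ψ₃.comp emb₁₃) (hinj.comp j13)
  have w12 := map_wSer (ψ₃.comp emb₁₂) q12
  have w13 := map_wSer (ψ₃.comp emb₁₃) q13
  have e1 := fun k => map_eSer_eq ((ψ₃.comp emb₁₂).comp inFst) k
  have e2 := fun k => map_eSer_eq ((ψ₃.comp emb₁₂).comp inSnd) k
  have e3 := fun k => map_eSer_eq ((ψ₃.comp emb₁₃).comp inSnd) k
  have hM := congrArg ψ₃ mSer_mul_eq
  have hN := congrArg ψ₃ exch_mSer_mul_eq
  have h16 : ((ψ₃.comp emb₁₂).comp inFst) (C (1 / 16)) = 1 / 16 := by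
    have := map_C_ratCast ((ψ₃.comp emb₁₂).comp inFst) (1 / 16)
    push_cast at this; exact this
  simp only [RingHom.comp_apply, emb₁₃_inFst, emb₂₃_inFst, emb₂₃_inSnd] at *
  simp only [mNum, map_mul, map_add, map_sub, map_pow, map_ofNat, map_one] at hM hN
  simp only [map_mul, map_add, map_pow, map_ofNat, w12, w13, x1, r1] at h
  refine hinj ?_
  have h' := wThree_field n1 n2 n3 p1 q12 q13 q23 s12 s13 hM hN h
  rw [h']
  simp only [map_mul, map_sub, e1, e2, e3, h16]
  norm_num

theorem wThree_eq (n m : ℕ) : wThree n m = C (1 / 16) *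
    (C (eCoeff 0 n * eCoeff 0 m) * eSer 0 - C (eCoeff (-1) n * eCoeff (-1) m) * eSer (-1)) := by
  have h := congrArg (fun F => coeff n (coeff m F)) wThreeSer_eq
  have hk : ∀ f g k : PowerSeries ℝ, coeff n (coeff m (emb₁₂ (inFst f) * emb₁₂ (inSnd g) *
      emb₁₃ (inSnd k))) = C (coeff n g * coeff m k) * f := by
    intro f g k
    rw [← map_mul, emb₁₂, coeff_C_mul, emb₁₃, coeff_map, inSnd, coeff_map, mul_right_comm, ← map_mul,
      inFst, coeff_C_mul, coeff_map, map_mul]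
    ring
  have e : ∀ F, coeff n (coeff m (emb₁₂ (inFst (C (1 / 16))) * F)) =
      C (1 / 16) * coeff n (coeff m F) := fun F => by
    rw [emb₁₂, coeff_C_mul, inFst, coeff_C_mul]
  simp only [e, map_sub, hk] at h
  rw [wThreeSer, coeff_mk, coeff_mk] at h
  exact h

end ThreeVertices
end BCMotzkin
end

noncomputable section
open PowerSeries Finset
namespace BCMotzkin

/-! ### Weights, positivity of top coefficients, and the operators of the recursion -/

section Cone
variable {ι : Type} [Fintype ι] [DecidableEq ι]

/-- The products of the coefficients of basic series. -/
def prodE (l : ι → ℤ) (μ : ι → ℕ) : ℝ := ∏ i, eCoeff (l i) (μ i)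

/-- The sum of the `2 * l i + 1`. -/
def oddSum (l : ι → ℤ) : ℤ := ∑ i, (2 * l i + 1)

/-- The sum of the positive `2 * l i + 1`. -/
def oddWeight (l : ι → ℤ) : ℤ := ∑ i, max (2 * l i + 1) 0

theorem oddSum_le (l : ι → ℤ) : oddSum l ≤ oddWeight l := sum_le_sum fun _ _ => le_max_left _ _

/-- A basic family of series. -/
def basic (r : ℝ) (a : ℤ) (l : ι → ℤ) (μ : ι → ℕ) : PowerSeries ℝ := C (r * prodE l μ) * eSer a

/-- The basic families of weight at most `d` with nonnegative top coefficient. -/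
def basicSet (ι : Type) [Fintype ι] [DecidableEq ι] (d : ℤ) : Set ((ι → ℕ) → PowerSeries ℝ) :=
  {F | ∃ r a l, max (2 * a + 1) 0 + oddWeight l ≤ d ∧ (2 * a + 1 + oddSum l = d → 0 ≤ r) ∧
    F = basic r a l}

/-- The sums of basic families of weight at most `d` with nonnegative top coefficients. -/
def cone (ι : Type) [Fintype ι] [DecidableEq ι] (d : ℤ) :
    AddSubmonoid ((ι → ℕ) → PowerSeries ℝ) :=
  AddSubmonoid.closure (basicSet ι d)

/-- The elements of `cone ι d` with a nonzero top coefficient. -/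
def openCone (ι : Type) [Fintype ι] [DecidableEq ι] (d : ℤ) : Set ((ι → ℕ) → PowerSeries ℝ) :=
  {F | ∃ r a l, max (2 * a + 1) 0 + oddWeight l ≤ d ∧ 2 * a + 1 + oddSum l = d ∧ 0 < r ∧
    ∃ G ∈ cone ι d, F = basic r a l + G}

theorem basic_mem_cone {d : ℤ} {r : ℝ} {a : ℤ} {l : ι → ℤ}
    (h1 : max (2 * a + 1) 0 + oddWeight l ≤ d) (h2 : 2 * a + 1 + oddSum l = d → 0 ≤ r) :
    basic r a l ∈ cone ι d :=
  AddSubmonoid.subset_closure ⟨r, a, l, h1, h2, rfl⟩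

theorem openCone_subset {d : ℤ} {F : (ι → ℕ) → PowerSeries ℝ} (h : F ∈ openCone ι d) :
    F ∈ cone ι d := by
  obtain ⟨r, a, l, h1, _, h3, G, hG, rfl⟩ := h
  exact add_mem (basic_mem_cone h1 fun _ => h3.le) hG

theorem add_mem_openCone {d : ℤ} {F G : (ι → ℕ) → PowerSeries ℝ} (hF : F ∈ openCone ι d)
    (hG : G ∈ cone ι d) : F + G ∈ openCone ι d := by
  obtain ⟨r, a, l, h1, h2, h3, G', hG', rfl⟩ := hF
  exact ⟨r, a, l, h1, h2, h3, G' + G, add_mem hG' hG, add_assoc _ _ _⟩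

/-- The multiples of elements of the cone by `rSer`. -/
def rCone (ι : Type) [Fintype ι] [DecidableEq ι] (d : ℤ) :
    AddSubmonoid ((ι → ℕ) → PowerSeries ℝ) :=
  (cone ι d).map (AddMonoidHom.mulLeft (fun _ => rSer))

/-- The multiples of elements of the open cone by `rSer`. -/
def rOpenCone (ι : Type) [Fintype ι] [DecidableEq ι] (d : ℤ) : Set ((ι → ℕ) → PowerSeries ℝ) :=
  {F | ∃ G ∈ openCone ι d, F = (fun _ => rSer) * G}

theorem mem_rCone {d : ℤ} {F : (ι → ℕ) → PowerSeries ℝ} :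
    F ∈ rCone ι d ↔ ∃ G ∈ cone ι d, F = (fun _ => rSer) * G := by
  rw [rCone, AddSubmonoid.mem_map]
  exact exists_congr fun G => and_congr_right fun _ => eq_comm

theorem add_mem_rOpenCone {d : ℤ} {F G : (ι → ℕ) → PowerSeries ℝ} (hF : F ∈ rOpenCone ι d)
    (hG : G ∈ rCone ι d) : F + G ∈ rOpenCone ι d := by
  obtain ⟨F, hF, rfl⟩ := hF
  obtain ⟨G', hG', rfl⟩ := mem_rCone.1 hG
  exact ⟨F + G', add_mem_openCone hF hG', (mul_add _ _ _).symm⟩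

theorem rSer_ne_zero : rSer ≠ 0 := fun h0 => by simpa [h0] using constantCoeff_rSer

theorem mem_openCone_of_mul {d : ℤ} {F : (ι → ℕ) → PowerSeries ℝ}
    (h : (fun μ => rSer * F μ) ∈ rOpenCone ι d) : F ∈ openCone ι d := by
  obtain ⟨G, hG, h⟩ := h
  convert hG
  ext μ : 1
  exact mul_left_cancel₀ rSer_ne_zero (congrFun h μ)

section Operators
variable {κ : Type} [Fintype κ] [DecidableEq κ]

/-- The cone is generated by the basic families, so an additive operator need only be tested on
these. -/
theorem map_cone {d d' : ℤ} (T : ((κ → ℕ) → PowerSeries ℝ) →+ ((ι → ℕ) → PowerSeries ℝ))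
    (h : ∀ r a l, max (2 * a + 1) 0 + oddWeight l ≤ d → (2 * a + 1 + oddSum l = d → 0 ≤ r) →
      T (basic r a l) ∈ rCone ι d') {F : (κ → ℕ) → PowerSeries ℝ} (hF : F ∈ cone κ d) :
    T F ∈ rCone ι d' := by
  have : cone κ d ≤ (rCone ι d').comap T := by
    refine AddSubmonoid.closure_le.2 ?_
    rintro _ ⟨r, a, l, h1, h2, rfl⟩
    exact h r a l h1 h2
  exact this hF

theorem map_openCone {d d' : ℤ} (T : ((κ → ℕ) → PowerSeries ℝ) →+ ((ι → ℕ) → PowerSeries ℝ))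
    (h : ∀ r a l, max (2 * a + 1) 0 + oddWeight l ≤ d → (2 * a + 1 + oddSum l = d → 0 ≤ r) →
      T (basic r a l) ∈ rCone ι d')
    (h' : ∀ r a l, max (2 * a + 1) 0 + oddWeight l ≤ d → 2 * a + 1 + oddSum l = d → 0 < r →
      T (basic r a l) ∈ rOpenCone ι d') {F : (κ → ℕ) → PowerSeries ℝ} (hF : F ∈ openCone κ d) :
    T F ∈ rOpenCone ι d' := by
  obtain ⟨r, a, l, h1, h2, h3, G, hG, rfl⟩ := hF
  rw [map_add]
  exact add_mem_rOpenCone (h' r a l h1 h2 h3) (map_cone T h hG)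

end Operators

/-- The family of the product of two basic series. -/
def pairFam (x : ℝ) (a b : ℤ) (l : ι → ℤ) (μ : ι → ℕ) : PowerSeries ℝ :=
  X ^ 2 * (C (x * prodE l μ) * (eSer a * eSer b))

theorem pairFam_eq (x : ℝ) (a b : ℤ) (l : ι → ℤ) : pairFam x a b l = (fun _ => rSer) *
    (basic (x / 32) (a + b + 2) l + (basic (-(3 * x / 32)) (a + b + 1) l +
      basic (3 * x / 32) (a + b) l + basic (-(x / 32)) (a + b - 1) l)) := by
  ext μ : 1
  simp only [pairFam, Pi.mul_apply, Pi.add_apply, basic]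
  have h := X_sq_mul_eSer_mul_eSer a b
  have h1 : ∀ y, C (y / 32 * prodE l μ) = C (y * prodE l μ) * (C (1 / 32) : PowerSeries ℝ) := by
    intro y; rw [← map_mul]; congr 1; ring
  have h3 : C (3 * x * prodE l μ) = 3 * (C (x * prodE l μ) : PowerSeries ℝ) := by
    rw [mul_assoc, map_mul]; congr 1
  rw [neg_mul, map_neg, neg_mul (x / 32), map_neg, h1, h1, h3]
  linear_combination C (x * prodE l μ) * h

/-- Only the first term of the third difference can reach top weight, and its coefficient x / 32 has
the sign of x. The signs of the other terms are irrelevant. -/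
theorem pairFam_mem {d : ℤ} {x : ℝ} {a b : ℤ} {l : ι → ℤ}
    (h1 : max (2 * a + 1) 0 + max (2 * b + 1) 0 + 3 + oddWeight l ≤ d)
    (h2 : 2 * a + 2 * b + 5 + oddSum l = d → 0 ≤ x) : pairFam x a b l ∈ rCone ι d := by
  have := oddSum_le l
  rw [pairFam_eq, mem_rCone]
  refine ⟨_, add_mem (basic_mem_cone ?_ ?_) (add_mem (add_mem (basic_mem_cone ?_ ?_)
    (basic_mem_cone ?_ ?_)) (basic_mem_cone ?_ ?_)), rfl⟩
  · omega
  · intro h; have := h2 (by omega); positivity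
  all_goals omega

theorem pairFam_mem_open {d : ℤ} {x : ℝ} {a b : ℤ} {l : ι → ℤ}
    (h1 : max (2 * a + 1) 0 + max (2 * b + 1) 0 + 3 + oddWeight l ≤ d)
    (h2 : 2 * a + 2 * b + 5 + oddSum l = d) (hx : 0 < x) : pairFam x a b l ∈ rOpenCone ι d := by
  have := oddSum_le l
  rw [pairFam_eq]
  refine ⟨_, ⟨x / 32, a + b + 2, l, ?_, ?_, ?_, _, add_mem (add_mem (basic_mem_cone ?_ ?_)
    (basic_mem_cone ?_ ?_)) (basic_mem_cone ?_ ?_), rfl⟩, rfl⟩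
  · omega
  · omega
  · positivity
  all_goals omega

/-- The exponents with the value `q` at `j`. -/
def insertAt (j : ι) (q : ℤ) (l : {i // i ≠ j} → ℤ) (i : ι) : ℤ := if h : i = j then q else l ⟨i, h⟩

theorem prodE_insertAt (j : ι) (q : ℤ) (l : {i // i ≠ j} → ℤ) (μ : ι → ℕ) :
    prodE (insertAt j q l) μ = eCoeff q (μ j) * prodE l fun i => μ i := by
  rw [prodE, Fintype.prod_eq_mul_prod_subtype_ne _ j, insertAt, dif_pos rfl]
  congr 1
  exact Fintype.prod_congr _ _ fun i => by rw [insertAt, dif_neg i.2]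

theorem oddSum_insertAt (j : ι) (q : ℤ) (l : {i // i ≠ j} → ℤ) :
    oddSum (insertAt j q l) = 2 * q + 1 + oddSum l := by
  rw [oddSum, Fintype.sum_eq_add_sum_subtype_ne _ j, insertAt, dif_pos rfl]
  congr 1
  exact Fintype.sum_congr _ _ fun i => by rw [insertAt, dif_neg i.2]

theorem oddWeight_insertAt (j : ι) (q : ℤ) (l : {i // i ≠ j} → ℤ) :
    oddWeight (insertAt j q l) = max (2 * q + 1) 0 + oddWeight l := by
  rw [oddWeight, Fintype.sum_eq_add_sum_subtype_ne _ j, insertAt, dif_pos rfl]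
  congr 1
  exact Fintype.sum_congr _ _ fun i => by rw [insertAt, dif_neg i.2]

/-- The family of the series `eeSum`. -/
def eeFam (x : ℝ) (j : ι) (a : ℤ) (l : {i // i ≠ j} → ℤ) (μ : ι → ℕ) : PowerSeries ℝ :=
  C (x * prodE l fun i => μ i) * eeSum (μ j) a

theorem eeFam_eq (x : ℝ) (j : ι) (a : ℤ) (l : {i // i ≠ j} → ℤ) : eeFam x j a l =
    ∑ q ∈ Ico 0 a, basic ((2 * q + 1) * x) (a - 1 - q) (insertAt j q l) +
      ∑ q ∈ Ico a 0, basic (-(2 * q + 1) * x) (a - 1 - q) (insertAt j q l) := by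
  ext μ : 1
  simp only [eeFam, eeSum, Pi.add_apply, Finset.sum_apply, mul_add, mul_sum, basic, prodE_insertAt]
  congr 1 <;> refine sum_congr rfl fun q _ => ?_ <;> rw [← mul_assoc, ← map_mul] <;> congr 2 <;> ring

/-- In every term 2q + 1 and 2(a - 1 - q) + 1 have the sign of a and sum to 2a, so their weights sum
to max(2a, 0). The factor ±(2q + 1) is positive. -/
theorem eeFam_mem {d : ℤ} {x : ℝ} {j : ι} {a : ℤ} {l : {i // i ≠ j} → ℤ}
    (h1 : max (2 * a) 0 + oddWeight l ≤ d) (h2 : 2 * a + oddSum l = d → 0 ≤ x) :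
    eeFam x j a l ∈ cone ι d := by
  rw [eeFam_eq]
  refine add_mem (sum_mem fun q hq => ?_) (sum_mem fun q hq => ?_) <;> rw [mem_Ico] at hq <;>
  · refine basic_mem_cone ?_ ?_
    · rw [oddWeight_insertAt]; omega
    · rw [oddSum_insertAt]
      intro h
      refine mul_nonneg ?_ (h2 (by omega))
      norm_cast
      omega

theorem eeFam_mem_open {d : ℤ} {x : ℝ} {j : ι} {a : ℤ} {l : {i // i ≠ j} → ℤ} (ha : 0 < a)
    (h1 : 2 * a + oddWeight l ≤ d) (h2 : 2 * a + oddSum l = d) (hx : 0 < x) :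
    eeFam x j a l ∈ openCone ι d := by
  have h0 : (0 : ℤ) ∈ Ico 0 a := mem_Ico.2 ⟨le_rfl, ha⟩
  rw [eeFam_eq, Ico_eq_empty_of_le ha.le, sum_empty, add_zero, ← add_sum_erase _ _ h0]
  -- The term q = 0, with factor 1, provides the positive top coefficient.
  refine ⟨_, _, _, ?_, ?_, ?_, _, sum_mem fun q hq => basic_mem_cone ?_ ?_, rfl⟩
  · rw [oddWeight_insertAt]; omega
  · rw [oddSum_insertAt]; omega
  · simpa using hx
  · rw [mem_erase, mem_Ico] at hq
    rw [oddWeight_insertAt]; omega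
  · rw [mem_erase, mem_Ico] at hq
    intro _
    refine mul_nonneg ?_ hx.le
    norm_cast
    omega

theorem cut_add_right (n : ℕ) (f g : PowerSeries ℝ) : cut n (f + g) = cut n f + cut n g := by
  ext m
  rw [map_add, coeff_cut, coeff_cut, coeff_cut, map_add]
  split_ifs <;> ring

theorem cut_zero_right (n : ℕ) : cut n 0 = 0 := by
  ext m
  rw [coeff_cut]
  simp

theorem cut_C_mul (n : ℕ) (c : ℝ) (f : PowerSeries ℝ) : cut n (C c * f) = C c * cut n f := by
  ext m
  rw [coeff_C_mul, coeff_cut, coeff_cut, coeff_C_mul]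
  split_ifs <;> ring

/-- The operator of merging the vertex `j` with the root. -/
def cutOp (j : ι) : (({i // i ≠ j} → ℕ) → PowerSeries ℝ) →+ ((ι → ℕ) → PowerSeries ℝ) where
  toFun G μ := cut (μ j) (X ^ 2 * G fun i => μ i) + 2 * (X ^ 2 * (wTwo (μ j) * G fun i => μ i))
  map_zero' := by ext μ : 1; simp [cut_zero_right]
  map_add' F G := by
    ext μ : 1
    simp only [Pi.add_apply, mul_add, cut_add_right]
    ring

theorem cutOp_apply (j : ι) (G : ({i // i ≠ j} → ℕ) → PowerSeries ℝ) (μ : ι → ℕ) :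
    cutOp j G μ = cut (μ j) (X ^ 2 * G fun i => μ i) +
      2 * (X ^ 2 * (wTwo (μ j) * G fun i => μ i)) := rfl

theorem cutOp_basic (j : ι) (r : ℝ) (a : ℤ) (l : {i // i ≠ j} → ℤ) :
    cutOp j (basic r a l) = (fun _ => rSer) * (eeFam (r / 16) j (a + 2) l +
      (eeFam (-(3 * r / 16)) j (a + 1) l + eeFam (3 * r / 16) j a l +
        eeFam (-(r / 16)) j (a - 1) l)) := by
  ext μ : 1
  rw [cutOp_apply]
  simp only [Pi.mul_apply, Pi.add_apply, basic, eeFam]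
  have h := cut_add (μ j) a
  have h1 : ∀ y, C (y / 16 * prodE l fun i => μ i) =
      C (y * prodE l fun i => μ i) * (C (1 / 16) : PowerSeries ℝ) := by
    intro y; rw [← map_mul]; congr 1; ring
  have h3 : C (3 * r * prodE l fun i => μ i) =
      3 * (C (r * prodE l fun i => μ i) : PowerSeries ℝ) := by
    rw [mul_assoc, map_mul]; congr 1
  rw [neg_mul, map_neg, neg_mul (r / 16), map_neg, h1, h1, h3, mul_left_comm (X ^ 2) (C _),
    cut_C_mul]
  linear_combination C (r * prodE l fun i => μ i) * h

theorem cutOp_basic_mem (j : ι) (d : ℤ) (r : ℝ) (a : ℤ) (l : {i // i ≠ j} → ℤ)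
    (h1 : max (2 * a + 1) 0 + oddWeight l ≤ d) (h2 : 2 * a + 1 + oddSum l = d → 0 ≤ r) :
    cutOp j (basic r a l) ∈ rCone ι (d + 3) := by
  have := oddSum_le l
  rw [cutOp_basic, mem_rCone]
  refine ⟨_, add_mem (eeFam_mem ?_ ?_) (add_mem (add_mem (eeFam_mem ?_ ?_)
    (eeFam_mem ?_ ?_)) (eeFam_mem ?_ ?_)), rfl⟩
  · omega
  · intro h; have := h2 (by omega); positivity
  all_goals omega

theorem cutOp_basic_mem_open (j : ι) (d : ℤ) (r : ℝ) (a : ℤ) (l : {i // i ≠ j} → ℤ)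
    (h1 : max (2 * a + 1) 0 + oddWeight l ≤ d) (h2 : 2 * a + 1 + oddSum l = d) (hr : 0 < r) :
    cutOp j (basic r a l) ∈ rOpenCone ι (d + 3) := by
  have := oddSum_le l
  rw [cutOp_basic]
  -- In top weight the sum equals the sum of positive parts, so 2 * a + 1 ≥ 0; this gives 0 < a + 2
  -- for the leading family.
  refine ⟨_, add_mem_openCone (eeFam_mem_open ?_ ?_ ?_ ?_) (add_mem (add_mem (eeFam_mem ?_ ?_)
    (eeFam_mem ?_ ?_)) (eeFam_mem ?_ ?_)), rfl⟩
  · omega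
  · omega
  · omega
  · positivity
  all_goals omega

/-- The operator of splitting the root in a connected way. -/
def dblOp : ((Option ι → ℕ) → PowerSeries ℝ) →+ ((ι → ℕ) → PowerSeries ℝ) where
  toFun G μ := X ^ 2 * .mk fun n => ∑ x ∈ antidiagonal n, coeff x.1 (G (cons x.2 μ))
  map_zero' := by
    ext μ : 1
    have : (.mk fun n => ∑ x ∈ antidiagonal n, (coeff x.1 (0 : PowerSeries ℝ)) : PowerSeries ℝ) =
        0 := by ext n; simp
    simp only [Pi.zero_apply, this, mul_zero]
  map_add' F G := by
    ext μ : 1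
    simp only [Pi.add_apply, ← mul_add]
    congr 1
    ext n
    simp only [map_add, coeff_mk, sum_add_distrib]

theorem dblOp_apply (G : (Option ι → ℕ) → PowerSeries ℝ) (μ : ι → ℕ) :
    dblOp G μ = X ^ 2 * .mk fun n => ∑ x ∈ antidiagonal n, coeff x.1 (G (cons x.2 μ)) := rfl

theorem dblOp_basic (r : ℝ) (a : ℤ) (l : Option ι → ℤ) :
    dblOp (basic r a l) = pairFam r a (l none) fun i => l (some i) := by
  ext μ : 1
  rw [dblOp_apply, pairFam]
  congr 1
  ext n
  rw [coeff_mk, coeff_C_mul, coeff_mul, mul_sum]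
  refine sum_congr rfl fun x _ => ?_
  rw [basic, coeff_C_mul, prodE, Fintype.prod_option]
  simp only [cons_none, cons_some, prodE, eCoeff]
  ring

theorem oddSum_option (l : Option ι → ℤ) :
    oddSum l = 2 * l none + 1 + oddSum fun i => l (some i) := Fintype.sum_option _

theorem oddWeight_option (l : Option ι → ℤ) :
    oddWeight l = max (2 * l none + 1) 0 + oddWeight fun i => l (some i) := Fintype.sum_option _

theorem dblOp_basic_mem (d : ℤ) (r : ℝ) (a : ℤ) (l : Option ι → ℤ)
    (h1 : max (2 * a + 1) 0 + oddWeight l ≤ d) (h2 : 2 * a + 1 + oddSum l = d → 0 ≤ r) :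
    dblOp (basic r a l) ∈ rCone ι (d + 3) := by
  rw [oddWeight_option] at h1
  rw [oddSum_option] at h2
  rw [dblOp_basic]
  exact pairFam_mem (by omega) fun h => h2 (by omega)

theorem dblOp_basic_mem_open (d : ℤ) (r : ℝ) (a : ℤ) (l : Option ι → ℤ)
    (h1 : max (2 * a + 1) 0 + oddWeight l ≤ d) (h2 : 2 * a + 1 + oddSum l = d) (hr : 0 < r) :
    dblOp (basic r a l) ∈ rOpenCone ι (d + 3) := by
  rw [oddWeight_option] at h1
  rw [oddSum_option] at h2
  rw [dblOp_basic]
  exact pairFam_mem_open (by omega) (by omega) hr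

/-- The product of families on complementary sets. -/
def splitOp (I : Finset ι) (F : ({i // i ∈ I} → ℕ) → PowerSeries ℝ) :
    (({i // i ∉ I} → ℕ) → PowerSeries ℝ) →+ ((ι → ℕ) → PowerSeries ℝ) where
  toFun G μ := X ^ 2 * (F (fun i => μ i) * G fun i => μ i)
  map_zero' := by ext μ : 1; simp
  map_add' G G' := by ext μ : 1; simp only [Pi.add_apply, mul_add]

/-- The operator `splitOp` as a function of the first family. -/
def splitOp' (I : Finset ι) (G : ({i // i ∉ I} → ℕ) → PowerSeries ℝ) :
    (({i // i ∈ I} → ℕ) → PowerSeries ℝ) →+ ((ι → ℕ) → PowerSeries ℝ) where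
  toFun F := splitOp I F G
  map_zero' := by ext μ : 1; simp [splitOp]
  map_add' G G' := by
    ext μ : 1
    simp only [splitOp, AddMonoidHom.coe_mk, ZeroHom.coe_mk, Pi.add_apply, add_mul, mul_add]

/-- The exponents on the union of complementary sets. -/
def glue (I : Finset ι) (l : {i // i ∈ I} → ℤ) (l' : {i // i ∉ I} → ℤ) (i : ι) : ℤ :=
  if h : i ∈ I then l ⟨i, h⟩ else l' ⟨i, h⟩

theorem glue_of_mem (I : Finset ι) (l : {i // i ∈ I} → ℤ) (l' : {i // i ∉ I} → ℤ) (i : {i // i ∈ I}) :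
    glue I l l' i = l i := dif_pos i.2

theorem glue_of_notMem (I : Finset ι) (l : {i // i ∈ I} → ℤ) (l' : {i // i ∉ I} → ℤ)
    (i : {i // i ∉ I}) : glue I l l' i = l' i := dif_neg i.2

theorem prod_mem_mul_prod_notMem {M : Type*} [CommMonoid M] (f : ι → M) (I : Finset ι) :
    (∏ i : {i // i ∈ I}, f i) * ∏ i : {i // i ∉ I}, f i = ∏ i, f i := by
  rw [← Fintype.prod_subtype_mul_prod_subtype (· ∈ I) f]
  congr!

theorem sum_mem_add_sum_notMem_int (f : ι → ℤ) (I : Finset ι) :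
    ∑ i : {i // i ∈ I}, f i + ∑ i : {i // i ∉ I}, f i = ∑ i, f i := by
  rw [← Fintype.sum_subtype_add_sum_subtype (· ∈ I) f]
  congr!

theorem splitOp_basic (I : Finset ι) (r r' : ℝ) (a a' : ℤ) (l : {i // i ∈ I} → ℤ)
    (l' : {i // i ∉ I} → ℤ) :
    splitOp I (basic r a l) (basic r' a' l') = pairFam (r * r') a a' (glue I l l') := by
  have h : ∀ μ : ι → ℕ, prodE (glue I l l') μ = prodE l (fun i => μ i) * prodE l' fun i => μ i := by
    intro μ
    simp only [prodE, ← prod_mem_mul_prod_notMem _ I, glue_of_mem, glue_of_notMem]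
  ext μ : 1
  change X ^ 2 * (basic r a l (fun i => μ i) * basic r' a' l' fun i => μ i) = _
  rw [pairFam, basic, basic, h, mul_mul_mul_comm r, map_mul C (r * _)]
  ring

theorem oddSum_glue (I : Finset ι) (l : {i // i ∈ I} → ℤ) (l' : {i // i ∉ I} → ℤ) :
    oddSum (glue I l l') = oddSum l + oddSum l' := by
  simp only [oddSum, ← sum_mem_add_sum_notMem_int _ I, glue_of_mem, glue_of_notMem]

theorem oddWeight_glue (I : Finset ι) (l : {i // i ∈ I} → ℤ) (l' : {i // i ∉ I} → ℤ) :
    oddWeight (glue I l l') = oddWeight l + oddWeight l' := by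
  simp only [oddWeight, ← sum_mem_add_sum_notMem_int _ I, glue_of_mem, glue_of_notMem]

/-- Splitting is biadditive, so both arguments may be taken basic. The product can be in top weight
only if both factors are, and then its coefficient is a product of nonnegative numbers. -/
theorem splitOp_mem (I : Finset ι) {d d' : ℤ} {F : ({i // i ∈ I} → ℕ) → PowerSeries ℝ}
    {G : ({i // i ∉ I} → ℕ) → PowerSeries ℝ} (hF : F ∈ cone _ d) (hG : G ∈ cone _ d') :
    splitOp I F G ∈ rCone ι (d + d' + 3) := by
  refine map_cone (splitOp' I G) (fun r a l h1 h2 => ?_) hF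
  refine map_cone (splitOp I (basic r a l)) (fun r' a' l' h1' h2' => ?_) hG
  rw [splitOp_basic]
  have := oddSum_le l
  have := oddSum_le l'
  refine pairFam_mem ?_ ?_
  · rw [oddWeight_glue]; omega
  · rw [oddSum_glue]
    intro h
    exact mul_nonneg (h2 (by omega)) (h2' (by omega))

end Cone
end BCMotzkin
end

noncomputable section
open PowerSeries Finset
namespace BCMotzkin

/-! ### The recursion in the stable range, and the induction -/

section Stable
variable {ι : Type} [Fintype ι] [DecidableEq ι]

theorem splitTerm_singleton (g : ℕ) (μ : ι → ℕ) (j : ι) :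
    splitTerm μ ({j}, (0, g)) = wTwo (μ j) * gf g fun i : {i // i ≠ j} => μ i := by
  rw [splitTerm]
  congr 1
  · let e : {i : ι // i ∈ ({j} : Finset ι)} ≃ Unit :=
      { toFun := fun _ => ()
        invFun := fun _ => ⟨j, mem_singleton_self j⟩
        left_inv := fun i => Subtype.ext (mem_singleton.1 i.2).symm
        right_inv := fun _ => rfl }
    rw [wTwo]
    exact gf_congr (ν := fun _ => μ j) e (fun i => congrArg μ (mem_singleton.1 i.2).symm) 0
  · let e : {i : ι // i ∉ ({j} : Finset ι)} ≃ {i // i ≠ j} :=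
      Equiv.subtypeEquivRight fun i => not_congr mem_singleton
    exact gf_congr (ν := fun i : {i // i ≠ j} => μ i) e (fun i => rfl) g

theorem splitTerm_compl_singleton (g : ℕ) (μ : ι → ℕ) (j : ι) :
    splitTerm μ ({j}ᶜ, (g, 0)) = wTwo (μ j) * gf g fun i : {i // i ≠ j} => μ i := by
  have hm : ∀ i, i ∉ ({j}ᶜ : Finset ι) ↔ i = j := fun i => by simp
  rw [splitTerm, mul_comm]
  congr 1
  · let e : {i : ι // i ∉ ({j}ᶜ : Finset ι)} ≃ Unit :=
      { toFun := fun _ => ()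
        invFun := fun _ => ⟨j, (hm j).2 rfl⟩
        left_inv := fun i => Subtype.ext ((hm i).1 i.2).symm
        right_inv := fun _ => rfl }
    rw [wTwo]
    exact gf_congr (ν := fun _ => μ j) e (fun i => congrArg μ ((hm i).1 i.2).symm) 0
  · let e : {i : ι // i ∈ ({j}ᶜ : Finset ι)} ≃ {i // i ≠ j} :=
      Equiv.subtypeEquivRight fun i => by simp
    exact gf_congr (ν := fun i : {i // i ≠ j} => μ i) e (fun i => rfl) g

/-- The splittings of the root into two stable gluings. -/
def stableSplits (ι : Type) [Fintype ι] [DecidableEq ι] (g : ℕ) :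
    Finset (Finset ι × (ℕ × ℕ)) :=
  (splits ι g).filter fun p => 2 ≤ 2 * p.2.1 + #p.1 ∧ 2 ≤ 2 * p.2.2 + #p.1ᶜ

/-- A component of genus a with |I| vertices besides its root is unstable when 2a + |I| ≤ 1. So it
is a sphere with one vertex, already removed, or with two vertices. -/
theorem filter_splits_eq (g : ℕ) (h : 3 ≤ 2 * g + Fintype.card ι) :
    (splits ι g).filter (fun p => p ≠ (∅, (0, g)) ∧ p ≠ (univ, (g, 0))) =
      (univ.image fun j => ({j}, (0, g))) ∪ (univ.image fun j => ({j}ᶜ, (g, 0))) ∪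
        stableSplits ι g := by
  ext ⟨I, a, b⟩
  have hI := card_compl_add_card I
  simp only [mem_filter, mem_splits, mem_union, mem_image, mem_univ, true_and, stableSplits,
    Prod.mk.injEq, ne_eq]
  have h0 : I = ∅ ↔ #I = 0 := card_eq_zero.symm
  have h0' : I = univ ↔ #Iᶜ = 0 := by rw [card_eq_zero, compl_eq_empty_iff]
  have h1 : (∃ j, {j} = I) ↔ #I = 1 := by rw [card_eq_one]; exact exists_congr fun j => eq_comm
  have h1' : (∃ j, {j}ᶜ = I) ↔ #Iᶜ = 1 := by
    rw [card_eq_one]; exact exists_congr fun j => by rw [eq_comm, eq_compl_comm, eq_comm]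
  simp only [exists_and_right, h0, h0', h1, h1']
  omega

/-- For each j the two-vertex sphere occurs as first and as second component. Both contributions
join the merging with j, which accounts for the factor 2 in `cutOp`. -/
theorem rSer_mul_gf_stable (g : ℕ) (h : 3 ≤ 2 * g + Fintype.card ι) :
    (fun μ : ι → ℕ => rSer * gf g μ) =
      ∑ j, cutOp j (gf g) + ((if 1 ≤ g then dblOp (gf (g - 1)) else 0) +
        ∑ p ∈ stableSplits ι g, splitOp p.1 (gf p.2.1) (gf p.2.2)) := by
  have hne : Nonempty ι ∨ g ≠ 0 := by
    rcases Nat.eq_zero_or_pos g with rfl | hg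
    · exact Or.inl (Fintype.card_pos_iff.1 (by omega))
    · exact Or.inr hg.ne'
  have hcat : ∀ μ : ι → ℕ, cat g (cons 0 μ) = 0 := by
    intro μ
    cases isEmpty_or_nonempty ι with
    | inl hi => rw [cat_cons_zero_of_isEmpty, if_neg (hne.resolve_left (not_nonempty_iff.2 hi))]
    | inr hi => exact cat_cons_zero_of_nonempty g μ
  ext μ : 1
  have hd1 : Disjoint (univ.image fun j : ι => (({j}, (0, g)) : Finset ι × (ℕ × ℕ)))
      (univ.image fun j => ({j}ᶜ, (g, 0))) := by
    rw [disjoint_left]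
    rintro ⟨I, a, b⟩ h1 h2
    simp only [mem_image, mem_univ, true_and, Prod.mk.injEq] at h1 h2
    obtain ⟨j, rfl, rfl, rfl⟩ := h1
    obtain ⟨k, h3, h4, -⟩ := h2
    have := card_compl_add_card ({k} : Finset ι)
    rw [h3, card_singleton, card_singleton] at this
    omega
  have hd2 : Disjoint ((univ.image fun j : ι => (({j}, (0, g)) : Finset ι × (ℕ × ℕ))) ∪
      (univ.image fun j => ({j}ᶜ, (g, 0)))) (stableSplits ι g) := by
    rw [disjoint_left]
    rintro ⟨I, a, b⟩ h1 h2
    simp only [mem_union, mem_image, mem_univ, true_and, Prod.mk.injEq, stableSplits,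
      mem_filter] at h1 h2
    rcases h1 with ⟨j, rfl, rfl, rfl⟩ | ⟨j, rfl, rfl, rfl⟩
    · have := h2.2.1
      rw [card_singleton] at this
      omega
    · have := h2.2.2
      rw [compl_compl, card_singleton] at this
      omega
  rw [rSer_mul_gf g μ hne, hcat, filter_splits_eq g h, sum_union hd2, sum_union hd1,
    sum_image (by rintro i - j - hij; simpa using hij),
    sum_image (by rintro i - j - hij; simpa using hij)]
  have hdbl : X ^ 2 * dbl g μ = (if 1 ≤ g then dblOp (gf (g - 1)) else 0 : _ → PowerSeries ℝ) μ := by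
    rw [dbl]
    split_ifs
    · rw [dblOp_apply]; simp only [coeff_gf]
    · rw [mul_zero]; rfl
  have hsplit : ∀ p : Finset ι × (ℕ × ℕ),
      splitOp p.1 (gf p.2.1) (gf p.2.2) μ = X ^ 2 * splitTerm μ p := fun p => rfl
  simp only [Pi.add_apply, Finset.sum_apply, cutOp_apply, sum_add_distrib, hsplit, ← hdbl,
    splitTerm_singleton, splitTerm_compl_singleton, Nat.cast_zero, map_zero, zero_add, ← mul_sum]
  ring

/-- The root is not counted in ι, so n + 1 is 2g - 2 + v. Every operator of the recursion raises the
weight by three: merging and connected splitting come from n - 1, and the two components of a stable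
splitting have indices with sum n - 2. -/
theorem gf_mem_openCone (n : ℕ) : ∀ (ι : Type) [Fintype ι] [DecidableEq ι] (g : ℕ),
    2 * g + Fintype.card ι = n + 2 → (gf g : (ι → ℕ) → PowerSeries ℝ) ∈ openCone ι (3 * (n + 1)) := by
  induction n using Nat.strong_induction_on with
  | _ n ih =>
    intro ι _ _ g hg
    rcases Nat.eq_zero_or_pos n with rfl | hn
    · rcases Nat.eq_zero_or_pos g with rfl | hg0
      · have hcard : Fintype.card ι = Fintype.card Bool := by rw [Fintype.card_bool]; omega
        let e : Bool ≃ ι := Fintype.equivOfCardEq hcard.symm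
        have hp : ∀ (k : ℤ) (μ : ι → ℕ), prodE (fun _ => k) μ =
            eCoeff k (μ (e true)) * eCoeff k (μ (e false)) := by
          intro k μ
          rw [prodE, ← e.prod_comp, Fintype.prod_bool]
        have hs : ∀ k : ℤ, oddSum (fun _ : ι => k) = 2 * (2 * k + 1) := by
          intro k
          rw [oddSum, ← e.sum_comp, Fintype.sum_bool]; ring
        have hw : ∀ k : ℤ, oddWeight (fun _ : ι => k) = 2 * max (2 * k + 1) 0 := by
          intro k
          rw [oddWeight, ← e.sum_comp, Fintype.sum_bool]; ring
        -- The product of three e_0 has weight 3, that of three e_(-1) has weight 0, so the minus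
        -- sign of the latter is harmless.
        refine ⟨1 / 16, 0, fun _ => 0, ?_, ?_, by norm_num, basic (-(1 / 16)) (-1) (fun _ => -1),
          basic_mem_cone ?_ ?_, ?_⟩
        · rw [hw]; norm_num
        · rw [hs]; norm_num
        · rw [hw]; norm_num
        · rw [hs]; norm_num
        · ext μ : 1
          have h1 : gf 0 μ = wThree (μ (e true)) (μ (e false)) := by
            rw [wThree]
            refine (gf_congr e (fun b => ?_) 0).symm
            cases b <;> rfl
          rw [h1, wThree_eq, Pi.add_apply, basic, basic, hp, hp, neg_mul, map_neg, map_mul C (1 / 16),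
            map_mul C (1 / 16)]
          ring
      · have h1 : g = 1 := by omega
        have h2 : Fintype.card ι = 0 := by omega
        subst h1
        have : IsEmpty ι := Fintype.card_eq_zero_iff.1 h2
        have hw : ∀ l : ι → ℤ, oddWeight l = 0 := fun l => by simp [oddWeight]
        have hs : ∀ l : ι → ℤ, oddSum l = 0 := fun l => by simp [oddSum]
        -- e_1 alone has the top weight 3.
        refine ⟨1 / 128, 1, isEmptyElim, ?_, ?_, by norm_num,
          basic (-(3 / 128)) 0 isEmptyElim + (basic (3 / 128) (-1) isEmptyElim +
            basic (-(1 / 128)) (-2) isEmptyElim),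
          add_mem (basic_mem_cone ?_ ?_) (add_mem (basic_mem_cone ?_ ?_) (basic_mem_cone ?_ ?_)), ?_⟩
        any_goals rw [hw]; norm_num
        any_goals rw [hs]; norm_num
        ext μ : 1
        have hp : ∀ l : ι → ℤ, prodE l μ = 1 := fun l => by simp [prodE]
        simp only [gf_one_of_isEmpty, Pi.add_apply, basic, hp, mul_one, map_neg]
        have h3 : (C (3 / 128) : PowerSeries ℝ) = 3 * C (1 / 128) := by
          rw [← map_ofNat (C : ℝ →+* PowerSeries ℝ) 3, ← map_mul]; norm_num
        rw [h3]
        ring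
    · refine mem_openCone_of_mul ?_
      rw [rSer_mul_gf_stable g (by omega)]
      have hcut : ∀ j : ι, cutOp j (gf g) ∈ rOpenCone ι (3 * (n + 1)) := by
        intro j
        have hc := card_subtype_ne j
        have h1 := ih (n - 1) (by omega) {i // i ≠ j} g (by omega)
        have h2 := map_openCone (cutOp j) (cutOp_basic_mem j _) (cutOp_basic_mem_open j _) h1
        rwa [show 3 * ((n : ℤ) + 1) = 3 * (((n - 1 : ℕ) : ℤ) + 1) + 3 by omega]
      have hdbl : 1 ≤ g → dblOp (gf (g - 1)) ∈ rOpenCone ι (3 * (n + 1)) := by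
        intro hg1
        have h1 := ih (n - 1) (by omega) (Option ι) (g - 1) (by rw [Fintype.card_option]; omega)
        have h2 := map_openCone dblOp (dblOp_basic_mem _) (dblOp_basic_mem_open _) h1
        rwa [show 3 * ((n : ℤ) + 1) = 3 * (((n - 1 : ℕ) : ℤ) + 1) + 3 by omega]
      have hsub : ∀ F, F ∈ rOpenCone ι (3 * (n + 1)) → F ∈ rCone ι (3 * (n + 1)) := by
        rintro _ ⟨G, hG, rfl⟩
        exact mem_rCone.2 ⟨G, openCone_subset hG, rfl⟩
      have hsplit : ∀ p ∈ stableSplits ι g,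
          splitOp p.1 (gf p.2.1) (gf p.2.2) ∈ rCone ι (3 * (n + 1)) := by
        rintro ⟨I, a, b⟩ hp
        simp only [stableSplits, mem_filter, mem_splits] at hp
        obtain ⟨hab, h1, h2⟩ := hp
        have hI := card_mem_add_card_notMem I
        have hI' : Fintype.card {i // i ∈ I} = #I := Fintype.card_coe I
        have hI'' := card_compl_add_card I
        have k1 := ih (2 * a + #I - 2) (by omega) {i // i ∈ I} a (by omega)
        have k2 := ih (2 * b + #Iᶜ - 2) (by omega) {i // i ∉ I} b (by omega)
        have k3 := splitOp_mem I (openCone_subset k1) (openCone_subset k2)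
        rwa [show 3 * ((n : ℤ) + 1) = 3 * (((2 * a + #I - 2 : ℕ) : ℤ) + 1) +
          3 * (((2 * b + #Iᶜ - 2 : ℕ) : ℤ) + 1) + 3 by omega]
      have hsum := sum_mem hsplit
      cases isEmpty_or_nonempty ι with
      | inl hi =>
        have : 1 ≤ g := by rw [Fintype.card_eq_zero] at hg; omega
        rw [univ_eq_empty, sum_empty, zero_add, if_pos this]
        exact add_mem_rOpenCone (hdbl this) hsum
      | inr hi =>
        -- One term in the open cone suffices, the others being in the cone: a merging if there is
        -- another vertex, and otherwise the connected splitting, where necessarily g ≥ 1.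
        obtain ⟨j⟩ := hi
        rw [← add_sum_erase _ _ (mem_univ j), add_assoc]
        refine add_mem_rOpenCone (hcut j) (add_mem (sum_mem fun i _ => hsub _ (hcut i))
          (add_mem ?_ hsum))
        split_ifs with h1
        · exact hsub _ (hdbl h1)
        · exact zero_mem _

end Stable
end BCMotzkin
end

noncomputable section
open PowerSeries Finset
namespace BCMotzkin

/-! ### Expansion of the generalized Catalan numbers -/

section Expansion

/-- Taking a coefficient of the series puts the root on the same footing as the other vertices: its
exponent becomes the coordinate 0. -/
theorem cone_coeff {w : ℕ} {d : ℤ} {F : (Fin w → ℕ) → PowerSeries ℝ} (hF : F ∈ cone (Fin w) d) :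
    ∃ L : List (ℝ × (Fin (w + 1) → ℤ)),
      (∀ μ : Fin (w + 1) → ℕ, coeff (μ 0) (F (Fin.tail μ)) = (L.map fun x => x.1 * prodE x.2 μ).sum) ∧
      ∀ x ∈ L, oddWeight x.2 ≤ d ∧ (oddSum x.2 = d → 0 ≤ x.1) := by
  induction hF using AddSubmonoid.closure_induction with
  | mem F hF =>
    obtain ⟨r, a, l, h1, h2, rfl⟩ := hF
    refine ⟨[(r, Fin.cons a l)], fun μ => ?_, ?_⟩
    · simp only [List.map_cons, List.map_nil, List.sum_cons, List.sum_nil, add_zero, basic,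
        coeff_C_mul, prodE, Fin.prod_univ_succ, Fin.cons_zero, Fin.cons_succ, eCoeff, Fin.tail]
      ring
    · simp only [List.mem_singleton, forall_eq, oddWeight, oddSum, Fin.sum_univ_succ, Fin.cons_zero,
        Fin.cons_succ]
      exact ⟨h1, h2⟩
  | zero => exact ⟨[], fun μ => by simp, by simp⟩
  | add F G _ _ ihF ihG =>
    obtain ⟨L, h1, h2⟩ := ihF
    obtain ⟨L', h1', h2'⟩ := ihG
    refine ⟨L ++ L', fun μ => ?_, fun x hx => ?_⟩
    · rw [Pi.add_apply, map_add, h1, h1', List.map_append, List.sum_append]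
    · exact (List.mem_append.1 hx).elim (h2 x) (h2' x)

/-- The generalized Catalan numbers are combinations of products of coefficients of basic series. -/
theorem exists_expansion (g v : ℕ) (hv : 1 ≤ v) (hgv : 0 < 2 * (g : ℤ) - 2 + v) :
    ∃ L : List (ℝ × (Fin v → ℤ)),
      (∀ μ : Fin v → ℕ, (genCatalan g μ : ℝ) = (L.map fun x => x.1 * prodE x.2 μ).sum) ∧
      (∀ x ∈ L, oddWeight x.2 ≤ 3 * (2 * (g : ℤ) - 2 + v) ∧
        (oddSum x.2 = 3 * (2 * (g : ℤ) - 2 + v) → 0 ≤ x.1)) ∧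
      ∃ x ∈ L, oddSum x.2 = 3 * (2 * (g : ℤ) - 2 + v) ∧ 0 < x.1 := by
  obtain ⟨w, rfl⟩ : ∃ w, v = w + 1 := ⟨v - 1, by omega⟩
  obtain ⟨r, a, l, h1, h2, h3, G, hG, h⟩ := gf_mem_openCone (2 * g + w - 2) (Fin w) g
    (by rw [Fintype.card_fin]; omega)
  have hd : 3 * (((2 * g + w - 2 : ℕ) : ℤ) + 1) = 3 * (2 * (g : ℤ) - 2 + ((w + 1 : ℕ) : ℤ)) := by
    omega
  rw [hd] at h1 h2 hG
  obtain ⟨L, hL, hL'⟩ := cone_coeff hG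
  have hs : oddSum (Fin.cons a l : Fin (w + 1) → ℤ) = 2 * a + 1 + oddSum l := by
    simp only [oddSum, Fin.sum_univ_succ, Fin.cons_zero, Fin.cons_succ]
  have hw : oddWeight (Fin.cons a l : Fin (w + 1) → ℤ) = max (2 * a + 1) 0 + oddWeight l := by
    simp only [oddWeight, Fin.sum_univ_succ, Fin.cons_zero, Fin.cons_succ]
  refine ⟨(r, Fin.cons a l) :: L, fun μ => ?_, fun x hx => ?_, (r, Fin.cons a l),
    List.mem_cons_self, hs.trans h2, h3⟩
  · rw [List.map_cons, List.sum_cons, ← hL, genCatalan_eq_cat hv,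
      cat_congr (finSuccEquiv w) (d' := cons (μ 0) (Fin.tail μ)) (fun i => by
        refine Fin.cases ?_ (fun i => ?_) i
        · rfl
        · rw [finSuccEquiv_succ]; rfl), ← coeff_gf, h, Pi.add_apply, map_add]
    congr 1
    simp only [basic, coeff_C_mul, prodE, Fin.prod_univ_succ, Fin.cons_zero, Fin.cons_succ, eCoeff,
      Fin.tail]
    ring
  · rcases List.mem_cons.1 hx with rfl | hx
    · exact ⟨hw.trans_le h1, fun _ => h3.le⟩
    · exact hL' x hx

end Expansion

/-! ### Convergence in the disc of radius 1/2 and the value of u -/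

section Convergence

/-- Absolute convergence of a power series on the closed disc of radius `ρ`. -/
def PAbs (ρ : ℝ) (f : PowerSeries ℝ) : Prop := Summable fun m => |coeff m f| * ρ ^ m

/-- The sum of a power series at a complex number. -/
def ev (f : PowerSeries ℝ) (z : ℂ) : ℂ := ∑' m, ((coeff m f : ℝ) : ℂ) * z ^ m

theorem PAbs.summable_norm {f : PowerSeries ℝ} {z : ℂ} (h : PAbs ‖z‖ f) :
    Summable fun m => ‖((coeff m f : ℝ) : ℂ) * z ^ m‖ := by
  simpa [PAbs, norm_mul, norm_pow] using h

theorem coeff_mul_pow (f g : PowerSeries ℝ) (z : ℂ) (n : ℕ) : ((coeff n (f * g) : ℝ) : ℂ) * z ^ n =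
    ∑ x ∈ antidiagonal n, (((coeff x.1 f : ℝ) : ℂ) * z ^ x.1) * (((coeff x.2 g : ℝ) : ℂ) * z ^ x.2) := by
  rw [coeff_mul, Complex.ofReal_sum, sum_mul]
  refine sum_congr rfl fun x hx => ?_
  rw [← HasAntidiagonal.mem_antidiagonal.1 hx, Complex.ofReal_mul, pow_add]
  ring

theorem PAbs.mul {ρ : ℝ} (hρ : 0 ≤ ρ) {f g : PowerSeries ℝ} (hf : PAbs ρ f) (hg : PAbs ρ g) :
    PAbs ρ (f * g) := by
  have hn : ‖(ρ : ℂ)‖ = ρ := by rw [Complex.norm_real, Real.norm_of_nonneg hρ]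
  have h := summable_norm_sum_mul_antidiagonal_of_summable_norm
    (PAbs.summable_norm (hn.symm ▸ hf)) (PAbs.summable_norm (hn.symm ▸ hg))
  simp only [← coeff_mul_pow] at h
  simpa [PAbs, norm_mul, norm_pow, abs_of_nonneg hρ] using h

theorem ev_mul {z : ℂ} {f g : PowerSeries ℝ} (hf : PAbs ‖z‖ f) (hg : PAbs ‖z‖ g) :
    ev (f * g) z = ev f z * ev g z := by
  rw [ev, ev, ev, tsum_mul_tsum_eq_tsum_sum_antidiagonal_of_summable_norm hf.summable_norm
    hg.summable_norm]
  exact tsum_congr fun n => coeff_mul_pow f g z n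

theorem coeff_cSer_nonneg (m : ℕ) : 0 ≤ coeff m cSer := by
  rw [cSer, coeff_gf]; positivity

/-- At X = 1/2 the Catalan equation gives S_(N+2) ≤ 1 + S_N²/4 for the partial sums, and 2 is the
fixed point of s ↦ 1 + s²/4. -/
theorem sum_cSer_le (N : ℕ) : ∑ m ∈ range N, coeff m cSer * (1 / 2) ^ m ≤ 2 := by
  induction N using Nat.strong_induction_on with
  | _ N ih =>
    rcases N with _ | _ | N
    · simp
    · have h := congrArg (coeff 0) cSer_eq
      simp at h
      simp [h]
    · have hc : ∀ m, coeff (m + 2) cSer = ∑ x ∈ antidiagonal m, coeff x.1 cSer * coeff x.2 cSer := by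
        intro m
        conv_lhs => rw [cSer_eq]
        rw [map_add, coeff_one, if_neg (by omega), zero_add, coeff_X_pow_mul, coeff_mul]
      have h0 : coeff 0 cSer = 1 := by
        conv_lhs => rw [cSer_eq]
        simp
      have h1 : coeff 1 cSer = 0 := by
        conv_lhs => rw [cSer_eq]
        rw [map_add, coeff_one, coeff_X_pow_mul']
        simp
      have hS := ih N (by omega)
      have hS0 : 0 ≤ ∑ m ∈ range N, coeff m cSer * (1 / 2) ^ m :=
        sum_nonneg fun m _ => mul_nonneg (coeff_cSer_nonneg m) (by positivity)
      have h2 : ∑ m ∈ range N, coeff (m + 2) cSer * (1 / 2) ^ (m + 2) ≤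
          1 / 4 * ((∑ m ∈ range N, coeff m cSer * (1 / 2) ^ m) *
            ∑ m ∈ range N, coeff m cSer * (1 / 2) ^ m) := by
        rw [sum_mul_sum, ← sum_product', mul_sum]
        have e : ∀ m, coeff (m + 2) cSer * (1 / 2) ^ (m + 2) = ∑ x ∈ antidiagonal m,
            1 / 4 * (coeff x.1 cSer * (1 / 2) ^ x.1 * (coeff x.2 cSer * (1 / 2) ^ x.2)) := by
          intro m
          rw [hc, sum_mul]
          refine sum_congr rfl fun x hx => ?_
          rw [← HasAntidiagonal.mem_antidiagonal.1 hx]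
          ring
        simp only [e]
        have ha : ∀ m ∈ range N, antidiagonal m =
            (range N ×ˢ range N).filter (fun x => x.1 + x.2 = m) := by
          intro m hm
          ext x
          rw [mem_range] at hm
          simp only [HasAntidiagonal.mem_antidiagonal, mem_filter, mem_product, mem_range]
          omega
        rw [sum_congr rfl fun m hm => by rw [ha m hm]]
        refine sum_fiberwise_le_sum_of_sum_fiber_nonneg fun m _ => sum_nonneg fun x _ => ?_
        have := coeff_cSer_nonneg x.1
        have := coeff_cSer_nonneg x.2
        positivity
      rw [sum_range_succ', sum_range_succ']
      simp only [h0, h1, zero_add]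
      norm_num at h2 ⊢
      nlinarith

theorem pAbs_cSer : PAbs (1 / 2) cSer := by
  refine summable_of_sum_range_le (c := 2) (fun m => by positivity) fun N => ?_
  simpa only [abs_of_nonneg (coeff_cSer_nonneg _)] using sum_cSer_le N

theorem PAbs.mono {ρ σ : ℝ} (hρ : 0 ≤ ρ) (h : ρ ≤ σ) {f : PowerSeries ℝ} (hf : PAbs σ f) :
    PAbs ρ f :=
  Summable.of_nonneg_of_le (fun m => by positivity) (fun m => by gcongr) hf

theorem pAbs_of_eventually_zero {ρ : ℝ} {f : PowerSeries ℝ} (N : ℕ) (h : ∀ m, N ≤ m → coeff m f = 0) :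
    PAbs ρ f :=
  summable_of_ne_finset_zero (s := range N) fun m hm => by
    rw [mem_range, not_lt] at hm
    rw [h m hm, abs_zero, zero_mul]

theorem PAbs.sub {ρ : ℝ} (hρ : 0 ≤ ρ) {f g : PowerSeries ℝ} (hf : PAbs ρ f) (hg : PAbs ρ g) :
    PAbs ρ (f - g) := by
  refine Summable.of_nonneg_of_le (fun m => by positivity) (fun m => ?_) (Summable.add hf hg)
  rw [map_sub, ← add_mul]
  gcongr
  exact abs_sub _ _

theorem pAbs_geom {ρ a : ℝ} (hρ : 0 ≤ ρ) (ha : |a| * ρ < 1) : PAbs ρ (geom a) := by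
  have := summable_geometric_of_lt_one (mul_nonneg (abs_nonneg a) hρ) ha
  simpa only [PAbs, geom, coeff_mk, abs_pow, ← mul_pow] using this

theorem pAbs_uPow {ρ : ℝ} (hρ : 0 ≤ ρ) (h : ρ < 1 / 2) (n : ℤ) : PAbs ρ (uPow n) := by
  have h1 : PAbs ρ (1 : PowerSeries ℝ) := pAbs_of_eventually_zero 1 fun m hm => by
    rw [coeff_one, if_neg (by omega)]
  have hX : PAbs ρ (2 * X ^ 2 : PowerSeries ℝ) := pAbs_of_eventually_zero 3 fun m hm => by
    rw [← map_ofNat (C : ℝ →+* PowerSeries ℝ) 2, coeff_C_mul, coeff_X_pow, if_neg (by omega),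
      mul_zero]
  have hr : PAbs ρ rSer := h1.sub hρ (hX.mul hρ (pAbs_cSer.mono hρ h.le))
  have hu : PAbs ρ (uPow 1) := by
    rw [uPow_one]
    exact hr.mul hρ (pAbs_geom hρ (by rw [abs_of_pos two_pos]; linarith))
  have hu' : PAbs ρ (uPow (-1)) := by
    rw [uPow_neg_one]
    exact hr.mul hρ (pAbs_geom hρ (by rw [abs_neg, abs_of_pos two_pos]; linarith))
  induction n using Int.induction_on with
  | zero => rw [uPow_zero]; exact h1
  | succ n ih => rw [uPow_add]; exact ih.mul hρ hu
  | pred n ih => rw [sub_eq_add_neg, uPow_add]; exact ih.mul hρ hu'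

theorem ev_one (z : ℂ) : ev 1 z = 1 := by
  rw [ev, tsum_eq_single 0]
  · simp
  · intro m hm; simp [coeff_one, hm]

theorem ev_uPow {z : ℂ} (h : ‖z‖ < 1 / 2) (n : ℤ) : ev (uPow n) z = ev (uPow 1) z ^ n := by
  have hp := pAbs_uPow (norm_nonneg z) h
  have hm : ∀ m n, ev (uPow (m + n)) z = ev (uPow m) z * ev (uPow n) z := fun m n => by
    rw [uPow_add, ev_mul (hp m) (hp n)]
  have h0 : ev (uPow 0) z = 1 := by rw [uPow_zero, ev_one]
  have hne : ev (uPow 1) z ≠ 0 := by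
    have := hm 1 (-1)
    rw [add_neg_cancel, h0] at this
    exact left_ne_zero_of_mul_eq_one this.symm
  induction n using Int.induction_on with
  | zero => rw [h0, zpow_zero]
  | succ n ih => rw [hm, ih, zpow_add_one₀ hne]
  | pred n ih =>
    have := hm (-(n : ℤ) - 1) 1
    rw [sub_add_cancel, ih] at this
    rw [zpow_sub_one₀ hne, this, mul_assoc, mul_inv_cancel₀ hne, mul_one]

theorem ev_uPow_one_sq {z : ℂ} (h : ‖z‖ < 1 / 2) :
    ev (uPow 1) z ^ 2 * (1 - 2 * z) = 1 + 2 * z := by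
  have hp := pAbs_uPow (norm_nonneg z) h 1
  have hlin : ∀ a : ℝ, PAbs ‖z‖ (1 + C a * X : PowerSeries ℝ) ∧
      ev (1 + C a * X) z = 1 + a * z := by
    intro a
    have hc : ∀ m, 2 ≤ m → coeff m (1 + C a * X : PowerSeries ℝ) = 0 := fun m hm => by
      rw [map_add, coeff_one, coeff_C_mul, coeff_X, if_neg (by omega), if_neg (by omega)]; simp
    refine ⟨pAbs_of_eventually_zero 2 hc, ?_⟩
    rw [ev, tsum_eq_sum (s := range 2)]
    · simp [sum_range_succ, coeff_one, coeff_X]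
    · intro m hm
      rw [mem_range, not_lt] at hm
      rw [hc m hm]; simp
  have e : uPow 1 * uPow 1 * (1 + C (-2) * X) = 1 + C 2 * X := by
    have h2 : (C 2 : PowerSeries ℝ) = 2 := map_ofNat _ 2
    rw [map_neg, h2, ← uPow_one_sq]; ring
  have h1 := congrArg (fun f => ev f z) e
  rw [ev_mul (hp.mul (norm_nonneg z) hp) (hlin _).1, ev_mul hp hp, (hlin _).2, (hlin _).2] at h1
  push_cast at h1
  linear_combination h1

/-- If u were iq with q real, then 1 + q² = 2‖z‖ |q² - 1|, which is impossible for 2‖z‖ < 1. -/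
theorem ev_uPow_one_re_ne_zero {z : ℂ} (h : ‖z‖ < 1 / 2) : (ev (uPow 1) z).re ≠ 0 := by
  intro h0
  have h1 := ev_uPow_one_sq h
  set q := (ev (uPow 1) z).im with hq
  have h2 : ev (uPow 1) z ^ 2 = -(q ^ 2 : ℝ) := by
    rw [← Complex.re_add_im (ev (uPow 1) z), h0, ← hq]
    push_cast
    rw [zero_add, mul_pow, Complex.I_sq]
    ring
  rw [h2] at h1
  have h3 : ((1 + q ^ 2 : ℝ) : ℂ) = 2 * z * ((q ^ 2 - 1 : ℝ) : ℂ) := by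
    push_cast at h1 ⊢
    linear_combination -h1
  have h4 := congrArg norm h3
  rw [norm_mul, norm_mul, Complex.norm_real, Complex.norm_real, Real.norm_of_nonneg (by positivity),
    Complex.norm_ofNat, Real.norm_eq_abs] at h4
  have h5 : |q ^ 2 - 1| ≤ 1 + q ^ 2 := abs_le.2 ⟨by nlinarith [sq_nonneg q], by linarith⟩
  nlinarith [abs_nonneg (q ^ 2 - 1), norm_nonneg z, sq_nonneg q]

/-- The real part of u is continuous on the segment from 0 to z, does not vanish there, and is 1 at
0. This selects the branch of the square root. -/
theorem ev_uPow_one_re_pos {z : ℂ} (h : ‖z‖ < 1 / 2) : 0 < (ev (uPow 1) z).re := by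
  have hn : ∀ s ∈ Set.Icc (0 : ℝ) 1, ‖(s : ℂ) * z‖ ≤ ‖z‖ := by
    intro s hs
    rw [norm_mul, Complex.norm_real, Real.norm_of_nonneg hs.1]
    exact mul_le_of_le_one_left (norm_nonneg z) hs.2
  have hc : ContinuousOn (fun s : ℝ => (ev (uPow 1) (s * z)).re) (Set.Icc 0 1) := by
    refine Complex.continuous_re.comp_continuousOn ?_
    refine continuousOn_tsum (u := fun m => |coeff m (uPow 1)| * ‖z‖ ^ m) (fun m => by fun_prop)
      (pAbs_uPow (norm_nonneg z) h 1) fun m s hs => ?_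
    rw [norm_mul, norm_pow, Complex.norm_real, Real.norm_eq_abs]
    gcongr
    exact hn s hs
  have h0 : ev (uPow 1) ((0 : ℝ) * z) = 1 := by
    rw [ev, tsum_eq_single 0]
    · have := constantCoeff_uPow 1
      rw [← coeff_zero_eq_constantCoeff_apply] at this
      simp [this]
    · intro m hm; simp [hm]
  by_contra hlt
  rw [not_lt] at hlt
  have := intermediate_value_Icc' zero_le_one hc
  obtain ⟨s, hs, hs0⟩ := this (show (0 : ℝ) ∈ _ from ⟨by simpa using hlt, by rw [h0]; simp⟩)
  exact ev_uPow_one_re_ne_zero ((hn s hs).trans_lt h) hs0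

theorem ev_uPow_one_eq {z t : ℂ} (ht : 0 < t.re) (hz : ‖z‖ < 1 / 2)
    (h : 2 * z * (t ^ 2 + 1) = t ^ 2 - 1) : ev (uPow 1) z = t := by
  have h1 := ev_uPow_one_sq hz
  have h2 := ev_uPow_one_re_pos hz
  have hne : 1 - 2 * z ≠ 0 := by
    intro h0
    have : z = 1 / 2 := by linear_combination -h0 / 2
    rw [this] at hz
    norm_num at hz
  have h3 : ev (uPow 1) z ^ 2 = t ^ 2 := by
    refine mul_right_cancel₀ hne ?_
    linear_combination h1 + h
  rcases sq_eq_sq_iff_eq_or_eq_neg.1 h3 with h4 | h4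
  · exact h4
  · rw [h4, Complex.neg_re] at h2
    linarith

end Convergence
end BCMotzkin
end

noncomputable section
open PowerSeries Finset
namespace BCMotzkin

/-! ### Summation of the Laplace transform, one variable at a time -/

section Laplace

theorem hasSum_congr {α β : Type*} [AddCommMonoid β] [TopologicalSpace β] {f f' : α → β} {s s' : β}
    (h : HasSum f s) (hf : ∀ x, f' x = f x) (hs : s' = s) : HasSum f' s' := by
  rw [hs, funext hf]
  exact h

theorem hasSum_antidiagonal {F : ℕ × ℕ → ℂ} {s : ℂ} (hF : Summable fun p => ‖F p‖)
    (h : HasSum F s) : HasSum (fun n => ∑ x ∈ antidiagonal n, F x) s ∧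
      Summable fun n => ‖∑ x ∈ antidiagonal n, F x‖ := by
  have e : ∀ {α : Type} [AddCommMonoid α] (f : ℕ × ℕ → α) (n : ℕ),
      ∑ x ∈ antidiagonal n, f x = ∑ x : antidiagonal n, f x := fun f n => (sum_coe_sort _ f).symm
  have h1 := (HasAntidiagonal.sigmaAntidiagonalEquivProd (A := ℕ)).hasSum_iff.2 h
  have h2 := ((HasAntidiagonal.sigmaAntidiagonalEquivProd (A := ℕ)).hasSum_iff.2 hF.hasSum)
  constructor
  · refine h1.sigma fun n => ?_
    rw [e]
    exact hasSum_fintype _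
  · refine Summable.of_nonneg_of_le (fun n => norm_nonneg _) (fun n => norm_sum_le _ _)
      (h2.sigma (g := fun n => ∑ x ∈ antidiagonal n, ‖F x‖) fun n => ?_).summable
    rw [e]
    exact hasSum_fintype _

/-- The one-variable factor of the Laplace transform of the product of basic coefficients. -/
def factor (b c : ℝ) (k : ℤ) (x : ℂ) (n : ℕ) : ℂ :=
  ((∑ m ∈ range (n + 1), (n.choose m : ℝ) * eCoeff k m * b ^ (n - m) * c ^ m : ℝ) : ℂ) / n *
    x ^ (-(n : ℤ))

/-- The terms of the double series for the sum of `factor`. -/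
def factorTerm (b c : ℝ) (k : ℤ) (x : ℂ) (p : ℕ × ℕ) : ℂ :=
  ((coeff (p.1 + 1) (uPow (2 * k + 1)) : ℝ) : ℂ) / (2 * k + 1) * (c / x) ^ (p.1 + 1) *
    (((p.2 + p.1).choose p.1 : ℂ) * (b / x) ^ p.2)

theorem two_mul_add_one_ne_zero (R : Type*) [Ring R] [CharZero R] (k : ℤ) :
    (2 * k + 1 : R) ≠ 0 := by
  norm_cast
  omega

/-- Uses `eCoeff_mul` and (m + 1) binom(N + 1, m + 1) = (N + 1) binom(N, m). The term m = 0 is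
absent because e_k has no constant term, so everything is shifted by one. -/
theorem factor_succ (b c : ℝ) (k : ℤ) (x : ℂ) (N : ℕ) :
    factor b c k x (N + 1) = ∑ p ∈ antidiagonal N, factorTerm b c k x p := by
  rw [factor, sum_range_succ', eCoeff_zero, mul_zero, zero_mul, zero_mul, add_zero,
    Nat.sum_antidiagonal_eq_sum_range_succ_mk, Complex.ofReal_sum, sum_div, sum_mul]
  refine sum_congr rfl fun m hm => ?_
  rw [mem_range] at hm
  have hk := two_mul_add_one_ne_zero ℂ k
  have h1 : ((2 * k + 1 : ℂ)) * (eCoeff k (m + 1) : ℂ) =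
      (m + 1 : ℂ) * ((coeff (m + 1) (uPow (2 * k + 1)) : ℝ) : ℂ) := by
    have := eCoeff_mul k (m + 1)
    have := congrArg (fun r : ℝ => (r : ℂ)) this
    push_cast at this
    exact this
  have h2 : ((N + 1 : ℕ) : ℂ) * (N.choose m : ℂ) = ((N + 1).choose (m + 1) : ℂ) * (m + 1) := by
    exact_mod_cast Nat.add_one_mul_choose_eq N m
  have h3 : N - m + m = N := by omega
  have hN : ((N + 1 : ℕ) : ℂ) ≠ 0 := Nat.cast_ne_zero.2 (Nat.succ_ne_zero N)
  have h4 : x ^ (-((N + 1 : ℕ) : ℤ)) = (x ^ (m + 1))⁻¹ * (x ^ (N - m))⁻¹ := by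
    rw [zpow_neg, zpow_natCast, ← mul_inv, ← pow_add, show m + 1 + (N - m) = N + 1 by omega]
  simp only [factorTerm]
  rw [h3, h4, show N + 1 - (m + 1) = N - m by omega, div_pow, div_pow,
    div_eq_mul_inv (_ ^ _) (x ^ (m + 1)), div_eq_mul_inv (_ ^ _) (x ^ (N - m))]
  generalize (x ^ (m + 1))⁻¹ = y
  generalize (x ^ (N - m))⁻¹ = y'
  push_cast
  have h5 : (eCoeff k (m + 1) : ℂ) = (m + 1 : ℂ) * ((coeff (m + 1) (uPow (2 * k + 1)) : ℝ) : ℂ) /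
      (2 * k + 1) := by rw [eq_div_iff hk, mul_comm, h1]
  push_cast at h2 hN
  rw [h5]
  field_simp
  linear_combination -((coeff (m + 1) (uPow (2 * k + 1)) : ℝ) : ℂ) * (b : ℂ) ^ (N - m) *
    (c : ℂ) ^ (m + 1) * y * y' * h2

theorem norm_div_sub_lt {b c : ℝ} (hb : 0 ≤ b) (hc : 0 < c) {x : ℂ} (hx : b + 2 * c < ‖x‖) :
    ‖(c : ℂ) / (x - b)‖ < 1 / 2 := by
  have h1 : 2 * c < ‖x - b‖ := by
    have := norm_sub_norm_le x b
    rw [Complex.norm_real, Real.norm_of_nonneg hb] at this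
    linarith
  rw [norm_div, Complex.norm_real, Real.norm_of_nonneg hc.le, div_lt_iff₀ (by linarith)]
  linarith

/-- For fixed m the inner sum is the negative binomial series, which turns (c/x)^(m+1) into (c/(x -
b))^(m+1). The outer sum is then u^(2k+1) without its constant term 1. -/
theorem hasSum_factorTerm {b c : ℝ} (hb : 0 ≤ b) (hc : 0 < c) (k : ℤ) {x : ℂ}
    (hx : b + 2 * c < ‖x‖) : (Summable fun p => ‖factorTerm b c k x p‖) ∧
      HasSum (factorTerm b c k x) ((ev (uPow (2 * k + 1)) (c / (x - b)) - 1) / (2 * k + 1)) := by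
  have hx0 : 0 < ‖x‖ := by linarith
  have hx1 : x ≠ 0 := norm_pos_iff.1 hx0
  have hk := two_mul_add_one_ne_zero ℂ k
  have hbx : ‖(b : ℂ) / x‖ < 1 := by
    rw [norm_div, Complex.norm_real, Real.norm_of_nonneg hb, div_lt_one hx0]; linarith
  have hbx' : ‖(b / ‖x‖ : ℝ)‖ < 1 := by
    rw [Real.norm_of_nonneg (by positivity), div_lt_one hx0]; linarith
  have hxb : x - b ≠ 0 := by
    intro h0
    rw [sub_eq_zero.1 h0, Complex.norm_real, Real.norm_of_nonneg hb] at hx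
    linarith
  have hz := norm_div_sub_lt hb hc hx
  -- With absolute values inside, x - b becomes ‖x‖ - b; the condition ‖x‖ > b + 2c is exactly what
  -- keeps c/(‖x‖ - b) in the disc of convergence.
  have hρ : c / (‖x‖ - b) < 1 / 2 := by
    rw [div_lt_iff₀ (by linarith)]; linarith
  have hρ0 : 0 ≤ c / (‖x‖ - b) := div_nonneg hc.le (by linarith)
  have hrow : ∀ m, HasSum (fun j => factorTerm b c k x (m, j))
      (((coeff (m + 1) (uPow (2 * k + 1)) : ℝ) : ℂ) / (2 * k + 1) * (c / (x - b)) ^ (m + 1)) := by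
    intro m
    have h := (hasSum_choose_mul_geometric_of_norm_lt_one m hbx).mul_left
      (((coeff (m + 1) (uPow (2 * k + 1)) : ℝ) : ℂ) / (2 * k + 1) * (c / x) ^ (m + 1))
    refine hasSum_congr h (fun _ => rfl) ?_
    rw [mul_assoc, one_div, ← inv_pow, ← mul_pow]
    congr 2
    field_simp
  have hrow' : ∀ m, HasSum (fun j => ‖factorTerm b c k x (m, j)‖)
      (|coeff (m + 1) (uPow (2 * k + 1))| / ‖(2 * k + 1 : ℂ)‖ * (c / (‖x‖ - b)) ^ (m + 1)) := by
    intro m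
    have h := (hasSum_choose_mul_geometric_of_norm_lt_one m hbx').mul_left
      (|coeff (m + 1) (uPow (2 * k + 1))| / ‖(2 * k + 1 : ℂ)‖ * (c / ‖x‖) ^ (m + 1))
    refine hasSum_congr h (fun j => ?_) ?_
    · simp only [factorTerm, norm_mul, norm_div, norm_pow, Complex.norm_real, Complex.norm_natCast,
        Real.norm_eq_abs, abs_of_nonneg hb, abs_of_pos hc]
    · rw [mul_assoc, one_div, ← inv_pow, ← mul_pow]
      congr 2
      have : ‖x‖ - b ≠ 0 := by linarith
      field_simp
  have hs : Summable fun p => ‖factorTerm b c k x p‖ := by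
    refine (summable_prod_of_nonneg fun p => norm_nonneg _).2 ⟨fun m => (hrow' m).summable, ?_⟩
    simp only [fun m => (hrow' m).tsum_eq]
    have h := ((summable_nat_add_iff 1).2 (pAbs_uPow hρ0 hρ (2 * k + 1))).mul_left
      (‖(2 * k + 1 : ℂ)‖⁻¹)
    refine h.congr fun m => ?_
    ring
  refine ⟨hs, ?_⟩
  have hF := hs.of_norm.hasSum
  have h1 := hF.prod_fiberwise hrow
  have h2 : HasSum (fun m => ((coeff (m + 1) (uPow (2 * k + 1)) : ℝ) : ℂ) / (2 * k + 1) *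
      (c / (x - b)) ^ (m + 1)) ((ev (uPow (2 * k + 1)) (c / (x - b)) - 1) / (2 * k + 1)) := by
    have h3 := (pAbs_uPow (norm_nonneg _) hz (2 * k + 1)).summable_norm.of_norm.hasSum
    have h4 := (hasSum_nat_add_iff' 1).2 h3
    have h5 := h4.div_const (2 * k + 1 : ℂ)
    rw [sum_range_one, pow_zero, mul_one, coeff_zero_eq_constantCoeff_apply, constantCoeff_uPow,
      Complex.ofReal_one] at h5
    refine hasSum_congr h5 (fun m => ?_) rfl
    ring
  rw [← h1.unique h2]
  exact hF

theorem hasSum_factor {b c : ℝ} (hb : 0 ≤ b) (hc : 0 < c) (k : ℤ) {x : ℂ}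
    (hx : b + 2 * c < ‖x‖) : (Summable fun n : ℕ+ => ‖factor b c k x n‖) ∧
      HasSum (fun n : ℕ+ => factor b c k x n)
        ((ev (uPow (2 * k + 1)) (c / (x - b)) - 1) / (2 * k + 1)) := by
  obtain ⟨h1, h2⟩ := hasSum_factorTerm hb hc k hx
  obtain ⟨h3, h4⟩ := hasSum_antidiagonal h1 h2
  simp only [← factor_succ] at h3 h4
  constructor
  · rw [← Equiv.pnatEquivNat.symm.summable_iff]
    exact h4
  · rw [← Equiv.pnatEquivNat.symm.hasSum_iff]
    exact h3

theorem hasSum_prod_fin {α : Type} (v : ℕ) (f : Fin v → α → ℂ) (s : Fin v → ℂ)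
    (hf : ∀ i, Summable fun n => ‖f i n‖) (hs : ∀ i, HasSum (f i) (s i)) :
    (Summable fun n : Fin v → α => ‖∏ i, f i (n i)‖) ∧
      HasSum (fun n : Fin v → α => ∏ i, f i (n i)) (∏ i, s i) := by
  induction v with
  | zero =>
    constructor
    · exact summable_of_hasFiniteSupport (Set.toFinite _)
    · simp
  | succ v ih =>
    obtain ⟨h1, h2⟩ := ih (fun i => f i.succ) (fun i => s i.succ) (fun i => hf _) fun i => hs _
    set G : (Fin v → α) → ℂ := fun n => ∏ i, f i.succ (n i) with hG
    have h4 : Summable fun p : α × (Fin v → α) => ‖f 0 p.1 * G p.2‖ := (hf 0).mul_norm h1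
    have h5 : HasSum (fun p : α × (Fin v → α) => f 0 p.1 * G p.2) (s 0 * ∏ i : Fin v, s i.succ) :=
      (hs 0).mul h2 h4.of_norm
    have he : ∀ p : α × (Fin v → α), ∏ i, f i ((Fin.consEquiv fun _ => α) p i) = f 0 p.1 * G p.2 :=
      fun p => Fin.prod_univ_succ _
    refine ⟨(Fin.consEquiv fun _ : Fin (v + 1) => α).summable_iff.1 (h4.congr fun p => ?_),
      (Fin.consEquiv fun _ : Fin (v + 1) => α).hasSum_iff.1 ?_⟩
    · simp only [Function.comp_apply]
      rw [he]
    · refine hasSum_congr h5 (fun p => ?_) (Fin.prod_univ_succ s)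
      simp only [Function.comp_apply]
      rw [he]

end Laplace
end BCMotzkin
end

noncomputable section
open PowerSeries Finset
namespace BCMotzkin

/-! ### The Laplace transform as a combination of products -/

section Factorization

variable {g v : ℕ}

theorem sum_list_sum {α β : Type*} (s : Finset β) (L : List α) (f : α → β → ℝ) :
    ∑ b ∈ s, (L.map fun a => f a b).sum = (L.map fun a => ∑ b ∈ s, f a b).sum := by
  induction L with
  | nil => simp
  | cons a L ih => simp only [List.map_cons, List.sum_cons, sum_add_distrib, ih]

/-- The generalized Motzkin numbers as a combination of products of one-variable sums. -/
theorem genMotzkin_eq_sum {L : List (ℝ × (Fin v → ℤ))}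
    (hL : ∀ μ, (genCatalan g μ : ℝ) = (L.map fun x => x.1 * prodE x.2 μ).sum)
    (b c : ℝ) (n : Fin v → ℕ) :
    genMotzkin g b c n = (L.map fun x => x.1 * ∏ i, ∑ m ∈ range (n i + 1),
      ((n i).choose m : ℝ) * eCoeff (x.2 i) m * b ^ (n i - m) * c ^ m).sum := by
  have h1 : ∀ μ ∈ Fintype.piFinset fun i => range (n i + 1),
      (∏ i, ((n i).choose (μ i) : ℝ)) * genCatalan g μ * b ^ ((∑ i, n i) - ∑ i, μ i) *
        c ^ (∑ i, μ i) = (L.map fun x => x.1 * ∏ i, (((n i).choose (μ i) : ℝ) *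
          eCoeff (x.2 i) (μ i) * b ^ (n i - μ i) * c ^ (μ i))).sum := by
    intro μ hμ
    have h2 : ∀ i ∈ univ, μ i ≤ n i := fun i _ => by
      have := Fintype.mem_piFinset.1 hμ i
      rw [mem_range] at this
      omega
    rw [hL, ← sum_tsub_distrib _ h2, ← prod_pow_eq_pow_sum, ← prod_pow_eq_pow_sum,
      ← List.sum_map_mul_left, ← List.sum_map_mul_right, ← List.sum_map_mul_right]
    refine congrArg List.sum (List.map_congr_left fun x _ => ?_)
    simp only [prodE, prod_mul_distrib]
    ring
  rw [genMotzkin, sum_congr rfl h1, sum_list_sum]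
  simp only [← mul_sum, prod_univ_sum]

theorem laplaceTerm_eq_sum {L : List (ℝ × (Fin v → ℤ))}
    (hL : ∀ μ, (genCatalan g μ : ℝ) = (L.map fun x => x.1 * prodE x.2 μ).sum)
    (b c : ℝ) (x : Fin v → ℂ) (n : Fin v → ℕ+) :
    laplaceTerm g b c x n =
      (L.map fun y => (y.1 : ℂ) * ∏ i, factor b c (y.2 i) (x i) (n i)).sum := by
  rw [laplaceTerm, genMotzkin_eq_sum hL, ← Complex.ofRealHom_eq_coe, map_list_sum, List.map_map,
    div_eq_mul_inv, ← List.sum_map_mul_right, ← List.sum_map_mul_right]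
  refine congrArg List.sum (List.map_congr_left fun y _ => ?_)
  simp only [Function.comp_apply, Complex.ofRealHom_eq_coe, factor, prod_mul_distrib, prod_div_distrib]
  push_cast
  ring

theorem hasSum_list_sum {α β : Type*} (L : List α) {f : α → β → ℂ} {s : α → ℂ}
    (hf : ∀ a ∈ L, HasSum (f a) (s a)) :
    HasSum (fun x => (L.map fun a => f a x).sum) (L.map s).sum := by
  induction L with
  | nil => simp
  | cons a L ih =>
    simp only [List.map_cons, List.sum_cons]
    exact (hf a List.mem_cons_self).add (ih fun a' h => hf a' (List.mem_cons_of_mem a h))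

/-- The value of the Laplace transform as a combination of products of odd powers. -/
theorem hasSum_laplaceTerm {L : List (ℝ × (Fin v → ℤ))}
    (hL : ∀ μ, (genCatalan g μ : ℝ) = (L.map fun x => x.1 * prodE x.2 μ).sum)
    {b c : ℝ} (hb : 0 ≤ b) (hc : 0 < c) {t : Fin v → ℂ}
    (ht : ∀ i, (t i).re < 0 ∧ t i ≠ -1 ∧ b + 2 * c < ‖xOfT b c (t i)‖) :
    HasSum (laplaceTerm g b c fun i => xOfT b c (t i))
      (L.map fun y => (y.1 : ℂ) *
        ∏ i, -(t i ^ (2 * y.2 i + 1) + 1) / (2 * y.2 i + 1 : ℂ)).sum := by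
  have hv : ∀ (i : Fin v) (k : ℤ), ev (uPow (2 * k + 1)) (c / (xOfT b c (t i) - b)) =
      - t i ^ (2 * k + 1) := by
    intro i k
    obtain ⟨h1, h2, h3⟩ := ht i
    have hc' : (c : ℂ) ≠ 0 := Complex.ofReal_ne_zero.2 hc.ne'
    have h4 : t i ^ 2 - 1 ≠ 0 := by
      intro h
      rcases mul_self_eq_one_iff.1 ((sq (t i)).symm.trans (sub_eq_zero.1 h)) with h | h
      · rw [h] at h1; norm_num at h1
      · exact h2 h
    have hx : xOfT b c (t i) - b = c * (2 * (t i ^ 2 + 1) / (t i ^ 2 - 1)) := by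
      rw [xOfT]; field_simp; ring
    have hz := norm_div_sub_lt hb hc h3
    have hne : t i ^ 2 + 1 ≠ 0 := by
      intro h
      rw [h, mul_zero, zero_div, mul_zero] at hx
      rw [sub_eq_zero.1 hx, Complex.norm_real, Real.norm_of_nonneg hb] at h3
      linarith
    -- -t satisfies the quadratic equation of u at z = c/(x - b) and has positive real part, so u =
    -- -t.
    have hzt : 2 * (c / (xOfT b c (t i) - b)) * ((-t i) ^ 2 + 1) = (-t i) ^ 2 - 1 := by
      rw [hx, neg_sq]; field_simp
    rw [ev_uPow hz, ev_uPow_one_eq (t := -t i) (by simpa using h1) hz hzt]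
    exact Odd.neg_zpow ⟨k, rfl⟩ _
  rw [show laplaceTerm g b c (fun i => xOfT b c (t i)) = fun n => _ from
    funext (laplaceTerm_eq_sum hL b c _)]
  refine hasSum_list_sum L fun y _ => HasSum.mul_left _ ?_
  refine (hasSum_prod_fin v (fun i (n : ℕ+) => factor b c (y.2 i) (xOfT b c (t i)) n) _
    (fun i => (hasSum_factor hb hc _ (ht i).2.2).1) fun i => ?_).2
  have h := (hasSum_factor hb hc (y.2 i) (ht i).2.2).2
  rw [hv] at h
  refine hasSum_congr h (fun _ => rfl) ?_
  ring

end Factorization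
end BCMotzkin
end

noncomputable section
open PowerSeries Finset
namespace BCMotzkin

/-! ### The Laurent polynomial and its degree -/

section Laurent

variable {v : ℕ}

theorem MvLaurent.eval_single (a : Fin v → ℤ) (r : ℂ) (t : Fin v → ℂ) :
    MvLaurent.eval (AddMonoidAlgebra.single a r) t = r * ∏ i, t i ^ a i :=
  Finsupp.sum_single_index (zero_mul _)

theorem MvLaurent.eval_add (P Q : MvLaurent v) (t : Fin v → ℂ) :
    MvLaurent.eval (P + Q) t = P.eval t + Q.eval t :=
  Finsupp.sum_add_index' (fun _ => zero_mul _) fun _ _ _ => add_mul _ _ _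

theorem MvLaurent.eval_zero (t : Fin v → ℂ) : MvLaurent.eval (0 : MvLaurent v) t = 0 :=
  Finsupp.sum_zero_index

/-- Evaluation of Laurent polynomials as an additive map. -/
def MvLaurent.evalHom (t : Fin v → ℂ) : MvLaurent v →+ ℂ where
  toFun P := P.eval t
  map_zero' := MvLaurent.eval_zero t
  map_add' P Q := MvLaurent.eval_add P Q t

/-- The coefficient of a Laurent polynomial as an additive map. -/
def coeffHom (a : Fin v → ℤ) : MvLaurent v →+ ℂ where
  toFun P := P.coeff a
  map_zero' := rfl
  map_add' _ _ := rfl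

/-- The exponent vector that is `2 k i + 1` at `i ∈ A` and `0` elsewhere. -/
def oddExponent (k : Fin v → ℤ) (A : Finset (Fin v)) (i : Fin v) : ℤ :=
  if i ∈ A then 2 * k i + 1 else 0

/-- The Laurent polynomial `r ∏ i, -(t i ^ (2 k i + 1) + 1) / (2 k i + 1)`. -/
def oddLaurent (r : ℝ) (k : Fin v → ℤ) : MvLaurent v :=
  ∑ A : Finset (Fin v), AddMonoidAlgebra.single (oddExponent k A)
    ((r : ℂ) * ∏ i, -(1 / (2 * k i + 1 : ℂ)))

theorem eval_oddLaurent (r : ℝ) (k : Fin v → ℤ) (t : Fin v → ℂ) :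
    (oddLaurent r k).eval t =
      (r : ℂ) * ∏ i, -(t i ^ (2 * k i + 1) + 1) / (2 * k i + 1 : ℂ) := by
  have h1 : (oddLaurent r k).eval t = MvLaurent.evalHom t (oddLaurent r k) := rfl
  rw [h1, oddLaurent, map_sum]
  have h2 : ∀ i, -(t i ^ (2 * k i + 1) + 1) / (2 * k i + 1 : ℂ) =
      -(1 / (2 * k i + 1 : ℂ)) * (t i ^ (2 * k i + 1) + 1) := fun i => by ring
  simp only [h2, prod_mul_distrib]
  rw [prod_add_one, powerset_univ, ← mul_assoc, mul_sum]
  refine sum_congr rfl fun A _ => ?_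
  refine (MvLaurent.eval_single _ _ _).trans ?_
  congr 1
  have h3 : ∀ i, t i ^ oddExponent k A i = if i ∈ A then t i ^ (2 * k i + 1) else 1 := fun i => by
    rw [oddExponent]
    split_ifs
    · rfl
    · exact zpow_zero _
  rw [prod_congr rfl fun i _ => h3 i, prod_ite_mem, univ_inter]

theorem coeff_oddLaurent (r : ℝ) (k a : Fin v → ℤ) :
    (oddLaurent r k).coeff a = ∑ A : Finset (Fin v), if oddExponent k A = a then
      (r : ℂ) * ∏ i, -(1 / (2 * k i + 1 : ℂ)) else 0 := by
  have h1 : (oddLaurent r k).coeff a = coeffHom a (oddLaurent r k) := rfl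
  rw [h1, oddLaurent, map_sum]
  exact sum_congr rfl fun A _ => Finsupp.single_apply

theorem sum_oddExponent_le (k : Fin v → ℤ) (A : Finset (Fin v)) :
    ∑ i, oddExponent k A i ≤ oddWeight k := by
  refine sum_le_sum fun i _ => ?_
  rw [oddExponent]
  split_ifs
  · exact le_max_left _ _
  · exact le_max_right _ _

/-- An exponent vector with all entries odd has no zero entry, so it can only come from the full
subset, and it determines k. -/
theorem coeff_oddLaurent_odd (r : ℝ) (k l : Fin v → ℤ) :
    (oddLaurent r k).coeff (fun i => 2 * l i + 1) =
      ((if k = l then r else 0 : ℝ) : ℂ) * ∏ i, -(1 / (2 * l i + 1 : ℂ)) := by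
  rw [coeff_oddLaurent]
  have h1 : ∀ A, oddExponent k A = (fun i => 2 * l i + 1) ↔ A = univ ∧ k = l := by
    intro A
    constructor
    · intro h
      have h2 : ∀ i, i ∈ A ∧ k i = l i := fun i => by
        have h3 := congrFun h i
        rw [oddExponent] at h3
        split_ifs at h3 with h4
        · exact ⟨h4, by omega⟩
        · omega
      exact ⟨eq_univ_iff_forall.2 fun i => (h2 i).1, funext fun i => (h2 i).2⟩
    · rintro ⟨rfl, rfl⟩
      funext i
      rw [oddExponent, if_pos (mem_univ i)]
  rw [sum_eq_single univ]
  · simp only [h1, true_and]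
    split_ifs with h
    · rw [h]
    · simp
  · intro A _ hA
    rw [if_neg fun h => hA ((h1 A).1 h).1]
  · exact fun h => absurd (mem_univ _) h

/-- The upper bound is the weight. For a top exponent vector, the coefficient is a nonzero number
depending only on the vector, times a sum of nonnegative reals of which one is positive. -/
theorem hasDegree_sum {d : ℤ} {L : List (ℝ × (Fin v → ℤ))}
    (hL : ∀ x ∈ L, oddWeight x.2 ≤ d ∧ (oddSum x.2 = d → 0 ≤ x.1))
    (htop : ∃ x ∈ L, oddSum x.2 = d ∧ 0 < x.1) :
    MvLaurent.HasDegree (L.map fun x => oddLaurent x.1 x.2).sum d := by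
  have hc : ∀ a, (L.map fun x => oddLaurent x.1 x.2).sum.coeff a =
      (L.map fun x => (oddLaurent x.1 x.2).coeff a).sum := fun a => by
    have := map_list_sum (coeffHom a) (L.map fun x => oddLaurent x.1 x.2)
    rw [List.map_map] at this
    exact this
  constructor
  · obtain ⟨y, hy, hyd, hpos⟩ := htop
    refine ⟨fun i => 2 * y.2 i + 1, ?_, hyd.symm⟩
    rw [Finsupp.mem_support_iff, hc]
    simp only [coeff_oddLaurent_odd, List.sum_map_mul_right]
    refine mul_ne_zero ?_ (prod_ne_zero_iff.2 fun i _ => neg_ne_zero.2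
      (one_div_ne_zero (two_mul_add_one_ne_zero ℂ _)))
    have h1 := map_list_sum Complex.ofRealHom (L.map fun x => if x.2 = y.2 then x.1 else 0)
    rw [List.map_map] at h1
    refine fun h0 => (ne_of_gt (?_ : 0 < (L.map fun x => if x.2 = y.2 then x.1 else 0).sum))
      (Complex.ofReal_eq_zero.1 (h1.trans h0))
    refine hpos.trans_le (List.single_le_sum ?_ _ (List.mem_map.2 ⟨y, hy, if_pos rfl⟩))
    intro r hr
    obtain ⟨x, hx, rfl⟩ := List.mem_map.1 hr
    split_ifs with h
    · exact (hL x hx).2 (h ▸ hyd)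
    · exact le_rfl
  · rintro _ ⟨a, ha, rfl⟩
    rw [Finsupp.mem_support_iff, hc] at ha
    obtain ⟨x, hx, hx0⟩ : ∃ x ∈ L, (oddLaurent x.1 x.2).coeff a ≠ 0 := by
      by_contra! h
      refine ha (List.sum_eq_zero fun r hr => ?_)
      obtain ⟨x, hx, rfl⟩ := List.mem_map.1 hr
      exact h x hx
    rw [coeff_oddLaurent] at hx0
    obtain ⟨A, _, hA⟩ := exists_ne_zero_of_sum_ne_zero hx0
    have h2 : oddExponent x.2 A = a := by
      by_contra h
      exact hA (if_neg h)
    rw [← h2]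
    exact (sum_oddExponent_le _ _).trans (hL x hx).1

end Laurent

/-! ### Extending the inversion symmetry from negative real points -/

section Reciprocity

variable {v : ℕ}

/-- Laurent polynomial expressions in one variable that agree on a set with infinitely many nonzero
points agree at all nonzero points. -/
theorem laurent_eq_of_infinite {ι : Type*} (s : Finset ι) (c : ι → ℂ) (n : ι → ℤ) {S : Set ℂ}
    (hS : S.Infinite) (hS0 : ∀ z ∈ S, z ≠ 0 ∧ ∑ j ∈ s, c j * z ^ n j = 0) {z : ℂ} (hz : z ≠ 0) :
    ∑ j ∈ s, c j * z ^ n j = 0 := by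
  obtain ⟨N, hN⟩ : ∃ N : ℕ, ∀ j ∈ s, 0 ≤ n j + N :=
    ⟨s.sup fun j => (n j).natAbs, fun j hj => by
      have := le_sup (f := fun j => (n j).natAbs) hj
      omega⟩
  let p : Polynomial ℂ := ∑ j ∈ s, Polynomial.C (c j) * Polynomial.X ^ (n j + N).toNat
  have hp : ∀ w : ℂ, w ≠ 0 → p.eval w = (∑ j ∈ s, c j * w ^ n j) * w ^ N := by
    intro w hw
    rw [Polynomial.eval_finsetSum, sum_mul]
    refine sum_congr rfl fun j hj => ?_
    rw [Polynomial.eval_mul, Polynomial.eval_C, Polynomial.eval_pow, Polynomial.eval_X, mul_assoc,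
      ← zpow_natCast w (Int.toNat _), Int.toNat_of_nonneg (hN j hj), zpow_add₀ hw, zpow_natCast]
  have hp0 : p = 0 := Polynomial.eq_zero_of_infinite_isRoot p (hS.mono fun w hw => by
    rw [Set.mem_ofPred_eq, Polynomial.IsRoot, hp w (hS0 w hw).1, (hS0 w hw).2, zero_mul])
  have h := hp z hz
  rw [hp0, Polynomial.eval_zero] at h
  exact (mul_eq_zero.1 h.symm).resolve_right (pow_ne_zero N hz)

/-- The negative real points other than `-1`. -/
def negReal : Set ℂ := {z | ∃ r : ℝ, r < 0 ∧ r ≠ -1 ∧ z = r}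

theorem negReal_infinite : negReal.Infinite := by
  have h : ((fun r : ℝ => (r : ℂ)) '' Set.Iio (-1)).Infinite :=
    (Set.Iio_infinite (-1)).image Complex.ofReal_injective.injOn
  refine h.mono ?_
  rintro _ ⟨r, hr, rfl⟩
  rw [Set.mem_Iio] at hr
  exact ⟨r, by linarith, hr.ne, rfl⟩

/-- A Laurent polynomial that is symmetric under inversion at negative real points is so
everywhere. -/
theorem MvLaurent.eval_inv_of_negReal (P : MvLaurent v)
    (h : ∀ t : Fin v → ℂ, (∀ i, t i ∈ negReal) → P.eval (fun i => (t i)⁻¹) = P.eval t)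
    (t : Fin v → ℂ) (ht : ∀ i, t i ≠ 0) : P.eval (fun i => (t i)⁻¹) = P.eval t := by
  -- The coordinates in A are arbitrary nonzero numbers, the others still negative reals; they are
  -- freed one at a time by the one-variable statement.
  have key : ∀ (A : Finset (Fin v)) (t : Fin v → ℂ), (∀ i ∈ A, t i ≠ 0) →
      (∀ i ∉ A, t i ∈ negReal) → P.eval (fun i => (t i)⁻¹) = P.eval t := by
    intro A
    induction A using Finset.induction_on with
    | empty => exact fun t _ h2 => h t fun i => h2 i (notMem_empty i)
    | insert j A hj ih =>
      intro t h1 h2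
      have he : ∀ z : ℂ, P.eval (Function.update t j z) =
          ∑ a ∈ P.coeff.support, (P.coeff a * ∏ i ∈ univ.erase j, t i ^ a i) * z ^ a j := by
        intro z
        rw [MvLaurent.eval, Finsupp.sum]
        refine sum_congr rfl fun a _ => ?_
        rw [← mul_prod_erase univ _ (mem_univ j), Function.update_self,
          prod_congr rfl fun i hi => by rw [Function.update_of_ne (ne_of_mem_erase hi)]]
        ring
      have he' : ∀ z : ℂ, P.eval (fun i => (Function.update t j z i)⁻¹) =
          ∑ a ∈ P.coeff.support, (P.coeff a * ∏ i ∈ univ.erase j, (t i)⁻¹ ^ a i) * z ^ (-a j) := by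
        intro z
        rw [MvLaurent.eval, Finsupp.sum]
        refine sum_congr rfl fun a _ => ?_
        rw [← mul_prod_erase univ _ (mem_univ j), Function.update_self,
          prod_congr rfl fun i hi => by rw [Function.update_of_ne (ne_of_mem_erase hi)], inv_zpow,
          zpow_neg]
        ring
      have hcomb : ∀ z : ℂ, P.eval (fun i => (Function.update t j z i)⁻¹) -
          P.eval (Function.update t j z) = ∑ x ∈ P.coeff.support.disjSum P.coeff.support,
            Sum.elim (fun a => P.coeff a * ∏ i ∈ univ.erase j, (t i)⁻¹ ^ a i)
              (fun a => -(P.coeff a * ∏ i ∈ univ.erase j, t i ^ a i)) x *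
            z ^ Sum.elim (fun a : Fin v → ℤ => -a j) (fun a => a j) x := by
        intro z
        rw [sum_disjSum, he, he', sub_eq_add_neg, ← sum_neg_distrib]
        simp only [Sum.elim_inl, Sum.elim_inr, neg_mul]
      have h0 := hcomb (t j)
      rw [Function.update_eq_self] at h0
      refine sub_eq_zero.1 (h0.trans (laurent_eq_of_infinite _ _ _ negReal_infinite
        (fun z hz => ⟨?_, ?_⟩) (h1 j (mem_insert_self j A))))
      · obtain ⟨r, hr, _, rfl⟩ := hz
        exact Complex.ofReal_ne_zero.2 hr.ne
      · rw [← hcomb, sub_eq_zero]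
        refine ih _ (fun i hi => ?_) fun i hi => ?_
        · rw [Function.update_of_ne fun h : i = j => hj (h ▸ hi)]
          exact h1 i (mem_insert_of_mem hi)
        · by_cases hij : i = j
          · rw [hij, Function.update_self]
            exact hz
          · rw [Function.update_of_ne hij]
            exact h2 i fun h => (mem_insert.1 h).elim hij hi
  exact key univ t (fun i _ => ht i) fun i hi => absurd (mem_univ i) hi

end Reciprocity
end BCMotzkin
end

noncomputable section
open PowerSeries Finset
namespace BCMotzkin

/-! ### The case b = 0, c = 1 -/

section SpecialValue

variable {g v : ℕ}

/-- A power of b = 0 is nonzero only for exponent 0, which forces μ = n. -/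
theorem genMotzkin_zero_one (n : Fin v → ℕ) : genMotzkin g 0 1 n = genCatalan g n := by
  rw [genMotzkin, sum_eq_single n]
  · simp
  · intro μ hμ hne
    have h1 : ∀ i, μ i ≤ n i := fun i => by
      have := Fintype.mem_piFinset.1 hμ i
      rw [mem_range] at this
      omega
    have h2 : ∑ i, μ i < ∑ i, n i := by
      refine sum_lt_sum (fun i _ => h1 i) ?_
      by_contra! h
      exact hne (funext fun i => le_antisymm (h1 i) (h i (mem_univ i)))
    rw [zero_pow (by omega), mul_zero, zero_mul]
  · intro h
    exact absurd (Fintype.mem_piFinset.2 fun i => by simp) h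

/-- The signs multiply to (-1)^(∑ n i), and a nonzero Catalan number has even degree sum. -/
theorem laplaceTerm_neg (hv : 1 ≤ v) (x : Fin v → ℂ) (n : Fin v → ℕ+) :
    laplaceTerm g 0 1 (fun i => -x i) n = laplaceTerm g 0 1 x n := by
  rw [laplaceTerm, laplaceTerm, genMotzkin_zero_one]
  by_cases h0 : genCatalan g (fun i => (n i : ℕ)) = 0
  · rw [h0]; simp
  rw [genCatalan_eq_cat hv] at h0
  obtain ⟨E, F, hE, -⟩ := cat_ne_zero h0
  congr 1
  have h1 : ∀ i, (-x i) ^ (-((n i : ℕ) : ℤ)) =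
      (-1) ^ (n i : ℕ) * x i ^ (-((n i : ℕ) : ℤ)) := fun i => by
    rw [neg_eq_neg_one_mul, mul_zpow, zpow_neg, zpow_natCast, ← inv_pow, inv_neg_one]
  simp only [h1, prod_mul_distrib]
  rw [prod_pow_eq_pow_sum, hE, pow_mul, neg_one_sq, one_pow, one_mul]

theorem xOfT_zero_one_inv {t : ℂ} (ht : t ≠ 0) (h : t ^ 2 - 1 ≠ 0) :
    xOfT 0 1 t⁻¹ = -xOfT 0 1 t := by
  have h' : (t⁻¹) ^ 2 - 1 = -(t ^ 2 - 1) / t ^ 2 := by field_simp; ring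
  rw [xOfT, xOfT, h']
  simp only [Complex.ofReal_zero, Complex.ofReal_one]
  field_simp
  ring

theorem two_lt_norm_xOfT {r : ℝ} (h0 : r < 0) (h1 : r ≠ -1) : 2 < ‖xOfT 0 1 (r : ℂ)‖ := by
  have h2 : r ^ 2 - 1 ≠ 0 := fun h => by
    rcases mul_self_eq_one_iff.1 ((sq r).symm.trans (sub_eq_zero.1 h)) with h | h
    · linarith
    · exact h1 h
  have h3 : xOfT 0 1 (r : ℂ) = ((2 * (r ^ 2 + 1) / (r ^ 2 - 1) : ℝ) : ℂ) := by
    rw [xOfT, show (2 * (r ^ 2 + 1) / (r ^ 2 - 1) : ℝ) = 2 + 4 / (r ^ 2 - 1) by field_simp; ring]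
    push_cast
    ring
  rw [h3, Complex.norm_real, Real.norm_eq_abs, abs_div, lt_div_iff₀ (abs_pos.2 h2),
    abs_of_pos (a := 2 * (r ^ 2 + 1)) (by positivity)]
  have : |r ^ 2 - 1| < r ^ 2 + 1 := abs_lt.2 ⟨by nlinarith [pow_pos (neg_pos.2 h0) 2], by linarith⟩
  linarith

end SpecialValue
end BCMotzkin
end

theorem mainTheorem5 (g v : ℕ) (hv : 1 ≤ v) (hgv : 0 < 2 * (g : ℤ) - 2 + v)
    (b c : ℝ) (hb : 0 ≤ b) (hc : 0 < c) :
    ∃ P : BCMotzkin.MvLaurent v,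
      (∀ t : Fin v → ℂ,
        (∀ i, (t i).re < 0 ∧ t i ≠ -1 ∧ b + 2 * c < ‖BCMotzkin.xOfT b c (t i)‖) →
          Summable (BCMotzkin.laplaceTerm g b c fun i => BCMotzkin.xOfT b c (t i)) ∧
          BCMotzkin.discreteLaplace g b c (fun i => BCMotzkin.xOfT b c (t i)) = P.eval t) ∧
      P.HasDegree (3 * (2 * (g : ℤ) - 2 + v)) ∧
      ∀ t : Fin v → ℂ, (∀ i, t i ≠ 0) → P.eval (fun i => (t i)⁻¹) = P.eval t := by
  obtain ⟨L, hL, hdeg, htop⟩ := BCMotzkin.exists_expansion g v hv hgv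
  have hP : ∀ t, (L.map fun x => BCMotzkin.oddLaurent x.1 x.2).sum.eval t =
      (L.map fun y => (y.1 : ℂ) *
        ∏ i, -(t i ^ (2 * y.2 i + 1) + 1) / (2 * y.2 i + 1 : ℂ)).sum := fun t => by
    have h := map_list_sum (BCMotzkin.MvLaurent.evalHom t)
      (L.map fun x => BCMotzkin.oddLaurent x.1 x.2)
    rw [List.map_map] at h
    refine h.trans (congrArg List.sum (List.map_congr_left fun x _ => ?_))
    exact BCMotzkin.eval_oddLaurent x.1 x.2 t
  have hsum : ∀ {b c : ℝ}, 0 ≤ b → 0 < c → ∀ t : Fin v → ℂ,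
      (∀ i, (t i).re < 0 ∧ t i ≠ -1 ∧ b + 2 * c < ‖BCMotzkin.xOfT b c (t i)‖) →
      HasSum (BCMotzkin.laplaceTerm g b c fun i => BCMotzkin.xOfT b c (t i))
        ((L.map fun x => BCMotzkin.oddLaurent x.1 x.2).sum.eval t) := fun hb hc t ht => by
    rw [hP]
    exact BCMotzkin.hasSum_laplaceTerm hL hb hc ht
  refine ⟨_, fun t ht => ⟨(hsum hb hc t ht).summable, ?_⟩, BCMotzkin.hasDegree_sum hdeg htop,
    BCMotzkin.MvLaurent.eval_inv_of_negReal _ fun t ht => ?_⟩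
  -- The logarithmic term belongs to (g, v) = (0, 1), which is unstable.
  · rw [BCMotzkin.discreteLaplace, if_neg, sub_zero]
    · exact (hsum hb hc t ht).tsum_eq
    · rintro ⟨rfl, rfl⟩
      norm_num at hgv
  -- The Laurent polynomial was built from L alone, so its symmetry may be tested with b = 0 and c =
  -- 1, whatever the given b and c are.
  · choose r hr0 hr1 hr using ht
    obtain rfl : t = fun i => (r i : ℂ) := funext hr
    have h2 : ∀ i, (r i : ℂ) ^ 2 - 1 ≠ 0 := fun i h => by
      have h : r i ^ 2 - 1 = 0 := by exact_mod_cast h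
      rcases mul_self_eq_one_iff.1 ((sq (r i)).symm.trans (sub_eq_zero.1 h)) with h | h
      · linarith [hr0 i]
      · exact hr1 i h
    have hx : ∀ i, BCMotzkin.xOfT 0 1 ((r i : ℂ)⁻¹) = -BCMotzkin.xOfT 0 1 (r i : ℂ) := fun i =>
      BCMotzkin.xOfT_zero_one_inv (Complex.ofReal_ne_zero.2 (hr0 i).ne) (h2 i)
    have hn : ∀ i, (0 : ℝ) + 2 * 1 < ‖BCMotzkin.xOfT 0 1 (r i : ℂ)‖ := fun i => by
      rw [zero_add, mul_one]
      exact BCMotzkin.two_lt_norm_xOfT (hr0 i) (hr1 i)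
    -- Both t and 1/t lie in the domain of convergence, and the two series have the same terms;
    -- hence the values of the polynomial agree.
    have s1 := hsum le_rfl one_pos (fun i => (r i : ℂ)) fun i =>
      ⟨by simpa using hr0 i, by exact_mod_cast hr1 i, hn i⟩
    have s2 := hsum le_rfl one_pos (fun i => (r i : ℂ)⁻¹) fun i =>
      ⟨by rw [← Complex.ofReal_inv, Complex.ofReal_re]; exact inv_lt_zero.2 (hr0 i),
        fun h => hr1 i (by
          rw [inv_eq_iff_eq_inv, inv_neg, inv_one] at h
          exact_mod_cast h), by rw [hx, norm_neg]; exact hn i⟩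
    simp only [hx] at s2
    rw [show BCMotzkin.laplaceTerm g 0 1 (fun i => -BCMotzkin.xOfT 0 1 (r i : ℂ)) =
      BCMotzkin.laplaceTerm g 0 1 (fun i => BCMotzkin.xOfT 0 1 (r i : ℂ)) from
      funext (BCMotzkin.laplaceTerm_neg hv _)] at s2
    exact s2.unique s1
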